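/- **Melodies, matching, scaling.** A melody of $n\ge 1$ notes in point representation is a sequence of points $(x_1,p_1),\dots,(x_n,p_n)$ in the time–pitch plane with $0\le x_1<\dots<x_n\le D$, where $D$ is the duration of the melody (for instance, the midpoints of the segments of a melody in segment representation). Let $A=(A_1,\dots,A_n)$ and $B=(B_1,\dots,B_m)$ be sequences of points with strictly increasing time coordinates. A point $a$ is *assigned* to a point of $B$ as follows: to $B_1$ if it is earlier than all points of $B$; to $B_m$ if it is later than all of them; to $B_j$ if it has the same time as $B_j$; and, if it lies strictly between $B_j$ and $B_{j+1}$ in time, to the one nearer in time, where, if $a$ is on the bisector, it is assigned to the one with the smaller Manhattan ($l_1$) distance to $a$, and to $B_j$ in case of a tie. In the *$t$-monotone matching* between $A$ and $B$ every $A_i$ is matched to the point of $B$ it is assigned to, and every $B_j$ to which no $A_i$ is assigned is matched to the point of $A$ to which $B_j$ is assigned by the same rule. Its cost $\phi(A,B)$ is the sum of the $l_1$-distances of the matched pairs. Let $R=\{(x_i,p_i)\}_{i=1}^n$ (the reference, of duration $X$) and $Q=\{(t_j,q_j)\}_{j=1}^m$ (the query, of duration $T$) be melodies in point representation, $n,m\ge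 1$. The $\varepsilon$-scaling of $Q$ is $S_Q(\varepsilon)=\{(t_j(\varepsilon),q_j)\}_{j=1}^m$ with $t_j(\varepsilon)=t_j+\frac{2j-1}{2}\varepsilon$. If $T\le X$, the admissible scalings are those in $I=[0,(X-T)/m]$. An *event* is a value $\varepsilon>0$ such that, for some $i,j$, (type 1) $t_j(\varepsilon)=x_i$, or (type 2) $\frac{t_j(\varepsilon)+t_{j+1}(\varepsilon)}2=x_i$, or (type 3) $t_j(\varepsilon)=\frac{x_i+x_{i+1}}2$ and no note of $R$ is assigned to the $j$-th note of $S_Q(\varepsilon)$. **Theorem.** 1. There are $O(nm)$ events, and $\varepsilon\mapsto\phi(R,S_Q(\varepsilon))$ is an affine function on every open interval in $(0,\infty)$ that contains no event. 2. The cost may be discontinuous at an event: there are $R$, $Q$ with $T<X$ and an event in the interior of $I$ at which $\varepsilon\mapsto\phi(R,S_Q(\varepsilon))$ is not continuous. 3. There is a real-RAM program (unit-cost exact arithmetic and comparison of reals, integer addition, subtraction and comparison, indirect addressing) that, for all $n,m\ge1$ and all $R,Q$ with $T\le X$, given the notes in chronological order and the durations, computes in $O(nm\log(m+1))$ time (that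 is, $O(nm\log m)$ for $m\ge2$) an optimal scaling, in the following sense: it outputs $v=\inf_{\varepsilon\in I}\phi(R,S_Q(\varepsilon))$ and some $\varepsilon^*\in I$ such that $\varepsilon^*$ minimises $\phi(R,S_Q(\varepsilon))$ over $I$ whenever a minimiser exists; if none exists (which the discontinuities permit), $v$ is the limit of $\phi(R,S_Q(\varepsilon))$ as $\varepsilon\to\varepsilon^*$ from one side within $I$, and the program reports that this is the case and from which side. -/

import Mathlib

/-! ## Melodies in point representation and the `t`-monotone matching -/

/-- A melody of `n` notes in point representation: the note `i` is the point
`(time i, pitch i)`, the notes are in chronological order, and the melody occupies the time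
interval `[0, duration]`. Midpoints (and also endpoints) of the notes of a melody in segment
representation have this form. -/
structure PointMelody (n : ℕ) where
  time : Fin n → ℝ
  pitch : Fin n → ℝ
  duration : ℝ
  time_strictMono : StrictMono time
  time_nonneg : ∀ i, 0 ≤ time i
  time_le_duration : ∀ i, time i ≤ duration

namespace PointMelody

/-- The notes as points of the time-pitch plane. -/
def notes {n : ℕ} (R : PointMelody n) (i : Fin n) : ℝ × ℝ := (R.time i, R.pitch i)

/-- `t_j(ε) = t_j + (2 j - 1) / 2 * ε`; since `j : Fin m` counts from `0`, the factor reads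
`(2 j + 1) / 2`. -/
noncomputable def scaledTime {m : ℕ} (Q : PointMelody m) (ε : ℝ) (j : Fin m) : ℝ :=
  Q.time j + (2 * ((j : ℕ) : ℝ) + 1) / 2 * ε

/-- The notes of the `ε`-scaling `S_Q(ε)`. -/
noncomputable def scaledNotes {m : ℕ} (Q : PointMelody m) (ε : ℝ) (j : Fin m) : ℝ × ℝ :=
  (Q.scaledTime ε j, Q.pitch j)

end PointMelody

/-- The Manhattan distance in the plane. -/
def manhattan (a b : ℝ × ℝ) : ℝ := |a.1 - b.1| + |a.2 - b.2|

open Classical in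
/-- `B j` is the `t`-monotone nearest point of `a` in the chronological sequence `B`. -/
def Assigned {k : ℕ} (a : ℝ × ℝ) (B : Fin k → ℝ × ℝ) (j : Fin k) : Prop :=
  ((∀ l, a.1 < (B l).1) ∧ ∀ l, j ≤ l) ∨
  ((∀ l, (B l).1 < a.1) ∧ ∀ l, l ≤ j) ∨
  a.1 = (B j).1 ∨
  ∃ l r : Fin k, (r : ℕ) = l + 1 ∧ (B l).1 < a.1 ∧ a.1 < (B r).1 ∧
    ((a.1 < ((B l).1 + (B r).1) / 2 ∧ j = l) ∨
     (((B l).1 + (B r).1) / 2 < a.1 ∧ j = r) ∨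
     (a.1 = ((B l).1 + (B r).1) / 2 ∧
        j = if manhattan a (B r) < manhattan a (B l) then r else l))

/-- No point of `A` is assigned to `B j`. -/
def Unmatched {n m : ℕ} (A : Fin n → ℝ × ℝ) (B : Fin m → ℝ × ℝ) (j : Fin m) : Prop :=
  ∀ i, ¬ Assigned (A i) B j

/-- The pairs of the `t`-monotone matching between `A` and `B`: every point of `A` is assigned to
its nearest point of `B`, and then every unmatched point of `B` to its nearest point of `A`. -/
def Matched {n m : ℕ} (A : Fin n → ℝ × ℝ) (B : Fin m → ℝ × ℝ) (i : Fin n) (j : Fin m) : Prop :=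
  Assigned (A i) B j ∨ (Unmatched A B j ∧ Assigned (B j) A i)

open Classical in
/-- The cost `φ(B j)` of one point of `B`. -/
noncomputable def noteCost {n m : ℕ} (A : Fin n → ℝ × ℝ) (B : Fin m → ℝ × ℝ) (j : Fin m) : ℝ :=
  ∑ i, if Matched A B i j then manhattan (A i) (B j) else 0

/-- The cost `φ(A, B)` of the `t`-monotone matching. -/
noncomputable def matchingCost {n m : ℕ} (A : Fin n → ℝ × ℝ) (B : Fin m → ℝ × ℝ) : ℝ :=
  ∑ j, noteCost A B j

/-- `φ(R, S_Q(ε))` as a function of `ε`. -/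
noncomputable def scalingCost {n m : ℕ} (R : PointMelody n) (Q : PointMelody m) (ε : ℝ) : ℝ :=
  matchingCost R.notes (Q.scaledNotes ε)

/-- The admissible scalings: the query, whose duration grows by `m * ε`, is scaled at most until
it is as long as the reference. -/
def scalingRange {n m : ℕ} (R : PointMelody n) (Q : PointMelody m) : Set ℝ :=
  Set.Icc 0 ((R.duration - Q.duration) / m)

/-! ## Events -/

/-- Type 1: a note of the scaled query is simultaneous with a note of the reference. -/
def IsEvent1 {n m : ℕ} (R : PointMelody n) (Q : PointMelody m) (ε : ℝ) : Prop :=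
  ∃ (i : Fin n) (j : Fin m), Q.scaledTime ε j = R.time i

/-- Type 2: a note of the reference lies on the bisector of two consecutive notes of the scaled
query. -/
def IsEvent2 {n m : ℕ} (R : PointMelody n) (Q : PointMelody m) (ε : ℝ) : Prop :=
  ∃ (i : Fin n) (j j' : Fin m), (j' : ℕ) = j + 1 ∧
    (Q.scaledTime ε j + Q.scaledTime ε j') / 2 = R.time i

/-- Type 3: a note of the scaled query to which no note of the reference is assigned lies on the
bisector of two consecutive notes of the reference. -/
def IsEvent3 {n m : ℕ} (R : PointMelody n) (Q : PointMelody m) (ε : ℝ) : Prop :=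
  ∃ (i i' : Fin n) (j : Fin m), (i' : ℕ) = i + 1 ∧
    Q.scaledTime ε j = (R.time i + R.time i') / 2 ∧ Unmatched R.notes (Q.scaledNotes ε) j

/-- The events. -/
def events {n m : ℕ} (R : PointMelody n) (Q : PointMelody m) : Set ℝ :=
  {ε | 0 < ε ∧ (IsEvent1 R Q ε ∨ IsEvent2 R Q ε ∨ IsEvent3 R Q ε)}

/-! ## What a solution is -/

/-- `v` is the infimum of the cost over the admissible scalings, and `ε` is an admissible scaling
at which it is realised: `ε` is a minimiser (`side = 0`), or no minimiser exists and the infimum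
is the limit of the cost at `ε` from the left (`side = 1`) or from the right (`side = 2`). -/
def IsOptimalScaling {n m : ℕ} (R : PointMelody n) (Q : PointMelody m)
    (ε v : ℝ) (side : ℕ) : Prop :=
  ε ∈ scalingRange R Q ∧
  IsGLB (scalingCost R Q '' scalingRange R Q) v ∧
  ((side = 0 ∧ IsMinOn (scalingCost R Q) (scalingRange R Q) ε ∧ scalingCost R Q ε = v) ∨
   ((¬ ∃ ε' ∈ scalingRange R Q, IsMinOn (scalingCost R Q) (scalingRange R Q) ε') ∧
    ((side = 1 ∧ 0 < ε ∧ Filter.Tendsto (scalingCost R Q) (nhdsWithin ε (Set.Iio ε)) (nhds v)) ∨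
     (side = 2 ∧ ε < (R.duration - Q.duration) / m ∧
      Filter.Tendsto (scalingCost R Q) (nhdsWithin ε (Set.Ioi ε)) (nhds v)))))

/-! ## A real random access machine

A program is a fixed text over finitely many registers and arrays. Registers and array cells hold
either a natural number or a real number. On naturals there are addition, truncated subtraction,
and comparison; on reals the four arithmetic operations and comparison. There is no rounding, no
conversion between reals and naturals, and the only constants are natural numbers. Array cells are
addressed by computed naturals. Every constant, register access, array access, arithmetic
operation, comparison, connective, write and jump takes one unit of time. -/

namespace RealRAM

structure State where
  nat : ℕ → ℕ
  real : ℕ → ℝ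
  natArr : ℕ → ℕ → ℕ
  realArr : ℕ → ℕ → ℝ

inductive NatExpr where
  | const (c : ℕ)
  | reg (r : ℕ)
  | get (arr : ℕ) (idx : NatExpr)
  | add (a b : NatExpr)
  | sub (a b : NatExpr)

inductive RealExpr where
  | const (c : ℕ)
  | reg (r : ℕ)
  | get (arr : ℕ) (idx : NatExpr)
  | add (a b : RealExpr)
  | sub (a b : RealExpr)
  | mul (a b : RealExpr)
  | div (a b : RealExpr)

inductive Test where
  | natLt (a b : NatExpr)
  | natEq (a b : NatExpr)
  | realLt (a b : RealExpr)
  | realEq (a b : RealExpr)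
  | neg (b : Test)
  | conj (b c : Test)

/-- Program texts. -/
inductive Prog where
  | skip
  | setNat (r : ℕ) (e : NatExpr)
  | setReal (r : ℕ) (e : RealExpr)
  | putNat (arr : ℕ) (idx e : NatExpr)
  | putReal (arr : ℕ) (idx : NatExpr) (e : RealExpr)
  | seq (c d : Prog)
  | cond (b : Test) (c d : Prog)
  | loop (b : Test) (c : Prog)

def NatExpr.eval (s : State) : NatExpr → ℕ
  | const c => c
  | reg r => s.nat r
  | get arr idx => s.natArr arr (idx.eval s)
  | add a b => a.eval s + b.eval s
  | sub a b => a.eval s - b.eval s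

def NatExpr.time : NatExpr → ℕ
  | const _ => 1
  | reg _ => 1
  | get _ idx => idx.time + 1
  | add a b => a.time + b.time + 1
  | sub a b => a.time + b.time + 1

noncomputable def RealExpr.eval (s : State) : RealExpr → ℝ
  | const c => (c : ℝ)
  | reg r => s.real r
  | get arr idx => s.realArr arr (idx.eval s)
  | add a b => a.eval s + b.eval s
  | sub a b => a.eval s - b.eval s
  | mul a b => a.eval s * b.eval s
  | div a b => a.eval s / b.eval s

def RealExpr.time : RealExpr → ℕ
  | const _ => 1
  | reg _ => 1
  | get _ idx => idx.time + 1
  | add a b => a.time + b.time + 1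
  | sub a b => a.time + b.time + 1
  | mul a b => a.time + b.time + 1
  | div a b => a.time + b.time + 1

def Test.Holds (s : State) : Test → Prop
  | natLt a b => a.eval s < b.eval s
  | natEq a b => a.eval s = b.eval s
  | realLt a b => a.eval s < b.eval s
  | realEq a b => a.eval s = b.eval s
  | neg b => ¬ b.Holds s
  | conj b c => b.Holds s ∧ c.Holds s

def Test.time : Test → ℕ
  | natLt a b => a.time + b.time + 1
  | natEq a b => a.time + b.time + 1
  | realLt a b => a.time + b.time + 1
  | realEq a b => a.time + b.time + 1
  | neg b => b.time + 1
  | conj b c => b.time + c.time + 1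

/-- `Exec c s s' t`: started in the state `s`, the program `c` halts in the state `s'` after
exactly `t` units of time. -/
inductive Exec : Prog → State → State → ℕ → Prop where
  | skip (s : State) : Exec .skip s s 1
  | setNat (r : ℕ) (e : NatExpr) (s : State) :
      Exec (.setNat r e) s { s with nat := Function.update s.nat r (e.eval s) } (e.time + 1)
  | setReal (r : ℕ) (e : RealExpr) (s : State) :
      Exec (.setReal r e) s { s with real := Function.update s.real r (e.eval s) } (e.time + 1)
  | putNat (arr : ℕ) (idx e : NatExpr) (s : State) :
      Exec (.putNat arr idx e) s
        { s with
          natArr := Function.update s.natArr arr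
            (Function.update (s.natArr arr) (idx.eval s) (e.eval s)) }
        (idx.time + e.time + 1)
  | putReal (arr : ℕ) (idx : NatExpr) (e : RealExpr) (s : State) :
      Exec (.putReal arr idx e) s
        { s with
          realArr := Function.update s.realArr arr
            (Function.update (s.realArr arr) (idx.eval s) (e.eval s)) }
        (idx.time + e.time + 1)
  | seq {c d : Prog} {s s' s'' : State} {t u : ℕ} :
      Exec c s s' t → Exec d s' s'' u → Exec (.seq c d) s s'' (t + u)
  | condTrue {b : Test} {c d : Prog} {s s' : State} {t : ℕ} :
      b.Holds s → Exec c s s' t → Exec (.cond b c d) s s' (b.time + 1 + t)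
  | condFalse {b : Test} {c d : Prog} {s s' : State} {t : ℕ} :
      ¬ b.Holds s → Exec d s s' t → Exec (.cond b c d) s s' (b.time + 1 + t)
  | loopTrue {b : Test} {c : Prog} {s s' s'' : State} {t u : ℕ} :
      b.Holds s → Exec c s s' t → Exec (.loop b c) s' s'' u →
      Exec (.loop b c) s s'' (b.time + 1 + t + u)
  | loopFalse {b : Test} {c : Prog} {s : State} :
      ¬ b.Holds s → Exec (.loop b c) s s (b.time + 1)

/-- A finite sequence of reals as the content of an array. -/
def arrayOf {n : ℕ} (f : Fin n → ℝ) (k : ℕ) : ℝ :=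
  if h : k < n then f ⟨k, h⟩ else 0

/-- The input: `n` and `m` in the natural registers `0` and `1`, the durations of `R` and `Q` in
the real registers `0` and `1`, the times and pitches of `R` in the real arrays `0` and `1`, those
of `Q` in the real arrays `2` and `3`; everything else is `0`. -/
def input {n m : ℕ} (R : PointMelody n) (Q : PointMelody m) : State where
  nat := fun r => if r = 0 then n else if r = 1 then m else 0
  real := fun r => if r = 0 then R.duration else if r = 1 then Q.duration else 0
  natArr := fun _ _ => 0
  realArr := fun arr =>
    if arr = 0 then arrayOf R.time else if arr = 1 then arrayOf R.pitch
    else if arr = 2 then arrayOf Q.time else if arr = 3 then arrayOf Q.pitch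
    else fun _ => 0

end RealRAM

/-! Between neighbouring notes of a sequence the assignment is decided by their bisector, and the
pitches matter only on the bisector itself (`Precedes`). Hence a point is assigned to `B j` exactly
when it lies between the bisectors on either side of `B j` (`assigned_iff`).

Events. Each type of event equates an affine function of `ε` of positive slope with a constant, so a
type and a pair of indices give at most one event. On an interval without events no such comparison
changes sign. The matching and the sign of every time difference of a matched pair are therefore
frozen, and the cost is a sum of affine terms (`scalingCost_affine`). A jump occurs when a reference
note changes its partner on a bisector: the old partner may become unmatched and then be matched to
the same note again, so that a pair of positive cost is added at once.

Algorithm. As `ε` grows, the query notes and their bisectors move to the right, so a reference note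
is only ever handed over to earlier query notes. The values of `ε` at which a given reference note
is assigned to a given query note thus form one window; so do those at which a given query note is
unmatched and separates the first `c` reference notes from the others. Inside a window the distance
of the matched pair is one affine function up to a turning point and another one after it. The cost
is therefore a sum of `6 m (n + 1)` steps, each of which adds an affine function from some key on
(`scalingCost_eq_sum_steps`). A key is a time together with a side, ordered lexicographically,
because the pitches decide whether a change takes effect at the time or just after it; this keeps
values and one-sided limits apart.

The factor `log m` instead of `log (n m)` is due to monotonicity: for a fixed query note, kind of
window and kind of step, the keys increase with the index of the reference note
(`Valid.stepKey_mono`). The steps are generated as `6 m` sorted runs of length `n + 1`, and merging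
that starts from this width needs `log m + O(1)` rounds, each linear in the number of steps. A sweep
then maintains slope and offset of the cost. Between consecutive keys the cost is affine, so its
infimum there is found at the ends, and the midpoint settles whether it is attained inside
(`Best.improveOn_spec`). The smallest key is `(0, 0)` and the largest `(L, 1)`, so that the sweep
covers the whole range. -/

/-! ## The assignment rule -/

/-- `a` is assigned to `b` rather than to the next note `b'`, when it lies between them. -/
def Precedes (a b b' : ℝ × ℝ) : Prop :=
  a.1 < (b.1 + b'.1) / 2 ∨ (a.1 = (b.1 + b'.1) / 2 ∧ ¬ |a.2 - b'.2| < |a.2 - b.2|)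

/-- On the bisector both time differences have the same absolute value, so the tie-break compares
pitches only. -/
theorem manhattan_lt_iff_of_bisector {a b b' : ℝ × ℝ} (h : a.1 = (b.1 + b'.1) / 2) :
    manhattan a b' < manhattan a b ↔ |a.2 - b'.2| < |a.2 - b.2| := by
  have : |a.1 - b'.1| = |a.1 - b.1| := by
    rw [abs_eq_abs]; right; rw [h]; ring
  simp [manhattan, this]

theorem Precedes.of_lt {a b b' : ℝ × ℝ} (h : a.1 < (b.1 + b'.1) / 2) : Precedes a b b' := Or.inl h

theorem not_precedes_of_lt {a b b' : ℝ × ℝ} (h : (b.1 + b'.1) / 2 < a.1) : ¬ Precedes a b b' := by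
  rintro (h' | ⟨h', -⟩) <;> linarith

theorem Precedes.le {a b b' : ℝ × ℝ} (h : Precedes a b b') : a.1 ≤ (b.1 + b'.1) / 2 := by
  rcases h with h | ⟨h, -⟩ <;> linarith

theorem le_of_not_precedes {a b b' : ℝ × ℝ} (h : ¬ Precedes a b b') :
    (b.1 + b'.1) / 2 ≤ a.1 := by
  by_contra hc
  exact h (Or.inl (not_le.1 hc))

/-- A point is assigned to `B j` iff it comes after the bisector of `B j` and its predecessor, and
before the bisector of `B j` and its successor. -/
theorem assigned_iff {k : ℕ} {a : ℝ × ℝ} {B : Fin k → ℝ × ℝ}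
    (hB : StrictMono fun l => (B l).1) (j : Fin k) :
    Assigned a B j ↔ (∀ l : Fin k, (l : ℕ) + 1 = j → ¬ Precedes a (B l) (B j)) ∧
      ∀ r : Fin k, (r : ℕ) = j + 1 → Precedes a (B j) (B r) := by
  have hmono : ∀ l r : Fin k, (l : ℕ) < r → (B l).1 < (B r).1 := fun l r h => hB h
  have hle : ∀ l r : Fin k, (l : ℕ) ≤ r → (B l).1 ≤ (B r).1 := fun l r h => hB.monotone h
  constructor
  · rintro (⟨h, hj⟩ | ⟨h, hj⟩ | h | ⟨l, r, hlr, hl, hr, h⟩)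
    · refine ⟨fun l hl => ?_, fun r hr => ?_⟩
      · have := hj l
        rw [Fin.le_def] at this
        omega
      · have := h j
        have := h r
        exact .of_lt (by linarith)
    · refine ⟨fun l hl => ?_, fun r hr => ?_⟩
      · have := h j
        have := h l
        exact not_precedes_of_lt (by linarith)
      · have := hj r
        rw [Fin.le_def] at this
        omega
    · refine ⟨fun l hl => ?_, fun r hr => ?_⟩
      · have := hmono l j (by omega)
        exact not_precedes_of_lt (by linarith)
      · have := hmono j r (by omega)
        exact .of_lt (by linarith)
    · have key : (j = l ∧ Precedes a (B l) (B r)) ∨ (j = r ∧ ¬ Precedes a (B l) (B r)) := by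
        rcases h with ⟨h, rfl⟩ | ⟨h, rfl⟩ | ⟨h, hj⟩
        · exact Or.inl ⟨rfl, .of_lt h⟩
        · exact Or.inr ⟨rfl, not_precedes_of_lt h⟩
        · split_ifs at hj with hc <;> rw [manhattan_lt_iff_of_bisector h] at hc
          · refine Or.inr ⟨hj, ?_⟩
            rintro (h' | ⟨-, h'⟩)
            · linarith
            · exact h' hc
          · exact Or.inl ⟨hj, Or.inr ⟨h, hc⟩⟩
      rcases key with ⟨rfl, hp⟩ | ⟨rfl, hp⟩
      · refine ⟨fun l' hl' => ?_, fun r' hr' => ?_⟩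
        · have := hmono l' j (by omega)
          exact not_precedes_of_lt (by linarith)
        · obtain rfl : r' = r := Fin.ext (by omega)
          exact hp
      · refine ⟨fun l' hl' => ?_, fun r' hr' => ?_⟩
        · obtain rfl : l' = l := Fin.ext (by omega)
          exact hp
        · have := hmono j r' (by omega)
          exact .of_lt (by linarith)
  · rintro ⟨h1, h2⟩
    rcases lt_trichotomy a.1 (B j).1 with h | h | h
    · by_cases hj : (j : ℕ) = 0
      · refine Or.inl ⟨fun l => h.trans_le (hle j l (by omega)), fun l => ?_⟩
        rw [Fin.le_def]
        omega
      -- The point lies in the gap to the left of `B j`, on the bisector or in the half next to `B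
      -- j`.
      · have hp := h1 ⟨j - 1, by omega⟩ (by simp only; omega)
        have hlt := hmono ⟨j - 1, by omega⟩ j (by simp only; omega)
        have hb := le_of_not_precedes hp
        refine Or.inr (Or.inr (Or.inr ⟨⟨j - 1, by omega⟩, j, by simp only; omega,
          by linarith, h, ?_⟩))
        rcases hb.lt_or_eq with hb | hb
        · exact Or.inr (Or.inl ⟨hb, rfl⟩)
        · refine Or.inr (Or.inr ⟨hb.symm, ?_⟩)
          rw [if_pos]
          by_contra hc
          rw [manhattan_lt_iff_of_bisector hb.symm] at hc
          exact hp (Or.inr ⟨hb.symm, hc⟩)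
    · exact Or.inr (Or.inr (Or.inl h))
    · by_cases hj : (j : ℕ) + 1 = k
      · refine Or.inr (Or.inl ⟨fun l => (hle l j (by omega)).trans_lt h, fun l => ?_⟩)
        rw [Fin.le_def]
        omega
      · have hp := h2 ⟨j + 1, by omega⟩ rfl
        have hlt := hmono j ⟨j + 1, by omega⟩ (by simp)
        have hb := hp.le
        refine Or.inr (Or.inr (Or.inr ⟨j, ⟨j + 1, by omega⟩, rfl, h, by linarith, ?_⟩))
        rcases hp with hb | ⟨hb, hc⟩
        · exact Or.inl ⟨hb, rfl⟩
        · refine Or.inr (Or.inr ⟨hb, ?_⟩)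
          rw [if_neg (mt (manhattan_lt_iff_of_bisector hb).1 hc)]

namespace PointMelody

theorem notes_strictMono {n : ℕ} (R : PointMelody n) : StrictMono fun i => (R.notes i).1 :=
  R.time_strictMono

/-- Later notes move faster, so a nonnegative `ε` preserves the order. -/
theorem scaledNotes_strictMono {m : ℕ} (Q : PointMelody m) {ε : ℝ} (hε : 0 ≤ ε) :
    StrictMono fun j => (Q.scaledNotes ε j).1 := by
  intro i j hij
  have h1 := Q.time_strictMono hij
  have h2 : ((i : ℕ) : ℝ) ≤ ((j : ℕ) : ℝ) := by exact_mod_cast hij.le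
  have h3 := mul_le_mul_of_nonneg_right h2 hε
  simp only [scaledNotes, scaledTime]
  linarith

end PointMelody

/-! ## Finitely many events, and an affine cost in between -/

theorem ncard_le_of_subset_range_union {n m : ℕ} {s : Set ℝ} (f g h : Fin n × Fin m → ℝ)
    (hs : s ⊆ Set.range f ∪ Set.range g ∪ Set.range h) :
    s.Finite ∧ s.ncard ≤ 3 * (n * m) := by
  have hr : ∀ f : Fin n × Fin m → ℝ, (Set.range f).ncard ≤ n * m := fun f => by
    rw [← Set.image_univ]
    refine (Set.ncard_image_le Set.finite_univ).trans ?_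
    simp [Set.ncard_univ]
  have hfin : (Set.range f ∪ Set.range g ∪ Set.range h).Finite :=
    ((Set.finite_range f).union (Set.finite_range g)).union (Set.finite_range h)
  refine ⟨hfin.subset hs, (Set.ncard_le_ncard hs hfin).trans ?_⟩
  have h1 := Set.ncard_union_le (Set.range f ∪ Set.range g) (Set.range h)
  have h2 := Set.ncard_union_le (Set.range f) (Set.range g)
  have := hr f
  have := hr g
  have := hr h
  omega

theorem events_finite_and_ncard_le {n m : ℕ} (R : PointMelody n) (Q : PointMelody m) :
    (events R Q).Finite ∧ (events R Q).ncard ≤ 3 * (n * m) := by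
  have hpos : ∀ j : ℕ, (0 : ℝ) < (2 * (j : ℝ) + 1) / 2 := fun j => by positivity
  -- The three event equations solved for `ε`. The speeds of `t_j`, of the bisector of the notes `j`
  -- and `j + 1`, and again of `t_j` are the divisors. The value `0` for a missing neighbour only
  -- makes the maps total.
  refine ncard_le_of_subset_range_union
    (fun u => (R.time u.1 - Q.time u.2) / ((2 * ((u.2 : ℕ) : ℝ) + 1) / 2))
    (fun u => (R.time u.1 - (Q.time u.2 + if h : (u.2 : ℕ) + 1 < m then Q.time ⟨u.2 + 1, h⟩ else 0)
      / 2) / (((u.2 : ℕ) : ℝ) + 1))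
    (fun u => ((R.time u.1 + if h : (u.1 : ℕ) + 1 < n then R.time ⟨u.1 + 1, h⟩ else 0) / 2
      - Q.time u.2) / ((2 * ((u.2 : ℕ) : ℝ) + 1) / 2)) ?_
  rintro ε ⟨-, ⟨i, j, h⟩ | ⟨i, j, j', hj, h⟩ | ⟨i, i', j, hi, h, -⟩⟩
  · refine Or.inl (Or.inl ⟨(i, j), ?_⟩)
    have := hpos j
    simp only [PointMelody.scaledTime] at h
    rw [div_eq_iff this.ne']
    linarith
  · refine Or.inl (Or.inr ⟨(i, j), ?_⟩)
    have hlt : (j : ℕ) + 1 < m := by omega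
    obtain rfl : j' = ⟨j + 1, hlt⟩ := Fin.ext hj
    have : (0 : ℝ) < ((j : ℕ) : ℝ) + 1 := by positivity
    simp only [PointMelody.scaledTime] at h
    simp only [hlt, dif_pos]
    rw [div_eq_iff this.ne']
    push_cast at h
    linarith
  · refine Or.inr ⟨(i, j), ?_⟩
    have hlt : (i : ℕ) + 1 < n := by omega
    obtain rfl : i' = ⟨i + 1, hlt⟩ := Fin.ext hi
    have := hpos j
    simp only [PointMelody.scaledTime] at h
    simp only [hlt, dif_pos]
    rw [div_eq_iff this.ne']
    linarith

/-- The intermediate value theorem: a continuous function without zeros on an interval has one sign.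
-/
theorem affine_sign_const {a b u w : ℝ} (h : ∀ ε ∈ Set.Ioo a b, u * ε + w ≠ 0) :
    (∀ ε ∈ Set.Ioo a b, u * ε + w < 0) ∨ ∀ ε ∈ Set.Ioo a b, 0 < u * ε + w := by
  by_contra hc
  push Not at hc
  obtain ⟨⟨y, hy, hy'⟩, z, hz, hz'⟩ := hc
  have hcont : ContinuousOn (fun ε => u * ε + w) (Set.Ioo a b) := by fun_prop
  obtain ⟨c, hc, hc'⟩ := isPreconnected_Ioo.intermediate_value hz hy hcont ⟨hz', hy'⟩
  exact h c hc hc'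

/-- Off the bisectors the pitches play no role, so the comparison of times is all that has to agree.
-/
theorem precedes_congr_of_ne {a b b' c d d' : ℝ × ℝ}
    (h : a.1 ≠ (b.1 + b'.1) / 2) (h' : c.1 ≠ (d.1 + d'.1) / 2)
    (hiff : a.1 < (b.1 + b'.1) / 2 ↔ c.1 < (d.1 + d'.1) / 2) :
    Precedes a b b' ↔ Precedes c d d' := by
  simp [Precedes, h, h', hiff]

/-- On an interval without events the cost is affine. -/
theorem scalingCost_affine {n m : ℕ} (R : PointMelody n) (Q : PointMelody m) {a b : ℝ}
    (ha : 0 ≤ a) (hdis : Disjoint (Set.Ioo a b) (events R Q)) :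
    ∃ α β : ℝ, ∀ ε ∈ Set.Ioo a b, scalingCost R Q ε = α * ε + β := by
  classical
  rcases (Set.Ioo a b).eq_empty_or_nonempty with he | ⟨e, he⟩
  · exact ⟨0, 0, by simp [he]⟩
  have hno : ∀ ε ∈ Set.Ioo a b, ¬ IsEvent1 R Q ε ∧ ¬ IsEvent2 R Q ε ∧ ¬ IsEvent3 R Q ε := by
    intro ε hε
    have h := Set.disjoint_left.1 hdis hε
    have hpos : 0 < ε := ha.trans_lt hε.1
    simp only [events, Set.mem_ofPred_eq, hpos, true_and, not_or] at h
    exact h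
  have hmono : ∀ ε ∈ Set.Ioo a b, StrictMono fun j => (Q.scaledNotes ε j).1 := fun ε hε =>
    Q.scaledNotes_strictMono (ha.trans hε.1.le)
  -- the sign of `t_j(ε) - x_i` is constant
  have hsign : ∀ (i : Fin n) (j : Fin m), (∀ ε ∈ Set.Ioo a b, Q.scaledTime ε j - R.time i < 0) ∨
      ∀ ε ∈ Set.Ioo a b, 0 < Q.scaledTime ε j - R.time i := by
    intro i j
    have := affine_sign_const (a := a) (b := b) (u := (2 * ((j : ℕ) : ℝ) + 1) / 2)
      (w := Q.time j - R.time i) (fun ε hε h0 => (hno ε hε).1 ⟨i, j, by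
        simp only [PointMelody.scaledTime]; linarith⟩)
    refine this.imp (fun h ε hε => ?_) fun h ε hε => ?_ <;>
    · have := h ε hε
      simp only [PointMelody.scaledTime]
      linarith
  have hassR : ∀ ε ∈ Set.Ioo a b, ∀ i j, Assigned (R.notes i) (Q.scaledNotes ε) j ↔
      Assigned (R.notes i) (Q.scaledNotes e) j := by
    have key : ∀ ε ∈ Set.Ioo a b, ∀ (i : Fin n) (l r : Fin m), (r : ℕ) = l + 1 →
        (Precedes (R.notes i) (Q.scaledNotes ε l) (Q.scaledNotes ε r) ↔
          Precedes (R.notes i) (Q.scaledNotes e l) (Q.scaledNotes e r)) := by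
      intro ε hε i l r hlr
      have hne : ∀ δ ∈ Set.Ioo a b,
          R.time i ≠ (Q.scaledTime δ l + Q.scaledTime δ r) / 2 := fun δ hδ h =>
        (hno δ hδ).2.1 ⟨i, l, r, hlr, h.symm⟩
      refine precedes_congr_of_ne (hne ε hε) (hne e he) ?_
      have := affine_sign_const (a := a) (b := b)
        (u := ((2 * ((l : ℕ) : ℝ) + 1) / 2 + (2 * ((r : ℕ) : ℝ) + 1) / 2) / 2)
        (w := (Q.time l + Q.time r) / 2 - R.time i) (fun δ hδ h0 => hne δ hδ (by
          simp only [PointMelody.scaledTime]; linarith))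
      simp only [PointMelody.notes, PointMelody.scaledNotes, PointMelody.scaledTime]
      rcases this with h | h <;> have h1 := h ε hε <;> have h2 := h e he <;>
        constructor <;> intro h3 <;> linarith
    intro ε hε i j
    rw [assigned_iff (hmono ε hε), assigned_iff (hmono e he)]
    refine and_congr (forall_congr' fun l => imp_congr_right fun hl => not_congr ?_)
      (forall_congr' fun r => imp_congr_right fun hr => ?_)
    · exact key ε hε i l j hl.symm
    · exact key ε hε i j r hr
  have hunm : ∀ ε ∈ Set.Ioo a b, ∀ j, Unmatched R.notes (Q.scaledNotes ε) j ↔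
      Unmatched R.notes (Q.scaledNotes e) j := fun ε hε j =>
    forall_congr' fun i => not_congr (hassR ε hε i j)
  -- Events of type 3 concern unmatched query notes only. This suffices, since the second half of
  -- the matching is needed only for those, and by `hunm` they are the same throughout the interval.
  have hassQ : ∀ ε ∈ Set.Ioo a b, ∀ i j, Unmatched R.notes (Q.scaledNotes e) j →
      (Assigned (Q.scaledNotes ε j) R.notes i ↔ Assigned (Q.scaledNotes e j) R.notes i) := by
    intro ε hε i j hj
    have key : ∀ l r : Fin n, (r : ℕ) = l + 1 →
        (Precedes (Q.scaledNotes ε j) (R.notes l) (R.notes r) ↔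
          Precedes (Q.scaledNotes e j) (R.notes l) (R.notes r)) := by
      intro l r hlr
      have hne : ∀ δ ∈ Set.Ioo a b, Q.scaledTime δ j ≠ (R.time l + R.time r) / 2 :=
        fun δ hδ h => (hno δ hδ).2.2 ⟨l, r, j, hlr, h, (hunm δ hδ j).2 hj⟩
      refine precedes_congr_of_ne (hne ε hε) (hne e he) ?_
      have := affine_sign_const (a := a) (b := b) (u := (2 * ((j : ℕ) : ℝ) + 1) / 2)
        (w := Q.time j - (R.time l + R.time r) / 2) (fun δ hδ h0 => hne δ hδ (by
          simp only [PointMelody.scaledTime]; linarith))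
      simp only [PointMelody.notes, PointMelody.scaledNotes, PointMelody.scaledTime]
      rcases this with h | h <;> have h1 := h ε hε <;> have h2 := h e he <;>
        constructor <;> intro h3 <;> linarith
    rw [assigned_iff R.notes_strictMono, assigned_iff R.notes_strictMono]
    refine and_congr (forall_congr' fun l => imp_congr_right fun hl => not_congr ?_)
      (forall_congr' fun r => imp_congr_right fun hr => ?_)
    · exact key l i hl.symm
    · exact key i r hr
  have hmat : ∀ ε ∈ Set.Ioo a b, ∀ i j, Matched R.notes (Q.scaledNotes ε) i j ↔
      Matched R.notes (Q.scaledNotes e) i j := fun ε hε i j => by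
    unfold Matched
    rw [hassR ε hε, hunm ε hε]
    exact or_congr_right (and_congr_right fun h => hassQ ε hε i j h)
  have hterm : ∀ (j : Fin m) (i : Fin n), ∃ α β : ℝ, ∀ ε ∈ Set.Ioo a b,
      (if Matched R.notes (Q.scaledNotes ε) i j then
        manhattan (R.notes i) (Q.scaledNotes ε j) else 0) = α * ε + β := by
    intro j i
    by_cases hm : Matched R.notes (Q.scaledNotes e) i j
    · rcases hsign i j with h | h
      · refine ⟨-((2 * ((j : ℕ) : ℝ) + 1) / 2), R.time i - Q.time j + |R.pitch i - Q.pitch j|,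
          fun ε hε => ?_⟩
        have h' := h ε hε
        rw [if_pos ((hmat ε hε i j).2 hm)]
        simp only [manhattan, PointMelody.notes, PointMelody.scaledNotes]
        rw [abs_of_pos (by linarith)]
        simp only [PointMelody.scaledTime]
        ring
      · refine ⟨(2 * ((j : ℕ) : ℝ) + 1) / 2, Q.time j - R.time i + |R.pitch i - Q.pitch j|,
          fun ε hε => ?_⟩
        have h' := h ε hε
        rw [if_pos ((hmat ε hε i j).2 hm)]
        simp only [manhattan, PointMelody.notes, PointMelody.scaledNotes]
        rw [abs_of_neg (by linarith)]
        simp only [PointMelody.scaledTime]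
        ring
    · exact ⟨0, 0, fun ε hε => by rw [if_neg (mt (hmat ε hε i j).1 hm)]; ring⟩
  choose α β hαβ using hterm
  refine ⟨∑ j, ∑ i, α j i, ∑ j, ∑ i, β j i, fun ε hε => ?_⟩
  simp only [scalingCost, matchingCost, noteCost]
  rw [Finset.sum_mul, ← Finset.sum_add_distrib]
  refine Finset.sum_congr rfl fun j _ => ?_
  rw [Finset.sum_mul, ← Finset.sum_add_distrib]
  exact Finset.sum_congr rfl fun i _ => by rw [← hαβ j i ε hε]

/-! ## A discontinuous cost -/

/-- A reference of two notes of equal pitch. -/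
noncomputable def flatReference : PointMelody 2 where
  time := ![0, 1]
  pitch := ![0, 0]
  duration := 10
  time_strictMono := by intro i j h; fin_cases i <;> fin_cases j <;> simp_all
  time_nonneg := by intro i; fin_cases i <;> simp
  time_le_duration := by intro i; fin_cases i <;> simp

/-- A query that jumps by an interval of ten. -/
noncomputable def jumpQuery : PointMelody 2 where
  time := ![0, 1]
  pitch := ![0, 10]
  duration := 1
  time_strictMono := by intro i j h; fin_cases i <;> fin_cases j <;> simp_all
  time_nonneg := by intro i; fin_cases i <;> simp
  time_le_duration := by intro i; fin_cases i <;> simp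

theorem assigned_zero_iff {a : ℝ × ℝ} {B : Fin 2 → ℝ × ℝ} (hB : StrictMono fun l => (B l).1) :
    Assigned a B 0 ↔ Precedes a (B 0) (B 1) := by
  rw [assigned_iff hB]; simp [Fin.forall_fin_two]

theorem assigned_one_iff {a : ℝ × ℝ} {B : Fin 2 → ℝ × ℝ} (hB : StrictMono fun l => (B l).1) :
    Assigned a B 1 ↔ ¬ Precedes a (B 0) (B 1) := by
  rw [assigned_iff hB]; simp [Fin.forall_fin_two]

/-- The scaled query notes are at `ε / 2` and `1 + 3 ε / 2`. Their bisector `1 / 2 + ε` is still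
before the second reference note, so notes with equal indices are matched. -/
theorem scalingCost_example_of_lt {ε : ℝ} (h0 : 0 < ε) (h1 : ε < 1 / 2) :
    scalingCost flatReference jumpQuery ε = 2 * ε + 10 := by
  have hS := jumpQuery.scaledNotes_strictMono h0.le
  have hR := flatReference.notes_strictMono
  have p0 : Precedes (flatReference.notes 0) (jumpQuery.scaledNotes ε 0)
      (jumpQuery.scaledNotes ε 1) := Or.inl (by
    simp [PointMelody.notes, PointMelody.scaledNotes, PointMelody.scaledTime, flatReference,
      jumpQuery]; linarith)
  have p1 : ¬ Precedes (flatReference.notes 1) (jumpQuery.scaledNotes ε 0)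
      (jumpQuery.scaledNotes ε 1) := not_precedes_of_lt (by
    simp [PointMelody.notes, PointMelody.scaledNotes, PointMelody.scaledTime, flatReference,
      jumpQuery]; linarith)
  have m00 : Matched flatReference.notes (jumpQuery.scaledNotes ε) 0 0 :=
    Or.inl ((assigned_zero_iff hS).2 p0)
  have m11 : Matched flatReference.notes (jumpQuery.scaledNotes ε) 1 1 :=
    Or.inl ((assigned_one_iff hS).2 p1)
  have m01 : ¬ Matched flatReference.notes (jumpQuery.scaledNotes ε) 0 1 := by
    rintro (h | h)
    · exact (assigned_one_iff hS).1 h p0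
    · exact h.1 1 ((assigned_one_iff hS).2 p1)
  have m10 : ¬ Matched flatReference.notes (jumpQuery.scaledNotes ε) 1 0 := by
    rintro (h | h)
    · exact p1 ((assigned_zero_iff hS).1 h)
    · exact h.1 0 ((assigned_zero_iff hS).2 p0)
  simp only [scalingCost, matchingCost, noteCost, Fin.sum_univ_two]
  rw [if_pos m00, if_pos m11, if_neg m01, if_neg m10]
  simp [manhattan, PointMelody.notes, PointMelody.scaledNotes, PointMelody.scaledTime,
    flatReference, jumpQuery, abs_of_pos h0]
  norm_num
  ring

/-- The bisector now meets the second reference note, which goes to the first query note because of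
its pitch. The second query note becomes unmatched and is matched to that same reference note again.
The added pair has cost `3 / 4`, which lifts the left limit `11` to `47 / 4`. -/
theorem scalingCost_example_half : scalingCost flatReference jumpQuery (1 / 2) = 47 / 4 := by
  have hS := jumpQuery.scaledNotes_strictMono (ε := 1 / 2) (by norm_num)
  have hR := flatReference.notes_strictMono
  have p0 : Precedes (flatReference.notes 0) (jumpQuery.scaledNotes (1 / 2) 0)
      (jumpQuery.scaledNotes (1 / 2) 1) := Or.inl (by
    simp [PointMelody.notes, PointMelody.scaledNotes, PointMelody.scaledTime, flatReference,
      jumpQuery]; norm_num)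
  have p1 : Precedes (flatReference.notes 1) (jumpQuery.scaledNotes (1 / 2) 0)
      (jumpQuery.scaledNotes (1 / 2) 1) := Or.inr (by
    simp [PointMelody.notes, PointMelody.scaledNotes, PointMelody.scaledTime, flatReference,
      jumpQuery]; norm_num)
  have p2 : ¬ Precedes (jumpQuery.scaledNotes (1 / 2) 1) (flatReference.notes 0)
      (flatReference.notes 1) := not_precedes_of_lt (by
    simp [PointMelody.notes, PointMelody.scaledNotes, PointMelody.scaledTime, flatReference,
      jumpQuery]; norm_num)
  have m00 : Matched flatReference.notes (jumpQuery.scaledNotes (1 / 2)) 0 0 :=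
    Or.inl ((assigned_zero_iff hS).2 p0)
  have m10 : Matched flatReference.notes (jumpQuery.scaledNotes (1 / 2)) 1 0 :=
    Or.inl ((assigned_zero_iff hS).2 p1)
  have m11 : Matched flatReference.notes (jumpQuery.scaledNotes (1 / 2)) 1 1 := by
    refine Or.inr ⟨fun i h => ?_, (assigned_one_iff hR).2 p2⟩
    rw [assigned_one_iff hS] at h
    fin_cases i
    · exact h p0
    · exact h p1
  have m01 : ¬ Matched flatReference.notes (jumpQuery.scaledNotes (1 / 2)) 0 1 := by
    rintro (h | h)
    · exact (assigned_one_iff hS).1 h p0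
    · exact p2 ((assigned_zero_iff hR).1 h.2)
  simp only [scalingCost, matchingCost, noteCost, Fin.sum_univ_two]
  rw [if_pos m00, if_pos m11, if_neg m01, if_pos m10]
  simp [manhattan, PointMelody.notes, PointMelody.scaledNotes, PointMelody.scaledTime,
    flatReference, jumpQuery]
  norm_num

theorem exists_discontinuous_event :
    ∃ (n m : ℕ) (R : PointMelody n) (Q : PointMelody m) (ε : ℝ),
      ε ∈ interior (scalingRange R Q) ∧ ε ∈ events R Q ∧ ¬ ContinuousAt (scalingCost R Q) ε := by
  refine ⟨2, 2, flatReference, jumpQuery, 1 / 2, ?_, ⟨by norm_num, ?_⟩, fun h => ?_⟩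
  · rw [scalingRange, interior_Icc]
    constructor <;> norm_num [flatReference, jumpQuery]
  · refine Or.inr (Or.inl ⟨1, 0, 1, rfl, ?_⟩)
    norm_num [PointMelody.scaledTime, flatReference, jumpQuery]
  · have h1 : Filter.Tendsto (scalingCost flatReference jumpQuery)
        (nhdsWithin (1 / 2) (Set.Iio (1 / 2))) (nhds (47 / 4)) := by
      rw [← scalingCost_example_half]
      exact h.tendsto.mono_left nhdsWithin_le_nhds
    have h2 : Filter.Tendsto (fun ε : ℝ => 2 * ε + 10)
        (nhdsWithin (1 / 2) (Set.Iio (1 / 2))) (nhds (2 * (1 / 2) + 10)) :=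
      (Continuous.tendsto (by fun_prop) _).mono_left nhdsWithin_le_nhds
    have h3 := tendsto_nhds_unique (h1.congr' ?_) h2
    · norm_num at h3
    · filter_upwards [Ioo_mem_nhdsLT (show (0 : ℝ) < 1 / 2 by norm_num)] with ε hε
      exact scalingCost_example_of_lt hε.1 hε.2

/-! ## The cost as a sum of steps -/

/-- A point of time together with a side: the value changes at the time itself (`0`) or
immediately afterwards (`1`). -/
abbrev StepKey := ℝ ×ₗ ℕ

/-- The key of the point of time `ε` itself. -/
def germ (ε : ℝ) : StepKey := toLex (ε, 0)

/-- A key, moved into the range from `(0, 0)` to `(L, 1)`. -/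
noncomputable def clampKey (L e : ℝ) (s : ℕ) : StepKey :=
  if e < 0 then toLex (0, 0) else if L < e then toLex (L, 1) else toLex (e, s)

/-- Clamping is invisible to admissible scalings: a time below `0` has been passed by all of them, a
time above `L` by none. -/
theorem clampKey_le_germ {L e ε : ℝ} {s : ℕ} (h0 : 0 ≤ ε) (hL : ε ≤ L) :
    clampKey L e s ≤ germ ε ↔ e < ε ∨ (e = ε ∧ s = 0) := by
  unfold clampKey germ
  split_ifs with h1 h2 <;> simp only [Prod.Lex.toLex_le_toLex]
  · have : e < ε := by linarith
    simp only [this, true_or, iff_true]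
    rcases h0.lt_or_eq with h | h
    · exact Or.inl h
    · exact Or.inr ⟨h, le_rfl⟩
  · constructor
    · rintro (h | ⟨-, h⟩)
      · linarith
      · omega
    · rintro (h | ⟨h, -⟩) <;> linarith
  · simp

/-- The bound on the side `s` is needed when only the larger key is clamped, to `(L, 1)`, and in the
comparison with a time equal to `L`. -/
theorem clampKey_mono {L e e' : ℝ} {s s' : ℕ} (hL : 0 ≤ L) (hs : s ≤ 1)
    (h : e < e' ∨ (e = e' ∧ s ≤ s')) : clampKey L e s ≤ clampKey L e' s' := by
  have he : e ≤ e' := by rcases h with h | ⟨h, -⟩ <;> linarith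
  unfold clampKey
  split_ifs with h1 h2 h3 h4 h5 h6 h7 h8 <;> simp only [Prod.Lex.toLex_le_toLex'] <;>
    try (exfalso; linarith)
  · exact ⟨le_rfl, fun _ => le_rfl⟩
  · exact ⟨hL, fun _ => zero_le_one⟩
  · exact ⟨by linarith, fun _ => Nat.zero_le _⟩
  · exact ⟨le_rfl, fun _ => le_rfl⟩
  · exact ⟨by linarith, fun _ => hs⟩
  · exact ⟨he, fun h' => h.elim (fun h => absurd h' h.ne) fun h => h.2⟩

theorem zero_le_clampKey {L e : ℝ} {s : ℕ} (hL : 0 ≤ L) : toLex (0, 0) ≤ clampKey L e s := by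
  unfold clampKey
  split_ifs <;> simp only [Prod.Lex.toLex_le_toLex'] <;>
    exact ⟨by linarith, fun _ => Nat.zero_le _⟩

theorem clampKey_le {L e : ℝ} {s : ℕ} (hL : 0 ≤ L) (hs : s ≤ 1) :
    clampKey L e s ≤ toLex (L, 1) := by
  unfold clampKey
  split_ifs <;> simp only [Prod.Lex.toLex_le_toLex'] <;>
    exact ⟨by linarith, fun _ => by omega⟩

/-- Within the range the key `(L, 1)` means "never", just as `(0, 0)` means "always". -/
theorem not_last_le_germ {L ε : ℝ} (h : ε ≤ L) : ¬ toLex (L, 1) ≤ germ ε := by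
  rw [germ, Prod.Lex.toLex_le_toLex]
  rintro (h' | ⟨-, h'⟩)
  · exact absurd h' (not_lt.2 h)
  · simp at h'

theorem first_le_germ {ε : ℝ} (h : 0 ≤ ε) : (toLex (0, 0) : StepKey) ≤ germ ε := by
  rw [germ, Prod.Lex.toLex_le_toLex']
  exact ⟨h, fun _ => le_rfl⟩

/-- The numbers of notes, the times and pitches of the reference (`x`, `p`) and of the query
(`t`, `q`), and the largest admissible scaling. -/
structure ScalingData where
  n : ℕ
  m : ℕ
  x : ℕ → ℝ
  p : ℕ → ℝ
  t : ℕ → ℝ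
  q : ℕ → ℝ
  L : ℝ

namespace ScalingData

/-- The key at which the note `c - 1` of the reference passes the bisector of the notes `j - 1` and
`j` of the query, with sentinels at `c = 0`, `c = n + 1`, `j = 0` and `j = m`. -/
noncomputable def passKey (D : ScalingData) (c j : ℕ) : StepKey :=
  if c = 0 then toLex (0, 0) else if D.n < c then toLex (D.L, 1) else
  if j = 0 then toLex (D.L, 1) else if ¬ j < D.m then toLex (0, 0) else
  clampKey D.L ((D.x (c - 1) - (D.t (j - 1) + D.t j) / 2) / (j : ℝ))
    (if |D.p (c - 1) - D.q j| < |D.p (c - 1) - D.q (j - 1)| then 1 else 0)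

/-- The key at which the note `c - 1` of the reference is simultaneous with the note `j` of the
query. -/
noncomputable def meetKey (D : ScalingData) (c j : ℕ) : StepKey :=
  clampKey D.L ((D.x (c - 1) - D.t j) / ((2 * (j : ℝ) + 1) / 2)) 0

/-- The key at which the note `j` of the query passes the bisector of the notes `c - 1` and `c` of
the reference. -/
noncomputable def crossKey (D : ScalingData) (c j : ℕ) : StepKey :=
  if c = 0 then toLex (0, 0) else if ¬ c < D.n then toLex (D.L, 1) else
  clampKey D.L (((D.x (c - 1) + D.x c) / 2 - D.t j) / ((2 * (j : ℝ) + 1) / 2))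
    (if |D.p c - D.q j| < |D.p (c - 1) - D.q j| then 0 else 1)

/-- Slope and offset of the distance of the notes `c - 1` and `j` while `j` is the later one. -/
noncomputable def rising (D : ScalingData) (c j : ℕ) : ℝ × ℝ :=
  ((2 * (j : ℝ) + 1) / 2, D.t j - D.x (c - 1) + |D.p (c - 1) - D.q j|)

/-- Slope and offset of the distance of the notes `c - 1` and `j` while `j` is the earlier one. -/
noncomputable def falling (D : ScalingData) (c j : ℕ) : ℝ × ℝ :=
  (-((2 * (j : ℝ) + 1) / 2), D.x (c - 1) - D.t j + |D.p (c - 1) - D.q j|)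

/-- The note `c - 1` is assigned to `j` (`u = 0`), or `j` is unmatched and lies between `c - 1` and
`c` (`u = 1`), from the key `winStart` on, -/
noncomputable def winStart (D : ScalingData) (j u c : ℕ) : StepKey :=
  if u = 0 then D.passKey c (j + 1) else D.passKey c j

/-- until the key `winEnd`; -/
noncomputable def winEnd (D : ScalingData) (j u c : ℕ) : StepKey :=
  max (D.winStart j u c) (if u = 0 then D.passKey c j else D.passKey (c + 1) (j + 1))

/-- the cost of that pair changes from one affine function to another at `winTurn`. -/
noncomputable def winTurn (D : ScalingData) (j u c : ℕ) : StepKey :=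
  max (D.winStart j u c) (min (if u = 0 then D.meetKey c j else D.crossKey c j) (D.winEnd j u c))

/-- In a window with `u = 0` the query note first approaches the reference note from the left and
then leaves it behind. With `u = 1` it moves away from the note `c - 1` up to the bisector and then
approaches the note `c`, whence the argument `c + 1`. -/
noncomputable def costBefore (D : ScalingData) (j u c : ℕ) : ℝ × ℝ :=
  if u = 0 then D.falling c j else D.rising c j

noncomputable def costAfter (D : ScalingData) (j u c : ℕ) : ℝ × ℝ :=
  if u = 0 then D.rising c j else D.falling (c + 1) j

/-- The keys of the three steps of a window. -/
noncomputable def stepKey (D : ScalingData) (j u k c : ℕ) : StepKey :=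
  if k = 0 then D.winStart j u c else if k = 1 then D.winTurn j u c else D.winEnd j u c

/-- The jumps (slope and offset) of the three steps of a window. -/
noncomputable def stepJump (D : ScalingData) (j u k c : ℕ) : ℝ × ℝ :=
  if k = 0 then D.costBefore j u c else
  if k = 1 then D.costAfter j u c - D.costBefore j u c else -D.costAfter j u c

/-- What a window contributes to the cost. -/
noncomputable def winCost (D : ScalingData) (j u c : ℕ) (ε : ℝ) : ℝ :=
  if D.winStart j u c ≤ germ ε ∧ germ ε < D.winEnd j u c then
    if germ ε < (if u = 0 then D.meetKey c j else D.crossKey c j) then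
      (D.costBefore j u c).1 * ε + (D.costBefore j u c).2
    else (D.costAfter j u c).1 * ε + (D.costAfter j u c).2
  else 0

/-- Since `winStart ≤ winTurn ≤ winEnd`, the jumps telescope: the first function enters at the
start, is exchanged for the second at the turn, and the second is removed at the end. -/
theorem winCost_eq_sum (D : ScalingData) (j u c : ℕ) (ε : ℝ) :
    D.winCost j u c ε = ∑ k ∈ Finset.range 3, if D.stepKey j u k c ≤ germ ε then
      (D.stepJump j u k c).1 * ε + (D.stepJump j u k c).2 else 0 := by
  have gen : ∀ (k h l : StepKey) (a b : ℝ × ℝ), k ≤ l →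
      (if k ≤ germ ε ∧ germ ε < l then
        if germ ε < h then a.1 * ε + a.2 else b.1 * ε + b.2 else 0) =
      (if k ≤ germ ε then a.1 * ε + a.2 else 0) +
      (if max k (min h l) ≤ germ ε then (b - a).1 * ε + (b - a).2 else 0) +
      if l ≤ germ ε then (-b).1 * ε + (-b).2 else 0 := by
    intro k h l a b hle
    simp only [max_le_iff, min_le_iff, Prod.fst_sub, Prod.snd_sub, Prod.fst_neg, Prod.snd_neg]
    by_cases h1 : k ≤ germ ε
    · by_cases h2 : l ≤ germ ε
      · simp [h1, h2, not_lt.2 h2]; ring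
      · by_cases h3 : h ≤ germ ε
        · simp [h1, h2, h3, not_lt.2 h3, not_le.1 h2]; ring
        · simp [h1, h2, h3, not_le.1 h3, not_le.1 h2]
    · have h2 : ¬ l ≤ germ ε := fun h => h1 (hle.trans h)
      simp [h1, h2]
  rw [winCost, gen (D.winStart j u c) _ (D.winEnd j u c) _ _ (le_max_left _ _)]
  simp [Finset.sum_range_succ, stepKey, stepJump, winTurn]

/-- The notes of both melodies are in chronological order. -/
structure Valid (D : ScalingData) : Prop where
  n_pos : 0 < D.n
  m_pos : 0 < D.m
  L_nonneg : 0 ≤ D.L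
  x_lt : ∀ i i', i < i' → i' < D.n → D.x i < D.x i'
  t_lt : ∀ j j', j < j' → j' < D.m → D.t j < D.t j'

/-! ### Range and monotonicity of the keys. -/

variable {D : ScalingData}

theorem Valid.x_le (hD : D.Valid) {i i' : ℕ} (h : i ≤ i') (h' : i' < D.n) : D.x i ≤ D.x i' := by
  rcases h.lt_or_eq with h | rfl
  · exact (hD.x_lt i i' h h').le
  · exact le_rfl

theorem Valid.first_le_passKey (hD : D.Valid) (c j : ℕ) : toLex (0, 0) ≤ D.passKey c j := by
  have : (toLex (0, 0) : StepKey) ≤ toLex (D.L, 1) := by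
    rw [Prod.Lex.toLex_le_toLex']; exact ⟨hD.L_nonneg, fun _ => zero_le_one⟩
  unfold passKey
  split_ifs <;> first | exact le_rfl | exact this | exact zero_le_clampKey hD.L_nonneg

theorem Valid.passKey_le_last (hD : D.Valid) (c j : ℕ) : D.passKey c j ≤ toLex (D.L, 1) := by
  have : (toLex (0, 0) : StepKey) ≤ toLex (D.L, 1) := by
    rw [Prod.Lex.toLex_le_toLex']; exact ⟨hD.L_nonneg, fun _ => zero_le_one⟩
  unfold passKey
  split_ifs <;> first | exact le_rfl | exact this | exact clampKey_le hD.L_nonneg (by simp)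

/-- A later reference note is reached later by the moving bisector. The times increase strictly
before clamping, so the sides need no comparison. -/
theorem Valid.passKey_mono (hD : D.Valid) (j : ℕ) {c c' : ℕ} (h : c ≤ c') :
    D.passKey c j ≤ D.passKey c' j := by
  rcases h.lt_or_eq with h | rfl
  swap
  · exact le_rfl
  by_cases hc : c = 0
  · rw [show D.passKey c j = toLex (0, 0) by simp [passKey, hc]]
    exact hD.first_le_passKey _ _
  by_cases hc' : D.n < c'
  · rw [show D.passKey c' j = toLex (D.L, 1) by
      rw [passKey, if_neg (by omega), if_pos hc']]
    exact hD.passKey_le_last _ _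
  unfold passKey
  rw [if_neg hc, if_neg (by omega), if_neg (by omega : ¬ c' = 0), if_neg hc']
  split_ifs with h1 h2
  any_goals exact le_rfl
  all_goals
    refine clampKey_mono hD.L_nonneg (by simp) (Or.inl ?_)
    have hj : (0 : ℝ) < j := by exact_mod_cast Nat.pos_of_ne_zero h1
    have := hD.x_lt (c - 1) (c' - 1) (by omega) (by omega)
    exact div_lt_div_of_pos_right (by linarith) hj

/-- The truncated index makes the keys for `c = 0` and `c = 1` coincide, which is harmless because
the windows with `u = 0` and `c = 0` are empty on the range. -/
theorem Valid.meetKey_mono (hD : D.Valid) (j : ℕ) {c c' : ℕ} (h : c ≤ c') (h' : c' ≤ D.n) :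
    D.meetKey c j ≤ D.meetKey c' j := by
  have hn := hD.n_pos
  have := hD.x_le (i := c - 1) (i' := c' - 1) (by omega) (by omega)
  refine clampKey_mono hD.L_nonneg zero_le_one ?_
  have hj : (0 : ℝ) < (2 * (j : ℝ) + 1) / 2 := by positivity
  have h2 : (D.x (c - 1) - D.t j) / ((2 * (j : ℝ) + 1) / 2) ≤
      (D.x (c' - 1) - D.t j) / ((2 * (j : ℝ) + 1) / 2) :=
    div_le_div_of_nonneg_right (by linarith) hj.le
  rcases h2.lt_or_eq with h | h
  · exact Or.inl h
  · exact Or.inr ⟨h, le_rfl⟩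

theorem Valid.crossKey_mono (hD : D.Valid) (j : ℕ) {c c' : ℕ} (h : c ≤ c') :
    D.crossKey c j ≤ D.crossKey c' j := by
  have h01 : (toLex (0, 0) : StepKey) ≤ toLex (D.L, 1) := by
    rw [Prod.Lex.toLex_le_toLex']; exact ⟨hD.L_nonneg, fun _ => zero_le_one⟩
  rcases h.lt_or_eq with h | rfl
  swap
  · exact le_rfl
  by_cases hc : c = 0
  · rw [show D.crossKey c j = toLex (0, 0) by simp [crossKey, hc]]
    unfold crossKey
    split_ifs <;> first | exact le_rfl | exact h01 | exact zero_le_clampKey hD.L_nonneg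
  by_cases hc' : c' < D.n
  swap
  · rw [show D.crossKey c' j = toLex (D.L, 1) by
      rw [crossKey, if_neg (by omega), if_pos hc']]
    unfold crossKey
    split_ifs <;>
      first | exact le_rfl | exact h01 | exact clampKey_le hD.L_nonneg (by simp)
  unfold crossKey
  rw [if_neg hc, if_neg (by omega : ¬ ¬ c < D.n), if_neg (by omega : ¬ c' = 0),
    if_neg (not_not.2 hc')]
  refine clampKey_mono hD.L_nonneg (by split_ifs <;> simp) (Or.inl ?_)
  have hj : (0 : ℝ) < (2 * (j : ℝ) + 1) / 2 := by positivity
  have h1 := hD.x_lt (c - 1) (c' - 1) (by omega) (by omega)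
  have h2 := hD.x_lt c c' (by omega) (by omega)
  exact div_lt_div_of_pos_right (by linarith) hj

/-- The source of the factor `log m`: the steps with fixed `j`, `u`, `k` are generated in sorted
order. Maximum and minimum preserve monotonicity, so the clipping in `winTurn` and `winEnd` does no
harm. -/
theorem Valid.stepKey_mono (hD : D.Valid) (j u k : ℕ) {c c' : ℕ} (h : c ≤ c') (h' : c' ≤ D.n) :
    D.stepKey j u k c ≤ D.stepKey j u k c' := by
  have h1 : D.winStart j u c ≤ D.winStart j u c' := by
    unfold winStart; split_ifs <;> exact hD.passKey_mono _ h
  have h2 : D.winEnd j u c ≤ D.winEnd j u c' := by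
    unfold winEnd
    refine max_le_max h1 ?_
    split_ifs <;> exact hD.passKey_mono _ (by omega)
  unfold stepKey
  split_ifs
  · exact h1
  · unfold winTurn
    refine max_le_max h1 (min_le_min ?_ h2)
    split_ifs
    · exact hD.meetKey_mono _ h h'
    · exact hD.crossKey_mono _ h
  · exact h2

theorem Valid.first_le_stepKey (hD : D.Valid) (j u k c : ℕ) :
    toLex (0, 0) ≤ D.stepKey j u k c := by
  have h1 : toLex (0, 0) ≤ D.winStart j u c := by
    unfold winStart; split_ifs <;> exact hD.first_le_passKey _ _
  unfold stepKey winTurn winEnd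
  split_ifs <;> first | exact h1 | exact h1.trans (le_max_left _ _)

theorem Valid.stepKey_le_last (hD : D.Valid) (j u k c : ℕ) :
    D.stepKey j u k c ≤ toLex (D.L, 1) := by
  have h1 : D.winStart j u c ≤ toLex (D.L, 1) := by
    unfold winStart; split_ifs <;> exact hD.passKey_le_last _ _
  have h2 : D.winEnd j u c ≤ toLex (D.L, 1) :=
    max_le h1 (by split_ifs <;> exact hD.passKey_le_last _ _)
  unfold stepKey
  split_ifs
  · exact h1
  · exact max_le h1 ((min_le_right _ _).trans h2)
  · exact h2

/-- A note of the reference. -/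
def refNote (D : ScalingData) (i : ℕ) : ℝ × ℝ := (D.x i, D.p i)

/-- A note of the scaled query. -/
noncomputable def queryNote (D : ScalingData) (ε : ℝ) (j : ℕ) : ℝ × ℝ :=
  (D.t j + (2 * (j : ℝ) + 1) / 2 * ε, D.q j)

theorem Valid.queryNote_lt (hD : D.Valid) {ε : ℝ} (h0 : 0 ≤ ε) {j j' : ℕ} (h : j < j')
    (h' : j' < D.m) : (D.queryNote ε j).1 < (D.queryNote ε j').1 := by
  have h1 := hD.t_lt j j' h h'
  have h2 : (j : ℝ) ≤ j' := by exact_mod_cast h.le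
  have h3 := mul_le_mul_of_nonneg_right h2 h0
  simp only [queryNote]
  linarith

/-! ### What the keys say about a given scaling. -/

theorem passKey_zero_left (D : ScalingData) (j : ℕ) : D.passKey 0 j = toLex (0, 0) := by
  simp [passKey]

theorem passKey_of_gt {c : ℕ} (j : ℕ) (h : D.n < c) : D.passKey c j = toLex (D.L, 1) := by
  rw [passKey, if_neg (by omega), if_pos h]

theorem passKey_zero_right {c : ℕ} (h : c ≠ 0) : D.passKey c 0 = toLex (D.L, 1) := by
  simp [passKey, h]

theorem passKey_of_ge {c j : ℕ} (hc : c ≤ D.n) (hj : D.m ≤ j) (h0 : 0 < j) :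
    D.passKey c j = toLex (0, 0) := by
  simp [passKey, not_lt.2 hc, not_lt.2 hj, h0.ne']

/-- The bisector of the query notes `j` and `j + 1` moves with speed `j + 1`, by which the key
divides. The side is `1` when the tie goes to the later note, so that the change comes only after
the moment of the tie. -/
theorem passKey_le_germ {ε : ℝ} (h0 : 0 ≤ ε) (hL : ε ≤ D.L) {i j : ℕ} (hi : i < D.n)
    (hj : j + 1 < D.m) : D.passKey (i + 1) (j + 1) ≤ germ ε ↔
      Precedes (D.refNote i) (D.queryNote ε j) (D.queryNote ε (j + 1)) := by
  rw [passKey, if_neg (by omega), if_neg (by omega), if_neg (by omega), if_neg (by omega),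
    clampKey_le_germ h0 hL]
  have hj0 : (0 : ℝ) < ((j + 1 : ℕ) : ℝ) := by positivity
  rw [div_lt_iff₀ hj0, div_eq_iff hj0.ne']
  simp only [Precedes, refNote, queryNote, Nat.add_sub_cancel]
  push_cast
  refine or_congr ?_ (and_congr ?_ ?_)
  · constructor <;> intro h <;> linarith
  · constructor <;> intro h <;> linarith
  · split_ifs with h <;> simp [h]

/-- Here the query note moves across a fixed bisector, and a tie that goes to the later reference
note takes effect at once, with side `0`. -/
theorem crossKey_le_germ {ε : ℝ} (h0 : 0 ≤ ε) (hL : ε ≤ D.L) {i : ℕ} (j : ℕ) (hi : i + 1 < D.n) :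
    D.crossKey (i + 1) j ≤ germ ε ↔
      ¬ Precedes (D.queryNote ε j) (D.refNote i) (D.refNote (i + 1)) := by
  rw [crossKey, if_neg (by omega), if_neg (by omega), clampKey_le_germ h0 hL]
  have hj0 : (0 : ℝ) < (2 * (j : ℝ) + 1) / 2 := by positivity
  rw [div_lt_iff₀ hj0, div_eq_iff hj0.ne']
  simp only [Precedes, refNote, queryNote, Nat.add_sub_cancel, abs_sub_comm (D.q j)]
  push Not
  rcases lt_trichotomy ((D.x i + D.x (i + 1)) / 2) (D.t j + (2 * (j : ℝ) + 1) / 2 * ε) with h | h | h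
  · refine iff_of_true (Or.inl (by linarith)) ⟨h.le, fun h' => absurd h' h.ne'⟩
  · split_ifs with hc
    · refine iff_of_true (Or.inr ⟨by linarith, rfl⟩) ⟨h.le, fun _ => hc⟩
    · refine iff_of_false ?_ fun h' => hc (h'.2 h.symm)
      rintro (h' | ⟨-, h'⟩)
      · linarith
      · omega
  · refine iff_of_false ?_ fun h' => absurd h'.1 (not_le.2 h)
    rintro (h' | ⟨h', -⟩) <;> linarith

/-- At the meeting time itself the falling and the rising distance agree, so the side `0` is a mere
convention. -/
theorem germ_lt_meetKey {ε : ℝ} (h0 : 0 ≤ ε) (hL : ε ≤ D.L) (i j : ℕ) :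
    germ ε < D.meetKey (i + 1) j ↔ (D.queryNote ε j).1 < (D.refNote i).1 := by
  rw [← not_le, meetKey, clampKey_le_germ h0 hL]
  have hj0 : (0 : ℝ) < (2 * (j : ℝ) + 1) / 2 := by positivity
  simp only [and_true, ← le_iff_lt_or_eq, div_le_iff₀ hj0, refNote, queryNote, not_le,
    Nat.add_sub_cancel]
  constructor <;> intro h <;> linarith

theorem rising_eq_manhattan {ε : ℝ} {i j : ℕ} (h : (D.refNote i).1 ≤ (D.queryNote ε j).1) :
    (D.rising (i + 1) j).1 * ε + (D.rising (i + 1) j).2 =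
      manhattan (D.refNote i) (D.queryNote ε j) := by
  rw [manhattan, abs_of_nonpos (by linarith)]
  simp only [rising, refNote, queryNote, Nat.add_sub_cancel]
  ring

theorem falling_eq_manhattan {ε : ℝ} {i j : ℕ} (h : (D.queryNote ε j).1 ≤ (D.refNote i).1) :
    (D.falling (i + 1) j).1 * ε + (D.falling (i + 1) j).2 =
      manhattan (D.refNote i) (D.queryNote ε j) := by
  rw [manhattan, abs_of_nonneg (by linarith)]
  simp only [falling, refNote, queryNote, Nat.add_sub_cancel]
  ring

end ScalingData

/-- The data of a pair of melodies. -/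
noncomputable def scalingData {n m : ℕ} (R : PointMelody n) (Q : PointMelody m) : ScalingData where
  n := n
  m := m
  x := RealRAM.arrayOf R.time
  p := RealRAM.arrayOf R.pitch
  t := RealRAM.arrayOf Q.time
  q := RealRAM.arrayOf Q.pitch
  L := (R.duration - Q.duration) / m

namespace ScalingData

/-! ### The windows reproduce the matching. -/

section Melodies

variable {n m : ℕ} {R : PointMelody n} {Q : PointMelody m}

theorem valid_scalingData (hn : 0 < n) (hm : 0 < m) (h : Q.duration ≤ R.duration) :
    (scalingData R Q).Valid where
  n_pos := hn
  m_pos := hm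
  L_nonneg := div_nonneg (by linarith) (Nat.cast_nonneg m)
  x_lt := by
    intro i i' hi hi'
    have hi' : i' < n := hi'
    have h1 : i < n := by omega
    simp only [scalingData, RealRAM.arrayOf, hi', h1, dif_pos]
    exact R.time_strictMono hi
  t_lt := by
    intro i i' hi hi'
    have hi' : i' < m := hi'
    have h1 : i < m := by omega
    simp only [scalingData, RealRAM.arrayOf, hi', h1, dif_pos]
    exact Q.time_strictMono hi

theorem refNote_scalingData (i : Fin n) : (scalingData R Q).refNote i = R.notes i := by
  simp [refNote, scalingData, RealRAM.arrayOf, PointMelody.notes]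

theorem queryNote_scalingData (ε : ℝ) (j : Fin m) :
    (scalingData R Q).queryNote ε j = Q.scaledNotes ε j := by
  simp [queryNote, scalingData, RealRAM.arrayOf, PointMelody.scaledNotes, PointMelody.scaledTime]

theorem assigned_scaledNotes_iff {ε : ℝ} (h0 : 0 ≤ ε) (hL : ε ≤ (scalingData R Q).L)
    (i : Fin n) (j : Fin m) : Assigned (R.notes i) (Q.scaledNotes ε) j ↔
      ¬ (scalingData R Q).passKey (i + 1) j ≤ germ ε ∧
        (scalingData R Q).passKey (i + 1) (j + 1) ≤ germ ε := by
  set D := scalingData R Q with hD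
  have hi : (i : ℕ) < D.n := i.2
  rw [assigned_iff (Q.scaledNotes_strictMono h0)]
  simp only [← queryNote_scalingData (R := R) (Q := Q), ← refNote_scalingData (R := R) (Q := Q)]
  rw [← hD]
  refine and_congr ?_ ?_
  · rcases Nat.eq_zero_or_pos (j : ℕ) with hj | hj
    · rw [hj, passKey_zero_right (by omega)]
      refine iff_of_true (fun l hl => by omega) (not_last_le_germ hL)
    · have hjm : (j : ℕ) - 1 + 1 < D.m := by have : (j : ℕ) < D.m := j.2; omega
      have e : (j : ℕ) - 1 + 1 = j := by omega
      have := passKey_le_germ h0 hL hi hjm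
      rw [e] at this
      rw [this]
      constructor
      · intro h
        exact h ⟨j - 1, by omega⟩ (by simp only; omega)
      · rintro h l hl
        rwa [show (l : ℕ) = (j : ℕ) - 1 by omega]
  · by_cases hj : (j : ℕ) + 1 < m
    · rw [passKey_le_germ h0 hL hi hj]
      constructor
      · intro h
        exact h ⟨j + 1, hj⟩ rfl
      · rintro h r hr
        rwa [hr]
    · have : D.m ≤ (j : ℕ) + 1 := not_lt.1 hj
      rw [passKey_of_ge (by omega) this (by omega)]
      refine iff_of_true (fun r hr => by omega) (first_le_germ h0)

/-- The bisectors of the query increase with the index: a reference note before one of them is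
before the next. -/
theorem Valid.passKey_le_germ_succ {D : ScalingData} (hD : D.Valid) {ε : ℝ} (h0 : 0 ≤ ε)
    (hL : ε ≤ D.L) {c j : ℕ} (hc : c ≤ D.n) (h : D.passKey c j ≤ germ ε) :
    D.passKey c (j + 1) ≤ germ ε := by
  rcases c with _ | i
  · rw [passKey_zero_left]; exact first_le_germ h0
  by_cases hj : j + 1 < D.m
  swap
  · rw [passKey_of_ge hc (by omega) (by omega)]; exact first_le_germ h0
  rcases j with _ | j
  · rw [passKey_zero_right (by omega)] at h
    exact absurd h (not_last_le_germ hL)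
  rw [passKey_le_germ h0 hL (by omega) (by omega)] at h
  rw [passKey_le_germ h0 hL (by omega) hj]
  have h1 := h.le
  have h2 := hD.queryNote_lt h0 (show j < j + 1 by omega) (by omega)
  have h3 := hD.queryNote_lt h0 (show j + 1 < j + 1 + 1 by omega) (by omega)
  exact .of_lt (by linarith)

/-- The maximum in `winEnd` only turns a window whose end would precede its start into an empty one.
-/
theorem lt_winEnd_iff {D : ScalingData} {j u c : ℕ} {g : StepKey} (h : D.winStart j u c ≤ g) :
    g < D.winEnd j u c ↔
      g < (if u = 0 then D.passKey c j else D.passKey (c + 1) (j + 1)) := by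
  simp [winEnd, not_lt.2 h]

open Classical in
theorem sum_winCost_matched {ε : ℝ} (h0 : 0 ≤ ε) (hL : ε ≤ (scalingData R Q).L) (j : Fin m) :
    ∑ c ∈ Finset.range (n + 1), (scalingData R Q).winCost j 0 c ε =
      ∑ i, if Assigned (R.notes i) (Q.scaledNotes ε) j then
        manhattan (R.notes i) (Q.scaledNotes ε j) else 0 := by
  set D := scalingData R Q with hD
  rw [Finset.sum_range_succ']
  have hz : D.winCost j 0 0 ε = 0 := by
    rw [winCost, if_neg]
    rintro ⟨h1, h2⟩
    rw [lt_winEnd_iff h1, if_pos rfl, passKey_zero_left] at h2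
    exact absurd (first_le_germ h0) (not_le.2 h2)
  rw [hz, add_zero, Finset.sum_range]
  refine Finset.sum_congr rfl fun i _ => ?_
  have hcond : (D.winStart j 0 (i + 1) ≤ germ ε ∧ germ ε < D.winEnd j 0 (i + 1)) ↔
      Assigned (R.notes i) (Q.scaledNotes ε) j := by
    rw [assigned_scaledNotes_iff h0 hL, and_comm, ← hD]
    constructor
    · rintro ⟨h1, h2⟩
      rw [lt_winEnd_iff h2, if_pos rfl] at h1
      exact ⟨not_le.2 h1, h2⟩
    · rintro ⟨h1, h2⟩
      refine ⟨?_, h2⟩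
      rw [lt_winEnd_iff h2, if_pos rfl]
      exact not_le.1 h1
  rw [winCost]
  by_cases h : Assigned (R.notes i) (Q.scaledNotes ε) j
  · rw [if_pos (hcond.2 h), if_pos h, if_pos rfl, costBefore, costAfter, if_pos rfl, if_pos rfl,
      ← queryNote_scalingData (R := R) (Q := Q), ← refNote_scalingData (R := R) (Q := Q), ← hD]
    split_ifs with h1 <;> rw [germ_lt_meetKey h0 hL] at h1
    · exact falling_eq_manhattan h1.le
    · exact rising_eq_manhattan (not_lt.1 h1)
  · rw [if_neg (mt hcond.1 h), if_neg h]

-- For an unmatched `j` exactly one `c` has its window open: the number of reference notes assigned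
-- before `j`. The nearest reference note is then `c - 1` or `c`, and `crossKey` tells which. For a
-- matched `j`, monotonicity of `passKey` in the reference index closes all these windows.
open Classical in
theorem sum_winCost_unmatched (hV : (scalingData R Q).Valid) {ε : ℝ} (h0 : 0 ≤ ε)
    (hL : ε ≤ (scalingData R Q).L) (j : Fin m) :
    ∑ c ∈ Finset.range (n + 1), (scalingData R Q).winCost j 1 c ε =
      ∑ i, if Unmatched R.notes (Q.scaledNotes ε) j ∧ Assigned (Q.scaledNotes ε j) R.notes i then
        manhattan (R.notes i) (Q.scaledNotes ε j) else 0 := by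
  set D := scalingData R Q with hD
  have hn : 0 < n := hV.n_pos
  have hjm : (j : ℕ) < D.m := j.2
  have hcond : ∀ c, (D.winStart j 1 c ≤ germ ε ∧ germ ε < D.winEnd j 1 c) ↔
      D.passKey c j ≤ germ ε ∧ ¬ D.passKey (c + 1) (j + 1) ≤ germ ε := by
    intro c
    have e : D.winStart j 1 c = D.passKey c j := by simp [winStart]
    constructor
    · rintro ⟨h1, h2⟩
      rw [lt_winEnd_iff h1, if_neg one_ne_zero] at h2
      exact ⟨e ▸ h1, not_le.2 h2⟩
    · rintro ⟨h1, h2⟩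
      rw [← e] at h1
      exact ⟨h1, by rw [lt_winEnd_iff h1, if_neg one_ne_zero]; exact not_le.1 h2⟩
  by_cases hU : Unmatched R.notes (Q.scaledNotes ε) j
  swap
  · rw [Finset.sum_eq_zero, Finset.sum_eq_zero]
    · intro i _
      rw [if_neg fun h => hU h.1]
    · intro c _
      rw [winCost, if_neg]
      rw [hcond]
      rintro ⟨h1, h2⟩
      unfold Unmatched at hU
      push Not at hU
      obtain ⟨i, hi⟩ := hU
      rw [assigned_scaledNotes_iff h0 hL, ← hD] at hi
      rcases le_or_gt c i with h | h
      · exact h2 ((hV.passKey_mono _ (by omega)).trans hi.2)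
      · exact hi.1 ((hV.passKey_mono _ (by omega)).trans h1)
  -- the number of notes of the reference that are assigned to earlier notes than `j`
  have hex : ∃ c, c ≤ n ∧ D.passKey c j ≤ germ ε ∧ ¬ D.passKey (c + 1) (j + 1) ≤ germ ε := by
    have hP0 : D.passKey 0 j ≤ germ ε := by rw [passKey_zero_left]; exact first_le_germ h0
    -- The first `c` reference notes belong before `j`. By maximality the next one does not; if it
    -- also preceded the bisector after `j`, it would be assigned to `j`.
    let c := Nat.findGreatest (fun c => D.passKey c j ≤ germ ε) n
    have hcn : c ≤ n := Nat.findGreatest_le n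
    have hc : D.passKey c j ≤ germ ε :=
      Nat.findGreatest_spec (P := fun c => D.passKey c j ≤ germ ε) (Nat.zero_le n) hP0
    refine ⟨c, hcn, hc, fun h => ?_⟩
    rcases hcn.lt_or_eq with hlt | heq
    · have hnot : ¬ D.passKey (c + 1) j ≤ germ ε :=
        Nat.findGreatest_is_greatest (P := fun c => D.passKey c j ≤ germ ε) (Nat.lt_succ_self c) hlt
      exact hU ⟨c, hlt⟩ ((assigned_scaledNotes_iff h0 hL _ _).2 ⟨hnot, h⟩)
    · rw [passKey_of_gt (D := D) _ (show n < c + 1 by omega)] at h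
      exact not_last_le_germ hL h
  obtain ⟨c, hcn, hc1, hc2⟩ := hex
  -- Two open windows would contain a reference note that is before the bisector preceding `j` but
  -- not before the one following it.
  have huniq : ∀ c', c' ≤ n → D.passKey c' j ≤ germ ε →
      ¬ D.passKey (c' + 1) (j + 1) ≤ germ ε → c' = c := by
    have aux : ∀ a b, b ≤ n → ¬ D.passKey (a + 1) (j + 1) ≤ germ ε →
        D.passKey b j ≤ germ ε → b ≤ a := by
      intro a b hb h1 h2
      by_contra h
      exact h1 (hV.passKey_le_germ_succ h0 hL (show a + 1 ≤ n by omega)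
        ((hV.passKey_mono j (by omega)).trans h2))
    intro c' h h1 h2
    exact le_antisymm (aux c c' h hc2 h1) (aux c' c hcn h2 hc1)
  rw [Finset.sum_eq_single c]
  rotate_left
  · intro c' hc' hne
    rw [winCost, if_neg]
    rw [hcond]
    rintro ⟨h1, h2⟩
    exact hne (huniq c' (by rw [Finset.mem_range] at hc'; omega) h1 h2)
  · intro h
    exact absurd (Finset.mem_range.2 (by omega)) h
  rw [winCost, if_pos ((hcond c).2 ⟨hc1, hc2⟩)]
  simp only [hU, true_and, one_ne_zero, if_false, costBefore, costAfter,
    ← queryNote_scalingData (R := R) (Q := Q)]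
  -- the neighbours of `j` in the reference
  have hbefore : ∀ i, i + 1 ≤ c → D.x i < (D.queryNote ε j).1 := by
    intro i hi
    refine (hV.x_le (show i ≤ c - 1 by omega) (show c - 1 < n by omega)).trans_lt ?_
    obtain ⟨i', rfl⟩ : ∃ i', c = i' + 1 := ⟨c - 1, by omega⟩
    rcases hj0 : (j : ℕ) with _ | j'
    · rw [hj0, passKey_zero_right (by omega)] at hc1
      exact absurd hc1 (not_last_le_germ hL)
    · rw [hj0, passKey_le_germ h0 hL (show i' < n by omega) (by omega)] at hc1
      have h1 := hc1.le
      have h2 := hV.queryNote_lt h0 (Nat.lt_succ_self j') (by omega)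
      simp only [refNote, Nat.add_sub_cancel] at h1 ⊢
      linarith
  have hafter : ∀ i, c ≤ i → i < n → (D.queryNote ε j).1 < D.x i := by
    intro i hi hin
    refine lt_of_lt_of_le ?_ (hV.x_le hi hin)
    by_cases hj1 : (j : ℕ) + 1 < D.m
    · rw [passKey_le_germ h0 hL (show c < n by omega) hj1] at hc2
      have h1 := le_of_not_precedes hc2
      have h2 := hV.queryNote_lt h0 (Nat.lt_succ_self (j : ℕ)) hj1
      simp only [refNote] at h1
      linarith
    · rw [passKey_of_ge (show c + 1 ≤ n by omega) (by omega) (by omega)] at hc2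
      exact absurd (first_le_germ h0) hc2
  -- Bisectors of reference notes below `c - 1` and above `c` are settled by `hbefore` and `hafter`;
  -- only the one between `c - 1` and `c` is open. The sentinels of `crossKey` at `c = 0` and `c =
  -- n` leave the only existing neighbour.
  have hass : ∀ i : Fin n, Assigned (D.queryNote ε j) R.notes i ↔
      (i : ℕ) + (if germ ε < D.crossKey c j then 1 else 0) = c := by
    intro i
    rw [assigned_iff R.notes_strictMono]
    simp only [← refNote_scalingData (R := R) (Q := Q)]
    rw [← hD]
    have hpre : ∀ i, c < i + 1 → i + 1 < n →
        Precedes (D.queryNote ε j) (D.refNote i) (D.refNote (i + 1)) := by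
      intro i h1 h2
      have h3 := hafter i (by omega) (by omega)
      have h4 := hafter (i + 1) (by omega) (by omega)
      exact .of_lt (by simp only [refNote]; linarith)
    have hnpre : ∀ i, i + 1 < c →
        ¬ Precedes (D.queryNote ε j) (D.refNote i) (D.refNote (i + 1)) := by
      intro i h1
      have h3 := hbefore i (by omega)
      have h4 := hbefore (i + 1) (by omega)
      exact not_precedes_of_lt (by simp only [refNote]; linarith)
    have hmid : ∀ i, i + 1 = c → c < n →
        (Precedes (D.queryNote ε j) (D.refNote i) (D.refNote (i + 1)) ↔
          germ ε < D.crossKey c j) := by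
      rintro i rfl h2
      rw [← not_le, crossKey_le_germ h0 hL _ h2, not_not]
    have hc0 : c = 0 → ¬ germ ε < D.crossKey c j := by
      rintro rfl
      simpa [crossKey] using first_le_germ h0
    have hcN : c = n → germ ε < D.crossKey c j := by
      intro h
      rw [crossKey, if_neg (by omega), if_pos (show ¬ c < D.n from h.not_lt)]
      exact not_le.1 (not_last_le_germ hL)
    constructor
    · rintro ⟨h1, h2⟩
      have h1' : (i : ℕ) ≠ 0 → ¬ Precedes (D.queryNote ε j) (D.refNote (i - 1))
          (D.refNote (i - 1 + 1)) := fun hi => by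
        have := h1 ⟨i - 1, by omega⟩ (by simp only; omega)
        rwa [show (i : ℕ) - 1 + 1 = i by omega]
      have h2' : (i : ℕ) + 1 < n → Precedes (D.queryNote ε j) (D.refNote i)
          (D.refNote (i + 1)) := fun hi => h2 ⟨i + 1, hi⟩ rfl
      have hle : (i : ℕ) ≤ c := by
        by_contra hlt
        exact h1' (by omega) (hpre _ (by omega) (by omega))
      have hge : c ≤ (i : ℕ) + 1 := by
        by_contra hlt
        exact hnpre i (by omega) (h2' (by omega))
      rcases hle.lt_or_eq with hlt | heq
      · rw [if_pos]
        · omega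
        · rcases hcn.lt_or_eq with h | h
          · exact (hmid i (by omega) h).1 (h2' (by omega))
          · exact hcN h
      · rw [if_neg]
        · omega
        · intro hg
          have hc0' : c ≠ 0 := fun h => hc0 h hg
          exact h1' (by omega) ((hmid (i - 1) (by omega) (by omega)).2 hg)
    · intro h
      refine ⟨fun l hl => ?_, fun r hr => ?_⟩
      · rw [← hl]
        split_ifs at h with hg
        · exact hnpre l (by omega)
        · rw [hmid l (by omega) (by omega)]; exact hg
      · rw [hr]
        split_ifs at h with hg
        · rw [hmid i h (by omega)]; exact hg
        · exact hpre i (by omega) (by omega)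
  have hpick : ∀ i₀ : Fin n, (∀ i, Assigned (D.queryNote ε j) R.notes i ↔ i = i₀) →
      (∑ i, if Assigned (D.queryNote ε j) R.notes i then
        manhattan (R.notes i) (D.queryNote ε j) else 0) =
          manhattan (D.refNote i₀) (D.queryNote ε j) := by
    intro i₀ h
    rw [Finset.sum_eq_single i₀, if_pos ((h i₀).2 rfl), hD, refNote_scalingData]
    · intro i _ hi
      rw [if_neg (mt (h i).1 hi)]
    · intro h
      exact absurd (Finset.mem_univ _) h
  split_ifs with hg
  · simp only [hg, if_true] at hass
    have hcpos : 0 < c := by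
      by_contra h
      obtain rfl : c = 0 := by omega
      simp only [crossKey, if_true] at hg
      exact absurd (first_le_germ h0) (not_le.2 hg)
    obtain ⟨i, rfl⟩ : ∃ i, c = i + 1 := ⟨c - 1, by omega⟩
    rw [← hD, hpick ⟨i, by omega⟩ fun i' => by rw [hass, Fin.ext_iff]; simp]
    exact rising_eq_manhattan (hbefore i le_rfl).le
  · simp only [hg, if_false, add_zero] at hass
    have hclt : c < n := by
      by_contra h
      rw [crossKey, if_neg (by omega), if_pos (show ¬ c < D.n from h)] at hg
      exact hg (not_le.1 (not_last_le_germ hL))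
    rw [← hD, hpick ⟨c, hclt⟩ fun i' => by rw [hass, Fin.ext_iff]]
    exact falling_eq_manhattan (hafter c le_rfl hclt).le

theorem scalingCost_eq_sum_winCost (hV : (scalingData R Q).Valid) {ε : ℝ} (h0 : 0 ≤ ε)
    (hL : ε ≤ (scalingData R Q).L) :
    scalingCost R Q ε = ∑ j ∈ Finset.range m, ∑ u ∈ Finset.range 2, ∑ c ∈ Finset.range (n + 1),
      (scalingData R Q).winCost j u c ε := by
  classical
  rw [scalingCost, matchingCost, Finset.sum_range]
  refine Finset.sum_congr rfl fun j _ => ?_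
  rw [Finset.sum_range_succ, Finset.sum_range_one, sum_winCost_matched h0 hL,
    sum_winCost_unmatched hV h0 hL, noteCost, ← Finset.sum_add_distrib]
  refine Finset.sum_congr rfl fun i _ => ?_
  by_cases h1 : Assigned (R.notes i) (Q.scaledNotes ε) j
  · have h2 : ¬ Unmatched R.notes (Q.scaledNotes ε) j := fun h => h i h1
    simp [Matched, h1, h2]
  · simp [Matched, h1]

end Melodies

/-! ### Numbering the steps -/

theorem sum_range_mul {M : Type*} [AddCommMonoid M] (f : ℕ → ℕ → M) (a b : ℕ) :
    ∑ k ∈ Finset.range (a * b), f (k / b) (k % b) =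
      ∑ i ∈ Finset.range a, ∑ j ∈ Finset.range b, f i j := by
  induction a with
  | zero => simp
  | succ a ih =>
    rw [Finset.sum_range_succ, ← ih, Nat.succ_mul, Finset.sum_range_add]
    congr 1
    refine Finset.sum_congr rfl fun j hj => ?_
    have hj := Finset.mem_range.1 hj
    rw [Nat.mul_comm a b, Nat.mul_add_div (by omega), Nat.mul_add_mod, Nat.div_eq_of_lt hj,
      Nat.mod_eq_of_lt hj, Nat.add_zero]

/-- The number of steps. -/
def size (D : ScalingData) : ℕ := D.m * 2 * 3 * (D.n + 1)

/-- The key of the step number `k`. -/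
noncomputable def keyAt (D : ScalingData) (k : ℕ) : StepKey :=
  D.stepKey (k / (D.n + 1) / 3 / 2) (k / (D.n + 1) / 3 % 2) (k / (D.n + 1) % 3) (k % (D.n + 1))

/-- The jump of the step number `k`. -/
noncomputable def jumpAt (D : ScalingData) (k : ℕ) : ℝ × ℝ :=
  D.stepJump (k / (D.n + 1) / 3 / 2) (k / (D.n + 1) / 3 % 2) (k / (D.n + 1) % 3) (k % (D.n + 1))

theorem scalingCost_eq_sum_steps {n m : ℕ} {R : PointMelody n} {Q : PointMelody m}
    (hV : (scalingData R Q).Valid) {ε : ℝ} (h0 : 0 ≤ ε) (hL : ε ≤ (scalingData R Q).L) :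
    scalingCost R Q ε = ∑ k ∈ Finset.range (scalingData R Q).size,
      if (scalingData R Q).keyAt k ≤ germ ε then
        ((scalingData R Q).jumpAt k).1 * ε + ((scalingData R Q).jumpAt k).2 else 0 := by
  rw [scalingCost_eq_sum_winCost hV h0 hL]
  set D := scalingData R Q
  unfold size keyAt jumpAt
  rw [sum_range_mul (fun a c => if D.stepKey (a / 3 / 2) (a / 3 % 2) (a % 3) c ≤ germ ε then
      (D.stepJump (a / 3 / 2) (a / 3 % 2) (a % 3) c).1 * ε +
      (D.stepJump (a / 3 / 2) (a / 3 % 2) (a % 3) c).2 else 0) (D.m * 2 * 3) (D.n + 1),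
    sum_range_mul (fun a k => ∑ c ∈ Finset.range (D.n + 1),
      if D.stepKey (a / 2) (a % 2) k c ≤ germ ε then
      (D.stepJump (a / 2) (a % 2) k c).1 * ε +
      (D.stepJump (a / 2) (a % 2) k c).2 else 0) (D.m * 2) 3,
    sum_range_mul (fun j u => ∑ k ∈ Finset.range 3, ∑ c ∈ Finset.range (D.n + 1),
      if D.stepKey j u k c ≤ germ ε then
      (D.stepJump j u k c).1 * ε + (D.stepJump j u k c).2 else 0) D.m 2]
  refine Finset.sum_congr rfl fun j _ => Finset.sum_congr rfl fun u _ => ?_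
  -- In the numbering the reference index runs fastest, whereas each window splits into its three
  -- steps.
  rw [Finset.sum_comm]
  exact Finset.sum_congr rfl fun c _ => D.winCost_eq_sum j u c ε

end ScalingData

/-! ## Reasoning about programs -/

namespace RealRAM

namespace State

def setN (s : State) (r v : ℕ) : State := { s with nat := Function.update s.nat r v }

def setR (s : State) (r : ℕ) (v : ℝ) : State := { s with real := Function.update s.real r v }

def putN (s : State) (arr i v : ℕ) : State :=
  { s with natArr := Function.update s.natArr arr (Function.update (s.natArr arr) i v) }

def putR (s : State) (arr i : ℕ) (v : ℝ) : State :=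
  { s with realArr := Function.update s.realArr arr (Function.update (s.realArr arr) i v) }

variable (s : State) (r r' arr arr' i i' v : ℕ) (x : ℝ)

@[simp] theorem setN_nat : (s.setN r v).nat r' = if r' = r then v else s.nat r' := by
  simp [setN, Function.update_apply]
@[simp] theorem setN_real : (s.setN r v).real = s.real := rfl
@[simp] theorem setN_natArr : (s.setN r v).natArr = s.natArr := rfl
@[simp] theorem setN_realArr : (s.setN r v).realArr = s.realArr := rfl
@[simp] theorem setR_nat : (s.setR r x).nat = s.nat := rfl
@[simp] theorem setR_real : (s.setR r x).real r' = if r' = r then x else s.real r' := by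
  simp [setR, Function.update_apply]
@[simp] theorem setR_natArr : (s.setR r x).natArr = s.natArr := rfl
@[simp] theorem setR_realArr : (s.setR r x).realArr = s.realArr := rfl
@[simp] theorem putN_nat : (s.putN arr i v).nat = s.nat := rfl
@[simp] theorem putN_real : (s.putN arr i v).real = s.real := rfl
@[simp] theorem putN_natArr : (s.putN arr i v).natArr arr' =
    if arr' = arr then Function.update (s.natArr arr) i v else s.natArr arr' := by
  simp [putN, Function.update_apply]
@[simp] theorem putN_realArr : (s.putN arr i v).realArr = s.realArr := rfl
@[simp] theorem putR_nat : (s.putR arr i x).nat = s.nat := rfl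
@[simp] theorem putR_real : (s.putR arr i x).real = s.real := rfl
@[simp] theorem putR_natArr : (s.putR arr i x).natArr = s.natArr := rfl
@[simp] theorem putR_realArr : (s.putR arr i x).realArr arr' =
    if arr' = arr then Function.update (s.realArr arr) i x else s.realArr arr' := by
  simp [putR, Function.update_apply]

end State

@[simp] theorem NatExpr.eval_setR (e : NatExpr) (s : State) (r : ℕ) (x : ℝ) :
    e.eval (s.setR r x) = e.eval s := by
  induction e <;> simp_all [NatExpr.eval]

open Classical in
/-- The final state of a program without loops. -/
noncomputable def Prog.run : Prog → State → State
  | .skip, s => s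
  | .setNat r e, s => s.setN r (e.eval s)
  | .setReal r e, s => s.setR r (e.eval s)
  | .putNat arr idx e, s => s.putN arr (idx.eval s) (e.eval s)
  | .putReal arr idx e, s => s.putR arr (idx.eval s) (e.eval s)
  | .seq c d, s => d.run (c.run s)
  | .cond b c d, s => if b.Holds s then c.run s else d.run s
  | .loop _ _, s => s

theorem Prog.run_cond_pos {b : Test} {c d : Prog} {s : State} (h : b.Holds s) :
    (Prog.cond b c d).run s = c.run s := by rw [Prog.run, if_pos h]

theorem Prog.run_cond_neg {b : Test} {c d : Prog} {s : State} (h : ¬ b.Holds s) :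
    (Prog.cond b c d).run s = d.run s := by rw [Prog.run, if_neg h]

/-- A bound for the running time of a program without loops. -/
def Prog.cost : Prog → ℕ
  | .skip => 1
  | .setNat _ e => e.time + 1
  | .setReal _ e => e.time + 1
  | .putNat _ idx e => idx.time + e.time + 1
  | .putReal _ idx e => idx.time + e.time + 1
  | .seq c d => c.cost + d.cost
  | .cond b c d => b.time + 1 + max c.cost d.cost
  | .loop _ _ => 0

/-- There is no loop in the program. -/
def Prog.LoopFree : Prog → Prop
  | .seq c d => c.LoopFree ∧ d.LoopFree
  | .cond _ c d => c.LoopFree ∧ d.LoopFree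
  | .loop _ _ => False
  | _ => True

/-- Programs without loops are thereby verified by evaluating `Prog.run`; only the loops need
invariants. -/
theorem Prog.LoopFree.exec {c : Prog} (h : c.LoopFree) (s : State) :
    ∃ t ≤ c.cost, Exec c s (c.run s) t := by
  induction c generalizing s with
  | skip => exact ⟨_, le_rfl, .skip s⟩
  | setNat r e => exact ⟨_, le_rfl, .setNat r e s⟩
  | setReal r e => exact ⟨_, le_rfl, .setReal r e s⟩
  | putNat arr idx e => exact ⟨_, le_rfl, .putNat arr idx e s⟩
  | putReal arr idx e => exact ⟨_, le_rfl, .putReal arr idx e s⟩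
  | seq c d hc hd =>
    obtain ⟨t, ht, h1⟩ := hc h.1 s
    obtain ⟨u, hu, h2⟩ := hd h.2 (c.run s)
    exact ⟨t + u, Nat.add_le_add ht hu, h1.seq h2⟩
  | cond b c d hc hd =>
    by_cases hb : b.Holds s
    · obtain ⟨t, ht, h1⟩ := hc h.1 s
      refine ⟨b.time + 1 + t, Nat.add_le_add_left (ht.trans (le_max_left _ _)) _, ?_⟩
      rw [Prog.run, if_pos hb]
      exact .condTrue hb h1
    · obtain ⟨t, ht, h1⟩ := hd h.2 s
      refine ⟨b.time + 1 + t, Nat.add_le_add_left (ht.trans (le_max_right _ _)) _, ?_⟩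
      rw [Prog.run, if_neg hb]
      exact .condFalse hb h1
  | loop b c => exact h.elim

/-- Started in `s`, the program halts within `T` units of time in a state with property `P`. -/
def Halts (c : Prog) (s : State) (T : ℕ) (P : State → Prop) : Prop :=
  ∃ s' t, Exec c s s' t ∧ t ≤ T ∧ P s'

theorem Halts.mono {c : Prog} {s : State} {T T' : ℕ} {P P' : State → Prop} (h : Halts c s T P)
    (hT : T ≤ T') (hP : ∀ s', P s' → P' s') : Halts c s T' P' := by
  obtain ⟨s', t, h1, h2, h3⟩ := h
  exact ⟨s', t, h1, h2.trans hT, hP _ h3⟩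

theorem Halts.seq {c d : Prog} {s : State} {T U : ℕ} {P P' : State → Prop} (h : Halts c s T P)
    (h' : ∀ s', P s' → Halts d s' U P') : Halts (.seq c d) s (T + U) P' := by
  obtain ⟨s', t, h1, h2, h3⟩ := h
  obtain ⟨s'', u, h4, h5, h6⟩ := h' s' h3
  exact ⟨s'', t + u, h1.seq h4, Nat.add_le_add h2 h5, h6⟩

theorem Prog.LoopFree.halts {c : Prog} (h : c.LoopFree) {s : State} {P : State → Prop}
    (hP : P (c.run s)) : Halts c s c.cost P := by
  obtain ⟨t, ht, h1⟩ := h.exec s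
  exact ⟨_, t, h1, ht, hP⟩

/-- The rule for loops, with an invariant that includes a bound for the number of rounds. -/
theorem Halts.loop {b : Test} {c : Prog} {Inv : ℕ → State → Prop} {T : ℕ}
    (hbody : ∀ k s, Inv k s → b.Holds s → Halts c s T fun s' => ∃ k' < k, Inv k' s') :
    ∀ k s, Inv k s →
      Halts (.loop b c) s ((k + 1) * (b.time + 1 + T)) fun s' => ¬ b.Holds s' ∧ ∃ k', Inv k' s' := by
  intro k
  induction k using Nat.strong_induction_on with
  | _ k ih =>
    intro s hs
    by_cases hb : b.Holds s
    · obtain ⟨s', t, h1, h2, k', hk, h3⟩ := hbody k s hs hb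
      obtain ⟨s'', u, h4, h5, h6⟩ := ih k' hk s' h3
      refine ⟨s'', _, .loopTrue hb h1 h4, ?_, h6⟩
      have : (k' + 1) * (b.time + 1 + T) ≤ k * (b.time + 1 + T) := Nat.mul_le_mul_right _ hk
      rw [Nat.succ_mul]
      omega
    · refine ⟨s, _, .loopFalse hb, ?_, hb, k, hs⟩
      rw [Nat.succ_mul]
      omega

/-- Sequential composition. -/
def block : List Prog → Prog
  | [] => .skip
  | c :: l => .seq c (block l)

/-! ## Keys in registers -/

/-- A key in a real and a natural register. -/
noncomputable def State.setKey (s : State) (d e : ℕ) (k : StepKey) : State :=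
  (s.setR d (ofLex k).1).setN e (ofLex k).2

variable {s : State} {d e d' e' : ℕ} {k : StepKey}

@[simp] theorem State.setKey_nat (r : ℕ) :
    (s.setKey d e k).nat r = if r = e then (ofLex k).2 else s.nat r := by simp [setKey]
@[simp] theorem State.setKey_real (r : ℕ) :
    (s.setKey d e k).real r = if r = d then (ofLex k).1 else s.real r := by simp [setKey]
@[simp] theorem State.setKey_natArr : (s.setKey d e k).natArr = s.natArr := rfl
@[simp] theorem State.setKey_realArr : (s.setKey d e k).realArr = s.realArr := rfl

/-- The key in a pair of registers. -/
noncomputable def State.key (s : State) (d e : ℕ) : StepKey := toLex (s.real d, s.nat e)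

theorem State.ext' {s s' : State} (h1 : ∀ r, s.nat r = s'.nat r) (h2 : ∀ r, s.real r = s'.real r)
    (h3 : s.natArr = s'.natArr) (h4 : s.realArr = s'.realArr) : s = s' := by
  cases s; cases s'
  simp only [State.mk.injEq]
  exact ⟨funext h1, funext h2, h3, h4⟩

/-- The instance of the problem that is stored in a state. -/
def State.data (s : State) : ScalingData where
  n := s.nat 0
  m := s.nat 1
  x := s.realArr 0
  p := s.realArr 1
  t := s.realArr 2
  q := s.realArr 3
  L := s.real 2

theorem State.data_setKey (s : State) {d e : ℕ} (k : StepKey) (hd : d ≠ 2) (he : 1 < e) :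
    (s.setKey d e k).data = s.data := by
  have h0 : 0 ≠ e := by omega
  have h1 : 1 ≠ e := by omega
  simp [State.data, hd.symm, h0, h1]

/-- The comparison of two keys. -/
def keyLt (a : RealExpr) (b : NatExpr) (a' : RealExpr) (b' : NatExpr) : Test :=
  .neg (.conj (.neg (.realLt a a')) (.neg (.conj (.realEq a a') (.natLt b b'))))

theorem holds_keyLt {a a' : RealExpr} {b b' : NatExpr} :
    (keyLt a b a' b').Holds s ↔
      (toLex (a.eval s, b.eval s) : StepKey) < toLex (a'.eval s, b'.eval s) := by
  simp only [keyLt, Test.Holds, Prod.Lex.toLex_lt_toLex]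
  tauto

def loadKey (d e : ℕ) (a : RealExpr) (b : ℕ) : Prog :=
  .seq (.setReal d a) (.setNat e (.const b))

theorem run_loadKey {a : RealExpr} {b : ℕ} :
    (loadKey d e a b).run s = s.setKey d e (toLex (a.eval s, b)) := rfl

/-- `clampKey` of a quotient, with the side `v` or `w` according to a test. -/
def clampProg (num den : RealExpr) (tie : Test) (v w d e : ℕ) : Prog :=
  block [.setReal d (.div num den), .cond tie (.setNat e (.const v)) (.setNat e (.const w)),
    .cond (.realLt (.reg d) (.const 0)) (loadKey d e (.const 0) 0)
      (.cond (.realLt (.reg 2) (.reg d)) (loadKey d e (.reg 2) 1) .skip)]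

-- The tie test is executed after register `d` has received the quotient, hence the hypothesis that
-- its outcome does not depend on that register.
open Classical in
theorem run_clampProg {num den : RealExpr} {tie : Test} {v w : ℕ} (hd : d ≠ 2)
    (htie : tie.Holds (s.setR d (num.eval s / den.eval s)) ↔ tie.Holds s) :
    (clampProg num den tie v w d e).run s =
      s.setKey d e (clampKey (s.real 2) (num.eval s / den.eval s) (if tie.Holds s then v else w)) := by
  simp only [clampProg, block, Prog.run, RealExpr.eval, NatExpr.eval, htie]
  by_cases ht : tie.Holds s <;>
  · simp only [ht, if_true, if_false, Test.Holds, RealExpr.eval, State.setN_real, State.setR_real,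
      hd.symm, Nat.cast_zero, run_loadKey]
    unfold clampKey
    split_ifs <;> refine State.ext' (fun r => ?_) (fun r => ?_) rfl rfl <;> simp <;>
      split_ifs <;> rfl

/-- Absolute values are compared through their squares, which needs no branching. -/
def sq (a : RealExpr) : RealExpr := .mul a a

theorem eval_sq {a : RealExpr} : (sq a).eval s = a.eval s ^ 2 := by
  simp [sq, RealExpr.eval, pow_two]

/-- `ScalingData.passKey`; the third argument is the second one as a real number. -/
def passProg (c j : NatExpr) (jr : RealExpr) (d e : ℕ) : Prog :=
  .cond (.natEq c (.const 0)) (loadKey d e (.const 0) 0) <|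
  .cond (.natLt (.reg 0) c) (loadKey d e (.reg 2) 1) <|
  .cond (.natEq j (.const 0)) (loadKey d e (.reg 2) 1) <|
  .cond (.neg (.natLt j (.reg 1))) (loadKey d e (.const 0) 0) <|
  clampProg
    (.sub (.get 0 (.sub c (.const 1)))
      (.div (.add (.get 2 (.sub j (.const 1))) (.get 2 j)) (.const 2))) jr
    (.realLt (sq (.sub (.get 1 (.sub c (.const 1))) (.get 3 j)))
      (sq (.sub (.get 1 (.sub c (.const 1))) (.get 3 (.sub j (.const 1)))))) 1 0 d e

theorem run_passProg {c j : NatExpr} {jr : RealExpr} (hd : d ≠ 2)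
    (hj : jr.eval s = (j.eval s : ℝ)) :
    (passProg c j jr d e).run s = s.setKey d e (s.data.passKey (c.eval s) (j.eval s)) := by
  rw [passProg, ScalingData.passKey]
  by_cases h1 : c.eval s = 0
  · rw [Prog.run_cond_pos (show Test.Holds s (.natEq c (.const 0)) from h1), if_pos h1,
      run_loadKey, RealExpr.eval, Nat.cast_zero]
  rw [Prog.run_cond_neg (show ¬ Test.Holds s (.natEq c (.const 0)) from h1), if_neg h1]
  by_cases h2 : s.data.n < c.eval s
  · rw [Prog.run_cond_pos (show Test.Holds s (.natLt (.reg 0) c) from h2), if_pos h2,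
      run_loadKey]
    rfl
  rw [Prog.run_cond_neg (show ¬ Test.Holds s (.natLt (.reg 0) c) from h2), if_neg h2]
  by_cases h3 : j.eval s = 0
  · rw [Prog.run_cond_pos (show Test.Holds s (.natEq j (.const 0)) from h3), if_pos h3,
      run_loadKey]
    rfl
  rw [Prog.run_cond_neg (show ¬ Test.Holds s (.natEq j (.const 0)) from h3), if_neg h3]
  by_cases h4 : ¬ j.eval s < s.data.m
  · rw [Prog.run_cond_pos (show Test.Holds s (.neg (.natLt j (.reg 1))) from h4), if_pos h4,
      run_loadKey, RealExpr.eval, Nat.cast_zero]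
  rw [Prog.run_cond_neg (show ¬ Test.Holds s (.neg (.natLt j (.reg 1))) from h4), if_neg h4,
    run_clampProg hd (by simp [Test.Holds, eval_sq, RealExpr.eval, NatExpr.eval])]
  simp only [Test.Holds, eval_sq, RealExpr.eval, NatExpr.eval, sq_lt_sq, hj, Nat.cast_ofNat]
  congr

/-- `(2 j + 1) / 2`. -/
def halfOdd (jr : RealExpr) : RealExpr :=
  .div (.add (.mul (.const 2) jr) (.const 1)) (.const 2)

/-- `ScalingData.meetKey`. -/
def meetProg (c j : NatExpr) (jr : RealExpr) (d e : ℕ) : Prog :=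
  clampProg (.sub (.get 0 (.sub c (.const 1))) (.get 2 j)) (halfOdd jr)
    (.natEq (.const 0) (.const 0)) 0 0 d e

theorem run_meetProg {c j : NatExpr} {jr : RealExpr} (hd : d ≠ 2)
    (hj : jr.eval s = (j.eval s : ℝ)) :
    (meetProg c j jr d e).run s = s.setKey d e (s.data.meetKey (c.eval s) (j.eval s)) := by
  rw [meetProg, run_clampProg hd (by simp [Test.Holds, NatExpr.eval])]
  simp [Test.Holds, RealExpr.eval, NatExpr.eval, ScalingData.meetKey, State.data, halfOdd, hj]

/-- `ScalingData.crossKey`. -/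
def crossProg (c j : NatExpr) (jr : RealExpr) (d e : ℕ) : Prog :=
  .cond (.natEq c (.const 0)) (loadKey d e (.const 0) 0) <|
  .cond (.neg (.natLt c (.reg 0))) (loadKey d e (.reg 2) 1) <|
  clampProg
    (.sub (.div (.add (.get 0 (.sub c (.const 1))) (.get 0 c)) (.const 2)) (.get 2 j)) (halfOdd jr)
    (.realLt (sq (.sub (.get 1 c) (.get 3 j)))
      (sq (.sub (.get 1 (.sub c (.const 1))) (.get 3 j)))) 0 1 d e

theorem run_crossProg {c j : NatExpr} {jr : RealExpr} (hd : d ≠ 2)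
    (hj : jr.eval s = (j.eval s : ℝ)) :
    (crossProg c j jr d e).run s = s.setKey d e (s.data.crossKey (c.eval s) (j.eval s)) := by
  rw [crossProg, ScalingData.crossKey]
  by_cases h1 : c.eval s = 0
  · rw [Prog.run_cond_pos (show Test.Holds s (.natEq c (.const 0)) from h1), if_pos h1,
      run_loadKey, RealExpr.eval, Nat.cast_zero]
  rw [Prog.run_cond_neg (show ¬ Test.Holds s (.natEq c (.const 0)) from h1), if_neg h1]
  by_cases h2 : ¬ c.eval s < s.data.n
  · rw [Prog.run_cond_pos (show Test.Holds s (.neg (.natLt c (.reg 0))) from h2), if_pos h2,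
      run_loadKey]
    rfl
  rw [Prog.run_cond_neg (show ¬ Test.Holds s (.neg (.natLt c (.reg 0))) from h2), if_neg h2,
    run_clampProg hd (by simp [Test.Holds, eval_sq, RealExpr.eval, NatExpr.eval])]
  simp only [Test.Holds, eval_sq, halfOdd, RealExpr.eval, NatExpr.eval, sq_lt_sq, hj,
    Nat.cast_ofNat, Nat.cast_one]
  congr

/-- Replace the second key by the maximum of both. -/
def maxProg (d e d' e' : ℕ) : Prog :=
  .cond (keyLt (.reg d') (.reg e') (.reg d) (.reg e))
    (.seq (.setReal d' (.reg d)) (.setNat e' (.reg e))) .skip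

theorem run_maxProg : (maxProg d e d' e').run s = s.setKey d' e' (max (s.key d e) (s.key d' e')) := by
  simp only [maxProg, Prog.run, holds_keyLt, RealExpr.eval, NatExpr.eval]
  split_ifs with h
  · rw [max_eq_left (show s.key d' e' ≤ s.key d e from h.le)]; rfl
  · rw [max_eq_right (show s.key d e ≤ s.key d' e' from not_lt.1 h)]
    refine State.ext' (fun r => ?_) (fun r => ?_) rfl rfl <;> simp [State.key] <;>
      rintro rfl <;> rfl

/-- Replace the second key by the minimum of both. -/
def minProg (d e d' e' : ℕ) : Prog :=
  .cond (keyLt (.reg d) (.reg e) (.reg d') (.reg e'))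
    (.seq (.setReal d' (.reg d)) (.setNat e' (.reg e))) .skip

theorem run_minProg : (minProg d e d' e').run s = s.setKey d' e' (min (s.key d' e') (s.key d e)) := by
  simp only [minProg, Prog.run, holds_keyLt, RealExpr.eval, NatExpr.eval]
  split_ifs with h
  · rw [min_eq_right (show s.key d e ≤ s.key d' e' from h.le)]; rfl
  · rw [min_eq_left (show s.key d' e' ≤ s.key d e from not_lt.1 h)]
    refine State.ext' (fun r => ?_) (fun r => ?_) rfl rfl <;> simp [State.key] <;>
      rintro rfl <;> rfl

end RealRAM

/-! ## Generating the steps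

Natural registers: `0`, `1` the numbers of notes; `2`, `3`, `4`, `5` the indices `j`, `u`, `k`, `c`
of a step; `6` its number; `7`, `8`, `9` sides of keys. Real registers: `2` the largest scaling;
`3` the index `j`; `4`, `5`, `6` times of keys; from `7` on slopes and offsets. The steps are stored
in the real arrays `4` (times), `5` (slopes), `6` (offsets) and in the natural array `0` (sides);
the natural array `1` is a permutation of them. -/

namespace RealRAM

variable {s : State}

/-- The three keys of a window, into the registers `(4, 7)`, `(5, 8)` and `(6, 9)`. -/
def windowProg : Prog :=
  block [
    .cond (.natEq (.reg 3) (.const 0))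
      (block [
        passProg (.reg 5) (.add (.reg 2) (.const 1)) (.add (.reg 3) (.const 1)) 4 7,
        passProg (.reg 5) (.reg 2) (.reg 3) 5 8,
        meetProg (.reg 5) (.reg 2) (.reg 3) 6 9])
      (block [
        passProg (.reg 5) (.reg 2) (.reg 3) 4 7,
        passProg (.add (.reg 5) (.const 1)) (.add (.reg 2) (.const 1)) (.add (.reg 3) (.const 1)) 5 8,
        crossProg (.reg 5) (.reg 2) (.reg 3) 6 9]),
    maxProg 4 7 5 8,
    minProg 5 8 6 9,
    maxProg 4 7 6 9]

theorem run_windowProg (hj : s.real 3 = (s.nat 2 : ℝ)) :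
    windowProg.run s =
      ((s.setKey 4 7 (s.data.winStart (s.nat 2) (s.nat 3) (s.nat 5))).setKey 5 8
        (s.data.winEnd (s.nat 2) (s.nat 3) (s.nat 5))).setKey 6 9
        (s.data.winTurn (s.nat 2) (s.nat 3) (s.nat 5)) := by
  -- The end is raised to the start before the turn is clipped against it, in the same nesting as in
  -- `winEnd` and `winTurn`.
  have fin : ∀ a b c : StepKey,
      (maxProg 4 7 6 9).run ((minProg 5 8 6 9).run ((maxProg 4 7 5 8).run
        (((s.setKey 4 7 a).setKey 5 8 b).setKey 6 9 c))) =
      ((s.setKey 4 7 a).setKey 5 8 (max a b)).setKey 6 9 (max a (min c (max a b))) := by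
    intro a b c
    rw [run_maxProg, run_minProg, run_maxProg]
    simp only [State.key, State.setKey_real, State.setKey_nat]
    norm_num
    refine State.ext' (fun r => ?_) (fun r => ?_) rfl rfl <;> simp <;> split_ifs <;> rfl
  simp only [windowProg, block, Prog.run]
  by_cases hu : s.nat 3 = 0
  · rw [if_pos (show Test.Holds s (.natEq (.reg 3) (.const 0)) from hu)]
    rw [run_passProg (s := s) (by norm_num) (by simp [RealExpr.eval, NatExpr.eval, hj]),
      run_passProg (by norm_num) (by simp [RealExpr.eval, NatExpr.eval, hj]),
      run_meetProg (by norm_num) (by simp [RealExpr.eval, NatExpr.eval, hj])]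
    simp only [State.data_setKey _ _ (show (4 : ℕ) ≠ 2 by norm_num) (show 1 < 7 by norm_num),
      State.data_setKey _ _ (show (5 : ℕ) ≠ 2 by norm_num) (show 1 < 8 by norm_num)]
    rw [fin]
    simp [ScalingData.winStart, ScalingData.winEnd, ScalingData.winTurn, hu, NatExpr.eval]
  · rw [if_neg (show ¬ Test.Holds s (.natEq (.reg 3) (.const 0)) from hu)]
    rw [run_passProg (s := s) (by norm_num) (by simp [RealExpr.eval, NatExpr.eval, hj]),
      run_passProg (by norm_num) (by simp [RealExpr.eval, NatExpr.eval, hj]),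
      run_crossProg (by norm_num) (by simp [RealExpr.eval, NatExpr.eval, hj])]
    simp only [State.data_setKey _ _ (show (4 : ℕ) ≠ 2 by norm_num) (show 1 < 7 by norm_num),
      State.data_setKey _ _ (show (5 : ℕ) ≠ 2 by norm_num) (show 1 < 8 by norm_num)]
    rw [fin]
    simp [ScalingData.winStart, ScalingData.winEnd, ScalingData.winTurn, hu, NatExpr.eval]

/-- Store a key as the key of the current step. -/
def storeKey (d e : ℕ) : Prog :=
  .seq (.putReal 4 (.reg 6) (.reg d)) (.putNat 0 (.reg 6) (.reg e))

/-- Store the key of the current step. -/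
def emitKey : Prog :=
  .cond (.natEq (.reg 4) (.const 0)) (storeKey 4 7)
    (.cond (.natEq (.reg 4) (.const 1)) (storeKey 6 9) (storeKey 5 8))

theorem run_emitKey {a b c : StepKey} {s' : State}
    (hs' : s' = ((s.setKey 4 7 a).setKey 5 8 b).setKey 6 9 c) :
    emitKey.run s' = (s'.putR 4 (s.nat 6)
        (ofLex (if s.nat 4 = 0 then a else if s.nat 4 = 1 then c else b)).1).putN 0 (s.nat 6)
        (ofLex (if s.nat 4 = 0 then a else if s.nat 4 = 1 then c else b)).2 := by
  subst hs'
  simp only [emitKey, storeKey, Prog.run, Test.Holds, NatExpr.eval, RealExpr.eval,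
    State.setKey_nat, State.setKey_real, State.putR_nat]
  norm_num
  split_ifs <;> rfl

/-- An absolute value. -/
def absProg (d : ℕ) (a : RealExpr) : Prog :=
  .seq (.setReal d a)
    (.cond (.realLt (.reg d) (.const 0)) (.setReal d (.sub (.const 0) (.reg d))) .skip)

theorem run_absProg {d : ℕ} {a : RealExpr} : (absProg d a).run s = s.setR d |a.eval s| := by
  simp only [absProg, Prog.run, Test.Holds, RealExpr.eval, State.setR_real, if_true, Nat.cast_zero]
  split_ifs with h
  · rw [abs_of_neg h]
    refine State.ext' (fun r => rfl) (fun r => ?_) rfl rfl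
    simp only [State.setR_real]
    split_ifs <;> simp
  · rw [abs_of_nonneg (not_lt.1 h)]

/-- The jump of the current step, into the real registers `7` and `8`. -/
def jumpProg : Prog :=
  block [
    absProg 9 (.sub (.get 1 (.sub (.reg 5) (.const 1))) (.get 3 (.reg 2))),
    .cond (.natEq (.reg 3) (.const 0))
      (block [
        .setReal 7 (.sub (.const 0) (halfOdd (.reg 3))),
        .setReal 8 (.add (.sub (.get 0 (.sub (.reg 5) (.const 1))) (.get 2 (.reg 2))) (.reg 9)),
        .setReal 10 (halfOdd (.reg 3)),
        .setReal 11 (.add (.sub (.get 2 (.reg 2)) (.get 0 (.sub (.reg 5) (.const 1)))) (.reg 9))])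
      (block [
        .setReal 7 (halfOdd (.reg 3)),
        .setReal 8 (.add (.sub (.get 2 (.reg 2)) (.get 0 (.sub (.reg 5) (.const 1)))) (.reg 9)),
        absProg 9 (.sub (.get 1 (.reg 5)) (.get 3 (.reg 2))),
        .setReal 10 (.sub (.const 0) (halfOdd (.reg 3))),
        .setReal 11 (.add (.sub (.get 0 (.reg 5)) (.get 2 (.reg 2))) (.reg 9))]),
    .cond (.natEq (.reg 4) (.const 0)) .skip
      (.cond (.natEq (.reg 4) (.const 1))
        (.seq (.setReal 7 (.sub (.reg 10) (.reg 7))) (.setReal 8 (.sub (.reg 11) (.reg 8))))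
        (.seq (.setReal 7 (.sub (.const 0) (.reg 10))) (.setReal 8 (.sub (.const 0) (.reg 11)))))]

theorem run_jumpProg (hj : s.real 3 = (s.nat 2 : ℝ)) :
    (jumpProg.run s).nat = s.nat ∧ (jumpProg.run s).natArr = s.natArr ∧
    (jumpProg.run s).realArr = s.realArr ∧ (∀ r < 7, (jumpProg.run s).real r = s.real r) ∧
    (jumpProg.run s).real 7 = (s.data.stepJump (s.nat 2) (s.nat 3) (s.nat 4) (s.nat 5)).1 ∧
    (jumpProg.run s).real 8 = (s.data.stepJump (s.nat 2) (s.nat 3) (s.nat 4) (s.nat 5)).2 := by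
  simp only [jumpProg, block, Prog.run, run_absProg, Test.Holds, NatExpr.eval, RealExpr.eval,
    State.setR_nat, halfOdd, ScalingData.stepJump, ScalingData.costBefore, ScalingData.costAfter,
    ScalingData.rising, ScalingData.falling]
  by_cases hu : s.nat 3 = 0 <;> by_cases hk : s.nat 4 = 0 <;> by_cases hk' : s.nat 4 = 1 <;>
  first
  | (exfalso; omega)
  | simp only [hu, hk, hk', if_true, if_false, State.setR_nat, one_ne_zero]
    refine ⟨by trivial, by trivial, by trivial, fun r hr => ?_, ?_, ?_⟩
    · simp [show r ≠ 7 by omega, show r ≠ 8 by omega, show r ≠ 9 by omega,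
        show r ≠ 10 by omega, show r ≠ 11 by omega]
    · simp [hj, State.data]
    · simp [hj, State.data]

/-- Store the jump of the current step, number it, and go on to the next one. -/
def advanceProg : Prog :=
  block [
    .putReal 5 (.reg 6) (.reg 7),
    .putReal 6 (.reg 6) (.reg 8),
    .putNat 1 (.reg 6) (.reg 6),
    .setNat 6 (.add (.reg 6) (.const 1)),
    .setNat 5 (.add (.reg 5) (.const 1)),
    .cond (.natLt (.reg 0) (.reg 5))
      (block [
        .setNat 5 (.const 0),
        .setNat 4 (.add (.reg 4) (.const 1)),
        .cond (.natEq (.reg 4) (.const 3))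
          (block [
            .setNat 4 (.const 0),
            .setNat 3 (.add (.reg 3) (.const 1)),
            .cond (.natEq (.reg 3) (.const 2))
              (block [
                .setNat 3 (.const 0),
                .setNat 2 (.add (.reg 2) (.const 1)),
                .setReal 3 (.add (.reg 3) (.const 1))])
              .skip])
          .skip])
      .skip]

/-- All three keys of a window are recomputed for each of its steps, although only one is stored.
This costs a constant factor and lets the reference index run fastest, so that the sorted runs
become contiguous. -/
def stepProg : Prog := block [windowProg, emitKey, jumpProg, advanceProg]

def generateProg : Prog := .loop (.natLt (.reg 2) (.reg 1)) stepProg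

/-- The first `N` steps of `D` are stored in the arrays. -/
structure State.Stores (s : State) (D : ScalingData) (N : ℕ) : Prop where
  key : ∀ k < N, (toLex (s.realArr 4 k, s.natArr 0 k) : StepKey) = D.keyAt k
  slope : ∀ k < N, s.realArr 5 k = (D.jumpAt k).1
  offset : ∀ k < N, s.realArr 6 k = (D.jumpAt k).2

/-- The invariant of `generateProg`. -/
structure GenerateInv (D : ScalingData) (s : State) : Prop where
  data : s.data = D
  number : s.nat 6 = ((s.nat 2 * 2 + s.nat 3) * 3 + s.nat 4) * (D.n + 1) + s.nat 5
  c_le : s.nat 5 ≤ D.n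
  k_lt : s.nat 4 < 3
  u_lt : s.nat 3 < 2
  real : s.real 3 = (s.nat 2 : ℝ)
  le_size : s.nat 6 ≤ D.size
  stores : s.Stores D (s.nat 6)
  perm : ∀ k < s.nat 6, s.natArr 1 k = k

end RealRAM

namespace ScalingData

/-- The counters are the mixed-radix digits of the step number, so the step being generated is the
one that `keyAt` and `jumpAt` describe. -/
theorem decode_number {n j u k c : ℕ} (hc : c ≤ n) (hk : k < 3) (hu : u < 2) :
    (((j * 2 + u) * 3 + k) * (n + 1) + c) % (n + 1) = c ∧
    (((j * 2 + u) * 3 + k) * (n + 1) + c) / (n + 1) % 3 = k ∧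
    (((j * 2 + u) * 3 + k) * (n + 1) + c) / (n + 1) / 3 % 2 = u ∧
    (((j * 2 + u) * 3 + k) * (n + 1) + c) / (n + 1) / 3 / 2 = j := by
  have h1 : (((j * 2 + u) * 3 + k) * (n + 1) + c) / (n + 1) = (j * 2 + u) * 3 + k := by
    rw [Nat.mul_comm, Nat.mul_add_div (by omega), Nat.div_eq_of_lt (by omega), Nat.add_zero]
  rw [h1]
  refine ⟨?_, by omega, by omega, by omega⟩
  rw [Nat.mul_comm, Nat.mul_add_mod, Nat.mod_eq_of_lt (by omega)]

end ScalingData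

namespace RealRAM

variable {s : State}

theorem run_advanceProg {n : ℕ} (hn : s.nat 0 = n) (hc : s.nat 5 ≤ n) (hk : s.nat 4 < 3)
    (hu : s.nat 3 < 2) (hj : s.real 3 = (s.nat 2 : ℝ))
    (hid : s.nat 6 = ((s.nat 2 * 2 + s.nat 3) * 3 + s.nat 4) * (n + 1) + s.nat 5) :
    ∃ s', advanceProg.run s = s' ∧ s'.nat 0 = s.nat 0 ∧ s'.nat 1 = s.nat 1 ∧
      s'.nat 6 = s.nat 6 + 1 ∧ s'.nat 5 ≤ n ∧ s'.nat 4 < 3 ∧ s'.nat 3 < 2 ∧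
      s'.real 3 = (s'.nat 2 : ℝ) ∧
      s'.nat 6 = ((s'.nat 2 * 2 + s'.nat 3) * 3 + s'.nat 4) * (n + 1) + s'.nat 5 ∧
      s'.real 2 = s.real 2 ∧ s'.natArr 0 = s.natArr 0 ∧
      s'.natArr 1 = Function.update (s.natArr 1) (s.nat 6) (s.nat 6) ∧
      (∀ r < 5, s'.realArr r = s.realArr r) ∧
      s'.realArr 5 = Function.update (s.realArr 5) (s.nat 6) (s.real 7) ∧
      s'.realArr 6 = Function.update (s.realArr 6) (s.nat 6) (s.real 8) := by
  refine ⟨_, rfl, ?_⟩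
  have harr : ∀ r < 5, r ≠ 5 ∧ r ≠ 6 := by omega
  simp only [advanceProg, block, Prog.run, Test.Holds, NatExpr.eval, RealExpr.eval]
  -- The counters work like an odometer with digits `c`, `k`, `u`, `j`; the cases are the possible
  -- lengths of the carry.
  by_cases h1 : n < s.nat 5 + 1
  · have e1 : s.nat 5 = n := by omega
    by_cases h2 : s.nat 4 + 1 = 3
    · have e2 : s.nat 4 = 2 := by omega
      by_cases h3 : s.nat 3 + 1 = 2
      · have e3 : s.nat 3 = 1 := by omega
        simp [hn, hj, e1, e2, e3, hid]
        refine ⟨by ring, fun r hr => ?_⟩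
        simp [(harr r hr).1, (harr r hr).2]
      · have e3 : s.nat 3 = 0 := by omega
        simp [hn, hj, e1, e2, e3, hid]
        refine ⟨by ring, fun r hr => ?_⟩
        simp [(harr r hr).1, (harr r hr).2]
    · have e2 : s.nat 4 < 2 := by omega
      have e3 : s.nat 4 ≠ 2 := by omega
      simp [hn, hj, e1, e3, hid, hu]
      refine ⟨by omega, by ring, fun r hr => ?_⟩
      simp [(harr r hr).1, (harr r hr).2]
  · have e1 : s.nat 5 < n := by omega
    have e3 : ¬ n < s.nat 5 + 1 := by omega
    simp [hn, hj, hu, hk, e3, hid]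
    refine ⟨by omega, by ring, fun r hr => ?_⟩
    simp [(harr r hr).1, (harr r hr).2]

theorem GenerateInv.step {D : ScalingData} (h : GenerateInv D s) (hlt : s.nat 2 < D.m) :
    GenerateInv D (stepProg.run s) ∧ (stepProg.run s).nat 6 = s.nat 6 + 1 := by
  obtain ⟨hdec1, hdec2, hdec3, hdec4⟩ := ScalingData.decode_number (j := s.nat 2) h.c_le h.k_lt h.u_lt
  rw [← h.number] at hdec1 hdec2 hdec3 hdec4
  have hkey : D.keyAt (s.nat 6) = D.stepKey (s.nat 2) (s.nat 3) (s.nat 4) (s.nat 5) := by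
    rw [ScalingData.keyAt, hdec1, hdec2, hdec3, hdec4]
  have hjump : D.jumpAt (s.nat 6) = D.stepJump (s.nat 2) (s.nat 3) (s.nat 4) (s.nat 5) := by
    rw [ScalingData.jumpAt, hdec1, hdec2, hdec3, hdec4]
  have hdata := h.data
  obtain ⟨s1, hs1⟩ : ∃ s1, s1 = windowProg.run s := ⟨_, rfl⟩
  have hw := hs1
  rw [run_windowProg h.real, hdata] at hw
  obtain ⟨s2, hs2⟩ : ∃ s2, s2 = emitKey.run s1 := ⟨_, rfl⟩
  have he := hs2
  rw [run_emitKey hw] at he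
  rw [show (if s.nat 4 = 0 then D.winStart (s.nat 2) (s.nat 3) (s.nat 5) else
    if s.nat 4 = 1 then D.winTurn (s.nat 2) (s.nat 3) (s.nat 5) else
      D.winEnd (s.nat 2) (s.nat 3) (s.nat 5)) = D.keyAt (s.nat 6) by rw [hkey]; rfl] at he
  have n2 : ∀ r < 7, s2.nat r = s.nat r := by
    intro r hr
    simp [he, hw, show r ≠ 7 by omega, show r ≠ 8 by omega, show r ≠ 9 by omega]
  have r2 : ∀ r < 4, s2.real r = s.real r := by
    intro r hr
    simp [he, hw, show r ≠ 4 by omega, show r ≠ 5 by omega, show r ≠ 6 by omega]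
  have a2 : ∀ r, r ≠ 4 → s2.realArr r = s.realArr r := by
    intro r hr
    simp [he, hw, hr]
  have a24 : s2.realArr 4 =
      Function.update (s.realArr 4) (s.nat 6) (ofLex (D.keyAt (s.nat 6))).1 := by
    simp [he, hw]
  have b20 : s2.natArr 0 =
      Function.update (s.natArr 0) (s.nat 6) (ofLex (D.keyAt (s.nat 6))).2 := by
    simp [he, hw]
  have b21 : s2.natArr 1 = s.natArr 1 := by simp [he, hw]
  have hdata2 : s2.data = D := by
    rw [← hdata]
    simp [State.data, n2, r2, a2]
  have hj2 : s2.real 3 = (s2.nat 2 : ℝ) := by rw [r2 3 (by norm_num), n2 2 (by norm_num), h.real]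
  obtain ⟨n3, b3, a3, r3, r37, r38⟩ := run_jumpProg hj2
  obtain ⟨s3, hs3⟩ : ∃ s3, s3 = jumpProg.run s2 := ⟨_, rfl⟩
  rw [← hs3] at n3 b3 a3 r3 r37 r38
  have hn0 : s.nat 0 = D.n := by rw [← hdata]; rfl
  have n3' : ∀ r < 7, s3.nat r = s.nat r := fun r hr => by rw [n3, n2 r hr]
  obtain ⟨s4, hs4, q0, q1, q6, q5, q4, q3, qr, qid, q2, qb0, qb1, qa, qa5, qa6⟩ :=
    run_advanceProg (s := s3) (n := D.n) (by rw [n3' 0 (by norm_num), hn0])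
      (by rw [n3' 5 (by norm_num)]; exact h.c_le) (by rw [n3' 4 (by norm_num)]; exact h.k_lt)
      (by rw [n3' 3 (by norm_num)]; exact h.u_lt)
      (by rw [r3 3 (by norm_num), r2 3 (by norm_num), n3' 2 (by norm_num), h.real])
      (by rw [n3' 6 (by norm_num), n3' 5 (by norm_num), n3' 4 (by norm_num), n3' 3 (by norm_num),
            n3' 2 (by norm_num), h.number])
  have hrun : stepProg.run s = s4 := by
    rw [← hs4, hs3, hs2, hs1]; rfl
  have e6 : s4.nat 6 = s.nat 6 + 1 := by rw [q6, n3' 6 (by norm_num)]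
  have ha : ∀ r < 4, s4.realArr r = s.realArr r := fun r hr => by
    rw [qa r (by omega), a3, a2 r (by omega)]
  rw [hrun]
  refine ⟨⟨?_, qid, q5, q4, q3, qr, ?_, ⟨fun k hk => ?_, fun k hk => ?_, fun k hk => ?_⟩,
    fun k hk => ?_⟩, e6⟩
  · rw [← hdata]
    simp only [State.data, ScalingData.mk.injEq]
    refine ⟨?_, ?_, ha 0 (by norm_num), ha 1 (by norm_num), ha 2 (by norm_num), ha 3 (by norm_num),
      ?_⟩
    · rw [q0, n3' 0 (by norm_num)]
    · rw [q1, n3' 1 (by norm_num)]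
    · rw [q2, r3 2 (by norm_num), r2 2 (by norm_num)]
  · rw [e6, h.number, ScalingData.size]
    have h1 : (s.nat 2 * 2 + s.nat 3) * 3 + s.nat 4 + 1 ≤ D.m * 2 * 3 := by
      have := h.k_lt
      have := h.u_lt
      omega
    have h2 := Nat.mul_le_mul_right (D.n + 1) h1
    rw [Nat.succ_mul] at h2
    have := h.c_le
    omega
  · rw [qa 4 (by norm_num), qb0, a3, b3, a24, b20]
    rcases eq_or_ne k (s.nat 6) with rfl | hne
    · simp
    · rw [Function.update_of_ne hne, Function.update_of_ne hne]
      exact h.stores.key k (by omega)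
  · rw [qa5, a3, n3' 6 (by norm_num), a2 5 (by norm_num)]
    rcases eq_or_ne k (s.nat 6) with rfl | hne
    · rw [Function.update_self, r37, hdata2, hjump, n2 2 (by norm_num), n2 3 (by norm_num),
        n2 4 (by norm_num), n2 5 (by norm_num)]
    · rw [Function.update_of_ne hne]
      exact h.stores.slope k (by omega)
  · rw [qa6, a3, n3' 6 (by norm_num), a2 6 (by norm_num)]
    rcases eq_or_ne k (s.nat 6) with rfl | hne
    · rw [Function.update_self, r38, hdata2, hjump, n2 2 (by norm_num), n2 3 (by norm_num),
        n2 4 (by norm_num), n2 5 (by norm_num)]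
    · rw [Function.update_of_ne hne]
      exact h.stores.offset k (by omega)
  · rw [qb1, n3' 6 (by norm_num), b3, b21]
    rcases eq_or_ne k (s.nat 6) with rfl | hne
    · rw [Function.update_self]
    · rw [Function.update_of_ne hne]
      exact h.perm k (by omega)

theorem loopFree_stepProg : stepProg.LoopFree := by
  simp [stepProg, windowProg, emitKey, jumpProg, advanceProg, block, Prog.LoopFree, passProg,
    crossProg, meetProg, clampProg, loadKey, maxProg, minProg, storeKey, absProg]

theorem GenerateInv.halts {D : ScalingData} (h : GenerateInv D s) :
    Halts generateProg s ((D.size + 1) * (4 + stepProg.cost)) fun s' =>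
      GenerateInv D s' ∧ s'.nat 6 = D.size := by
  have key := Halts.loop (b := .natLt (.reg 2) (.reg 1)) (c := stepProg) (T := stepProg.cost)
    (Inv := fun k s => GenerateInv D s ∧ k = D.size - s.nat 6) (by
      rintro k s ⟨hs, rfl⟩ hb
      have hlt : s.nat 2 < D.m := by rw [← hs.data]; exact hb
      obtain ⟨h1, h2⟩ := hs.step hlt
      refine loopFree_stepProg.halts ⟨_, ?_, h1, rfl⟩
      have := h1.le_size
      omega) _ s ⟨h, rfl⟩
  refine key.mono (Nat.mul_le_mul (by omega) ?_) ?_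
  · simp only [Test.time, NatExpr.time]
    omega
  · rintro s' ⟨hb, k, hs, rfl⟩
    refine ⟨hs, le_antisymm hs.le_size ?_⟩
    -- Once `j` has reached `m`, the number of the next step is at least the total number of steps.
    have hge : D.m ≤ s'.nat 2 := by rw [← hs.data]; exact not_lt.1 hb
    rw [hs.number, ScalingData.size]
    have h1 : D.m * 2 * 3 ≤ (s'.nat 2 * 2 + s'.nat 3) * 3 + s'.nat 4 := by omega
    exact (Nat.mul_le_mul_right _ h1).trans (Nat.le_add_right _ _)

/-! The largest admissible scaling -/

/-- Naturals cannot be converted to reals on this machine, so the real number `m` is obtained by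
counting in both kinds of registers; the time is linear in `m`. -/
def countProg : Prog :=
  .loop (.natLt (.reg 2) (.reg 1))
    (.seq (.setNat 2 (.add (.reg 2) (.const 1))) (.setReal 9 (.add (.reg 9) (.const 1))))

/-- Compute the largest admissible scaling. -/
def rangeProg : Prog :=
  .seq countProg
    (.seq (.setReal 2 (.div (.sub (.reg 0) (.reg 1)) (.reg 9))) (.setNat 2 (.const 0)))

theorem halts_rangeProg {n m : ℕ} (R : PointMelody n) (Q : PointMelody m) :
    Halts rangeProg (input R Q) ((m + 1) * 20 + 10) (GenerateInv (scalingData R Q)) := by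
  let Inv : ℕ → State → Prop := fun k s =>
    k = m - s.nat 2 ∧ s.nat 2 ≤ m ∧ s.real 9 = (s.nat 2 : ℝ) ∧
    (∀ r, r ≠ 2 → s.nat r = (input R Q).nat r) ∧ (∀ r, r ≠ 9 → s.real r = (input R Q).real r) ∧
    s.natArr = (input R Q).natArr ∧ s.realArr = (input R Q).realArr
  have key := Halts.loop (b := .natLt (.reg 2) (.reg 1))
    (c := .seq (.setNat 2 (.add (.reg 2) (.const 1))) (.setReal 9 (.add (.reg 9) (.const 1))))
    (T := 8) (Inv := Inv) (by
      rintro k s ⟨rfl, h1, h2, h3, h4, h5, h6⟩ hb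
      have hlt : s.nat 2 < s.nat 1 := hb
      have hm : s.nat 1 = m := by rw [h3 1 (by norm_num)]; simp [input]
      refine (Prog.LoopFree.halts (by simp [Prog.LoopFree]) (P := fun s' => ∃ k' < m - s.nat 2,
        Inv k' s') ⟨m - (s.nat 2 + 1), by omega, ?_⟩).mono
          (by simp [Prog.cost, NatExpr.time, RealExpr.time]) fun _ h => h
      simp only [Prog.run, NatExpr.eval, RealExpr.eval, Inv]
      refine ⟨by simp, by simp; omega, by simp [h2], fun r hr => ?_, fun r hr => ?_, h5, h6⟩
      · simp [hr, h3]
      · simp [hr, h4]) m (input R Q)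
    ⟨by simp [input], by simp [input], by simp [input], fun _ _ => rfl, fun _ _ => rfl, rfl, rfl⟩
  refine (key.seq (U := 10) (P' := GenerateInv (scalingData R Q)) ?_).mono ?_ fun _ h => h
  · rintro s ⟨hb, k, rfl, h1, h2, h3, h4, h5, h6⟩
    have hm : s.nat 1 = m := by rw [h3 1 (by norm_num)]; simp [input]
    have hge : ¬ s.nat 2 < s.nat 1 := hb
    have h2m : s.nat 2 = m := by omega
    refine (Prog.LoopFree.halts (by simp [Prog.LoopFree]) ?_).mono
      (by simp [Prog.cost, NatExpr.time, RealExpr.time]) fun _ h => h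
    simp only [Prog.run, NatExpr.eval, RealExpr.eval]
    have hz : ∀ r, r ≠ 0 → r ≠ 1 → r ≠ 2 → s.nat r = 0 := fun r h0 h1 h2 => by
      rw [h3 r h2]; simp [input, h0, h1]
    refine ⟨?_, ?_, ?_, ?_, ?_, ?_, ?_, ⟨?_, ?_, ?_⟩, ?_⟩
    · simp only [State.data, scalingData, ScalingData.mk.injEq]
      simp [h2, h2m, h3, h4, h6, input]
    all_goals simp [hz, h4, input]
  · simp only [Test.time, NatExpr.time]
    omega

end RealRAM

/-! ## Merge sort -/

/-- `P` maps the numbers below `N` onto themselves. -/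
structure PermutesBelow (P : ℕ → ℕ) (N : ℕ) : Prop where
  lt : ∀ a < N, P a < N
  surj : ∀ v < N, ∃ a < N, P a = v

theorem PermutesBelow.injOn {P : ℕ → ℕ} {N : ℕ} (h : PermutesBelow P N) :
    Set.InjOn P (Finset.range N) := by
  refine Finset.injOn_of_surjOn_of_card_le (t := Finset.range N) P ?_ ?_ le_rfl
  · intro a ha
    have := h.lt a (by simpa using ha)
    simpa using this
  · intro v hv
    obtain ⟨a, ha, rfl⟩ := h.surj v (by simpa using hv)
    exact ⟨a, by simpa using ha, rfl⟩

/-- The keys are sorted within the blocks of length `w`. -/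
def BlockSorted (κ : ℕ → StepKey) (P : ℕ → ℕ) (N w : ℕ) : Prop :=
  ∀ a b, a ≤ b → b < N → a / w = b / w → κ (P a) ≤ κ (P b)

/-- The state of a merge: of the blocks `[2 * w * q, mid)` and `[mid, hi)` of `P`, the parts before
`i` and before `j` have been merged into `T`, which is filled up to `k`. -/
structure Merging (κ : ℕ → StepKey) (P T : ℕ → ℕ) (N w q i mid j hi k : ℕ) : Prop where
  start_le : 2 * w * q ≤ i
  i_le : i ≤ mid
  le_j : mid ≤ j
  j_le : j ≤ hi
  mid_eq : mid = min N (2 * w * q + w)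
  hi_eq : hi = min N (2 * w * q + w + w)
  k_eq : k + mid = i + j
  lt : ∀ a < k, T a < N
  surj : ∀ b, b < i ∨ (mid ≤ b ∧ b < j) → ∃ a < k, T a = P b
  sorted : BlockSorted κ T k (2 * w)
  left : ∀ a b, 2 * w * q ≤ a → a < k → i ≤ b → b < mid → κ (T a) ≤ κ (P b)
  right : ∀ a b, 2 * w * q ≤ a → a < k → j ≤ b → b < hi → κ (T a) ≤ κ (P b)

section Merge

variable {κ : ℕ → StepKey} {P T : ℕ → ℕ} {N w q i mid j hi k : ℕ}

/-- The left of the two blocks is the block number `2 q` of width `w`, the right one number `2 q +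
1`; this is how `BlockSorted` applies to each. -/
theorem Merging.div_eq_of_left (h : Merging κ P T N w q i mid j hi k) (hw : 0 < w) {b : ℕ}
    (h1 : i ≤ b) (h2 : b < mid) : b / w = 2 * q := by
  have := h.start_le
  have := h.mid_eq
  have e : 2 * w * q = w * (2 * q) := by ring
  rw [show b = w * (2 * q) + (b - w * (2 * q)) by omega, Nat.mul_add_div hw,
    Nat.div_eq_of_lt (by omega), Nat.add_zero]

theorem Merging.div_eq_of_right (h : Merging κ P T N w q i mid j hi k) (hw : 0 < w) {b : ℕ}
    (h1 : j ≤ b) (h2 : b < hi) : b / w = 2 * q + 1 := by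
  have := h.start_le
  have := h.le_j
  have := h.mid_eq
  have := h.hi_eq
  have e : w * (2 * q + 1) = 2 * w * q + w := by ring
  rw [show b = w * (2 * q + 1) + (b - w * (2 * q + 1)) by omega, Nat.mul_add_div hw,
    Nat.div_eq_of_lt (by omega), Nat.add_zero]

/-- Position `k` is not before `2 w q`, so positions in its block of width `2 w` are not either. The
new entry therefore has to be compared only with what the current merge has written. -/
theorem Merging.sorted_update (h : Merging κ P T N w q i mid j hi k) (hw : 0 < w) (hk : k < hi)
    {v : ℕ} (hv : ∀ a, 2 * w * q ≤ a → a < k → κ (T a) ≤ κ v) :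
    BlockSorted κ (Function.update T k v) (k + 1) (2 * w) := by
  intro a b hab hb hdiv
  rcases (Nat.lt_succ_iff.1 hb).lt_or_eq with hb | rfl
  · rw [Function.update_of_ne (by omega), Function.update_of_ne (by omega)]
    exact h.sorted a b hab hb hdiv
  · rw [Function.update_self]
    rcases hab.lt_or_eq with hab | rfl
    · rw [Function.update_of_ne (by omega)]
      refine hv a ?_ hab
      have h1 : 2 * w * q ≤ b := by
        have := h.start_le
        have := h.k_eq
        have := h.le_j
        omega
      have h2 : q ≤ b / (2 * w) := by
        rw [Nat.le_div_iff_mul_le (by omega), Nat.mul_comm]; exact h1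
      rw [← hdiv, Nat.le_div_iff_mul_le (by omega), Nat.mul_comm] at h2
      exact h2
    · rw [Function.update_self]

theorem Merging.takeLeft (h : Merging κ P T N w q i mid j hi k) (hw : 0 < w) (hk : k < hi)
    (hP : BlockSorted κ P N w) (hPlt : ∀ a < N, P a < N) (hi' : i < mid)
    (hle : j < hi → κ (P i) ≤ κ (P j)) :
    Merging κ P (Function.update T k (P i)) N w q (i + 1) mid j hi (k + 1) where
  start_le := by have := h.start_le; omega
  i_le := hi'
  le_j := h.le_j
  j_le := h.j_le
  mid_eq := h.mid_eq
  hi_eq := h.hi_eq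
  k_eq := by have := h.k_eq; omega
  lt := by
    intro a ha
    rcases eq_or_ne a k with rfl | hne
    · rw [Function.update_self]
      exact hPlt i (by have := h.mid_eq; omega)
    · rw [Function.update_of_ne hne]
      exact h.lt a (by omega)
  surj := by
    intro b hb
    rcases eq_or_ne b i with rfl | hne
    · exact ⟨k, by omega, by rw [Function.update_self]⟩
    · obtain ⟨a, ha, e⟩ := h.surj b (by omega)
      exact ⟨a, by omega, by rw [Function.update_of_ne (by omega), e]⟩
  sorted := h.sorted_update hw hk fun a h1 h2 => h.left a i h1 h2 le_rfl hi'
  left := by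
    intro a b h1 h2 h3 h4
    rcases eq_or_ne a k with rfl | hne
    · rw [Function.update_self]
      refine hP i b (by omega) (by have := h.mid_eq; omega) ?_
      rw [h.div_eq_of_left hw le_rfl hi', h.div_eq_of_left hw (by omega) h4]
    · rw [Function.update_of_ne hne]
      exact h.left a b h1 (by omega) (by omega) h4
  right := by
    intro a b h1 h2 h3 h4
    rcases eq_or_ne a k with rfl | hne
    · rw [Function.update_self]
      -- The chosen head of the left block is at most the head of the right block, which is the
      -- least of what remains there.
      refine (hle (by omega)).trans (hP j b h3 (by have := h.hi_eq; omega) ?_)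
      rw [h.div_eq_of_right hw le_rfl (by omega), h.div_eq_of_right hw h3 h4]
    · rw [Function.update_of_ne hne]
      exact h.right a b h1 (by omega) h3 h4

theorem Merging.takeRight (h : Merging κ P T N w q i mid j hi k) (hw : 0 < w) (hk : k < hi)
    (hP : BlockSorted κ P N w) (hPlt : ∀ a < N, P a < N) (hj : j < hi)
    (hle : i < mid → κ (P j) ≤ κ (P i)) :
    Merging κ P (Function.update T k (P j)) N w q i mid (j + 1) hi (k + 1) where
  start_le := h.start_le
  i_le := h.i_le
  le_j := by have := h.le_j; omega
  j_le := hj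
  mid_eq := h.mid_eq
  hi_eq := h.hi_eq
  k_eq := by have := h.k_eq; omega
  lt := by
    intro a ha
    rcases eq_or_ne a k with rfl | hne
    · rw [Function.update_self]
      exact hPlt j (by have := h.hi_eq; omega)
    · rw [Function.update_of_ne hne]
      exact h.lt a (by omega)
  surj := by
    intro b hb
    rcases eq_or_ne b j with rfl | hne
    · exact ⟨k, by omega, by rw [Function.update_self]⟩
    · obtain ⟨a, ha, e⟩ := h.surj b (by omega)
      exact ⟨a, by omega, by rw [Function.update_of_ne (by omega), e]⟩
  sorted := h.sorted_update hw hk fun a h1 h2 => h.right a j h1 h2 le_rfl hj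
  left := by
    intro a b h1 h2 h3 h4
    rcases eq_or_ne a k with rfl | hne
    · rw [Function.update_self]
      refine (hle (by omega)).trans (hP i b h3 (by have := h.mid_eq; omega) ?_)
      rw [h.div_eq_of_left hw le_rfl (by omega), h.div_eq_of_left hw h3 h4]
    · rw [Function.update_of_ne hne]
      exact h.left a b h1 (by omega) h3 h4
  right := by
    intro a b h1 h2 h3 h4
    rcases eq_or_ne a k with rfl | hne
    · rw [Function.update_self]
      refine hP j b (by omega) (by have := h.hi_eq; omega) ?_
      rw [h.div_eq_of_right hw le_rfl hj, h.div_eq_of_right hw (by omega) h4]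
    · rw [Function.update_of_ne hne]
      exact h.right a b h1 (by omega) (by omega) h4

/-- All blocks before `k` have been merged. -/
structure Merged (κ : ℕ → StepKey) (P T : ℕ → ℕ) (N w k : ℕ) : Prop where
  boundary : (∃ q, k = 2 * w * q) ∨ k = N
  lt : ∀ a < k, T a < N
  surj : ∀ b < k, ∃ a < k, T a = P b
  sorted : BlockSorted κ T k (2 * w)

theorem Merging.merged (h : Merging κ P T N w q i mid j hi hi) : Merged κ P T N w hi where
  boundary := by
    have := h.hi_eq
    rcases le_total N (2 * w * q + w + w) with h1 | h1
    · exact Or.inr (by omega)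
    · refine Or.inl ⟨q + 1, ?_⟩
      have : 2 * w * (q + 1) = 2 * w * q + w + w := by ring
      omega
  lt := h.lt
  surj := fun b hb => h.surj b (by
    have := h.i_le
    have := h.j_le
    have := h.k_eq
    omega)
  sorted := h.sorted

/-- As `k < N`, the merged part ends at a multiple of `2 w`. Nothing of the new pair has been
written, so the order conditions are vacuous. -/
theorem Merged.merging (h : Merged κ P T N w k) (hk : k < N) :
    ∃ q, Merging κ P T N w q k (min N (k + w)) (min N (k + w)) (min N (min N (k + w) + w)) k := by
  rcases h.boundary with ⟨q, rfl⟩ | rfl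
  · refine ⟨q, ⟨le_rfl, by omega, le_rfl, by omega, rfl, by omega, rfl, h.lt, ?_, h.sorted, ?_, ?_⟩⟩
    · intro b hb
      exact h.surj b (by omega)
    · intro a b h1 h2
      omega
    · intro a b h1 h2
      omega
  · omega

end Merge

namespace RealRAM

/-! Natural registers: `6` the number of steps; `10`, `12`, `11`, `13` the current positions in and
the ends of the two blocks; `14` the position in the target, the natural array `2`; `15` the length
of the blocks. -/

/-- Register `13` still holds the end of the previous pair of blocks, which is the start of the new
one. -/
def openBlock : Prog :=
  block [
    .setNat 10 (.reg 13),
    .setNat 12 (.add (.reg 13) (.reg 15)),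
    .cond (.natLt (.reg 6) (.reg 12)) (.setNat 12 (.reg 6)) .skip,
    .setNat 11 (.reg 12),
    .setNat 13 (.add (.reg 12) (.reg 15)),
    .cond (.natLt (.reg 6) (.reg 13)) (.setNat 13 (.reg 6)) .skip]

/-- Compare the keys of the steps at two positions of the permutation. -/
def stepLt (a b : NatExpr) : Test :=
  keyLt (.get 4 (.get 1 a)) (.get 0 (.get 1 a)) (.get 4 (.get 1 b)) (.get 0 (.get 1 b))

/-- When the right block is exhausted, the key comparison may read a cell outside it; the preceding
conjunct makes the outcome irrelevant. -/
def takeNext : Prog :=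
  .seq
    (.cond (.conj (.natLt (.reg 10) (.reg 12))
        (.neg (.conj (.natLt (.reg 11) (.reg 13)) (stepLt (.reg 11) (.reg 10)))))
      (.seq (.putNat 2 (.reg 14) (.get 1 (.reg 10))) (.setNat 10 (.add (.reg 10) (.const 1))))
      (.seq (.putNat 2 (.reg 14) (.get 1 (.reg 11))) (.setNat 11 (.add (.reg 11) (.const 1)))))
    (.setNat 14 (.add (.reg 14) (.const 1)))

/-- New blocks are opened inside the loop that writes single entries. One loop thus handles all
pairs of a round, and its number of passes is the number of steps. -/
def mergeStep : Prog := .seq (.cond (.natEq (.reg 14) (.reg 13)) openBlock .skip) takeNext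

def copyStep : Prog :=
  .seq (.putNat 1 (.reg 14) (.get 2 (.reg 14))) (.setNat 14 (.add (.reg 14) (.const 1)))

/-- One round: merge the blocks in pairs, copy the result back, and double the block length. -/
def roundProg : Prog :=
  block [.setNat 13 (.const 0), .setNat 14 (.const 0),
    .loop (.natLt (.reg 14) (.reg 6)) mergeStep,
    .setNat 14 (.const 0),
    .loop (.natLt (.reg 14) (.reg 6)) copyStep,
    .setNat 15 (.add (.reg 15) (.reg 15))]

/-- The initial width is `n + 1` instead of `1`, the length of the runs that are sorted from the
outset. -/
def sortProg : Prog :=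
  .seq (.setNat 15 (.add (.reg 0) (.const 1))) (.loop (.natLt (.reg 15) (.reg 6)) roundProg)

/-! ### Correctness and running time of the merge sort. -/

variable {s : State} {D : ScalingData} {P : ℕ → ℕ} {w : ℕ}

theorem State.Stores.congr {s s' : State} {N : ℕ} (h : s.Stores D N)
    (h1 : s'.realArr = s.realArr) (h2 : s'.natArr 0 = s.natArr 0) : s'.Stores D N :=
  ⟨by rw [h1, h2]; exact h.key, by rw [h1]; exact h.slope, by rw [h1]; exact h.offset⟩

/-- What the merging of blocks does not change. -/
structure MergeFrame (D : ScalingData) (P : ℕ → ℕ) (w : ℕ) (s : State) : Prop where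
  stores : s.Stores D D.size
  size : s.nat 6 = D.size
  perm : s.natArr 1 = P
  width : s.nat 15 = w

/-- The invariant of the merging loop. -/
structure MergeInv (D : ScalingData) (P : ℕ → ℕ) (w : ℕ) (s : State) : Prop where
  frame : MergeFrame D P w s
  le : s.nat 14 ≤ D.size
  state : (s.nat 14 = s.nat 13 ∧ Merged D.keyAt P (s.natArr 2) D.size w (s.nat 14)) ∨
    (s.nat 14 < s.nat 13 ∧ ∃ q, Merging D.keyAt P (s.natArr 2) D.size w q (s.nat 10) (s.nat 12)
      (s.nat 11) (s.nat 13) (s.nat 14))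

theorem run_openBlock (hf : MergeFrame D P w s) (hw : 0 < w) :
    MergeFrame D P w (openBlock.run s) ∧ (openBlock.run s).nat 14 = s.nat 14 ∧
    (openBlock.run s).natArr = s.natArr ∧
    (openBlock.run s).nat 10 = s.nat 13 ∧
    (openBlock.run s).nat 12 = min D.size (s.nat 13 + w) ∧
    (openBlock.run s).nat 11 = min D.size (s.nat 13 + w) ∧
    (openBlock.run s).nat 13 = min D.size (min D.size (s.nat 13 + w) + w) := by
  have h6 := hf.size
  have h15 := hf.width
  suffices h : ∃ s', openBlock.run s = s' ∧ s'.realArr = s.realArr ∧ s'.natArr = s.natArr ∧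
      s'.nat 6 = s.nat 6 ∧ s'.nat 15 = s.nat 15 ∧ s'.nat 14 = s.nat 14 ∧ s'.nat 10 = s.nat 13 ∧
      s'.nat 12 = min D.size (s.nat 13 + w) ∧ s'.nat 11 = min D.size (s.nat 13 + w) ∧
      s'.nat 13 = min D.size (min D.size (s.nat 13 + w) + w) by
    obtain ⟨s', e, h1, h2, h3, h4, h5, h7⟩ := h
    rw [e]
    exact ⟨⟨hf.stores.congr h1 (by rw [h2]), h3.trans h6, by rw [h2]; exact hf.perm,
      h4.trans h15⟩, h5, h2, h7⟩
  refine ⟨_, rfl, ?_⟩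
  simp only [openBlock, block, Prog.run, Test.Holds, NatExpr.eval]
  by_cases c1 : D.size < s.nat 13 + w
  · have e1 : min D.size (s.nat 13 + w) = D.size := by omega
    simp [h6, h15, c1, e1, hw]
  · have e1 : min D.size (s.nat 13 + w) = s.nat 13 + w := by omega
    by_cases c2 : D.size < s.nat 13 + w + w
    · have e2 : min D.size (s.nat 13 + w + w) = D.size := by omega
      simp [h6, h15, c1, c2, e1, e2]
    · have e2 : min D.size (s.nat 13 + w + w) = s.nat 13 + w + w := by omega
      simp [h6, h15, c1, c2, e1, e2]

theorem holds_stepLt (hf : MergeFrame D P w s) (hP : ∀ a < D.size, P a < D.size) {a b : NatExpr}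
    (ha : a.eval s < D.size) (hb : b.eval s < D.size) :
    (stepLt a b).Holds s ↔ D.keyAt (P (a.eval s)) < D.keyAt (P (b.eval s)) := by
  rw [stepLt, holds_keyLt]
  simp only [RealExpr.eval, NatExpr.eval, hf.perm]
  rw [hf.stores.key _ (hP _ ha), hf.stores.key _ (hP _ hb)]

theorem run_takeNext (hf : MergeFrame D P w s) (hP : PermutesBelow P D.size)
    (hs : BlockSorted D.keyAt P D.size w) (hw : 0 < w) {q : ℕ} (hlt : s.nat 14 < s.nat 13)
    (h : Merging D.keyAt P (s.natArr 2) D.size w q (s.nat 10) (s.nat 12) (s.nat 11) (s.nat 13)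
      (s.nat 14)) :
    MergeInv D P w (takeNext.run s) ∧ (takeNext.run s).nat 14 = s.nat 14 + 1 := by
  have hhi : s.nat 13 ≤ D.size := by have := h.hi_eq; omega
  have hmid : s.nat 12 ≤ D.size := by have := h.mid_eq; omega
  have finish : ∀ s' : State, s'.realArr = s.realArr → s'.natArr 0 = s.natArr 0 →
      s'.natArr 1 = s.natArr 1 → s'.nat 6 = s.nat 6 → s'.nat 15 = s.nat 15 →
      s'.nat 13 = s.nat 13 → s'.nat 14 = s.nat 14 + 1 →
      Merging D.keyAt P (s'.natArr 2) D.size w q (s'.nat 10) (s'.nat 12) (s'.nat 11) (s'.nat 13)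
        (s'.nat 14) → MergeInv D P w s' ∧ s'.nat 14 = s.nat 14 + 1 := by
    intro s' h1 h2 h3 h4 h5 h6 h7 h8
    refine ⟨⟨⟨hf.stores.congr h1 h2, h4.trans hf.size, h3.trans hf.perm, h5.trans hf.width⟩,
      by omega, ?_⟩, h7⟩
    rcases eq_or_ne (s'.nat 14) (s'.nat 13) with he | hne
    · refine Or.inl ⟨he, ?_⟩
      rw [he] at h8 ⊢
      exact h8.merged
    · exact Or.inr ⟨by omega, q, h8⟩
  have hcmp : s.nat 10 < s.nat 12 → s.nat 11 < s.nat 13 →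
      ((stepLt (.reg 11) (.reg 10)).Holds s ↔
        D.keyAt (P (s.nat 11)) < D.keyAt (P (s.nat 10))) := fun h1 h2 =>
    holds_stepLt hf hP.lt (show s.nat 11 < _ by omega) (show s.nat 10 < _ by omega)
  simp only [takeNext, Prog.run, NatExpr.eval]
  split_ifs with hc
  · obtain ⟨c1, c2⟩ := hc
    have c1 : s.nat 10 < s.nat 12 := c1
    refine finish _ rfl (by simp) (by simp) (by simp) (by simp) (by simp) (by simp) ?_
    have := h.takeLeft hw hlt hs hP.lt c1 fun c3 => by
      by_contra c4
      exact c2 ⟨c3, (hcmp c1 c3).2 (not_le.1 c4)⟩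
    simpa [hf.perm] using this
  · refine finish _ rfl (by simp) (by simp) (by simp) (by simp) (by simp) (by simp) ?_
    -- If the right block were exhausted, `k < hi` would leave an entry in the left one, and the
    -- test would have chosen it.
    have hcj : s.nat 11 < s.nat 13 := by
      by_contra c3
      have := h.k_eq
      have := h.j_le
      exact hc ⟨show s.nat 10 < s.nat 12 by omega, fun c4 => c3 c4.1⟩
    have := h.takeRight hw hlt hs hP.lt hcj fun c1 => by
      by_contra c4
      refine hc ⟨c1, fun c5 => c4 ?_⟩
      exact ((hcmp c1 hcj).1 c5.2).le
    simpa [hf.perm] using this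

theorem MergeInv.step (h : MergeInv D P w s) (hP : PermutesBelow P D.size)
    (hs : BlockSorted D.keyAt P D.size w) (hw : 0 < w) (hlt : s.nat 14 < D.size) :
    MergeInv D P w (mergeStep.run s) ∧ (mergeStep.run s).nat 14 = s.nat 14 + 1 := by
  rcases h.state with ⟨he, hm⟩ | ⟨hne, q, hm⟩
  · rw [mergeStep, Prog.run, Prog.run_cond_pos (show Test.Holds s (.natEq (.reg 14) (.reg 13)) from he)]
    obtain ⟨h1, h2, h3, h4, h5, h6, h7⟩ := run_openBlock h.frame hw
    rw [← h2]
    obtain ⟨q, hq⟩ := hm.merging hlt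
    refine run_takeNext (q := q) h1 hP hs hw (by omega) ?_
    rw [h2, h3, h4, h5, h6, h7, ← he]
    exact hq
  · rw [mergeStep, Prog.run, Prog.run_cond_neg
      (show ¬ Test.Holds s (.natEq (.reg 14) (.reg 13)) from hne.ne)]
    exact run_takeNext h.frame hP hs hw hne hm

theorem loopFree_mergeStep : mergeStep.LoopFree := by
  simp [mergeStep, openBlock, takeNext, block, Prog.LoopFree]

theorem MergeInv.halts (h : MergeInv D P w s) (hP : PermutesBelow P D.size)
    (hs : BlockSorted D.keyAt P D.size w) (hw : 0 < w) :
    Halts (.loop (.natLt (.reg 14) (.reg 6)) mergeStep) s ((D.size + 1) * (4 + mergeStep.cost))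
      fun s' => MergeFrame D P w s' ∧ PermutesBelow (s'.natArr 2) D.size ∧
        BlockSorted D.keyAt (s'.natArr 2) D.size (2 * w) := by
  have key := Halts.loop (b := .natLt (.reg 14) (.reg 6)) (c := mergeStep) (T := mergeStep.cost)
    (Inv := fun k s => MergeInv D P w s ∧ k = D.size - s.nat 14) (by
      rintro k s ⟨hi, rfl⟩ hb
      have hlt : s.nat 14 < D.size := by rw [← hi.frame.size]; exact hb
      obtain ⟨h1, h2⟩ := hi.step hP hs hw hlt
      exact loopFree_mergeStep.halts ⟨_, by omega, h1, rfl⟩) _ s ⟨h, rfl⟩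
  refine key.mono (Nat.mul_le_mul (by omega) ?_) ?_
  · simp only [Test.time, NatExpr.time]
    omega
  · rintro s' ⟨hb, k, hi, rfl⟩
    have hge : ¬ s'.nat 14 < D.size := by rw [← hi.frame.size]; exact hb
    have he : s'.nat 14 = D.size := le_antisymm hi.le (not_lt.1 hge)
    have hm : Merged D.keyAt P (s'.natArr 2) D.size w D.size := by
      rcases hi.state with ⟨-, hm⟩ | ⟨hne, q, hm⟩
      · rwa [he] at hm
      · have := hm.hi_eq
        omega
    refine ⟨hi.frame, ⟨hm.lt, fun v hv => ?_⟩, hm.sorted⟩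
    obtain ⟨b, hb, rfl⟩ := hP.surj v hv
    exact hm.surj b hb

theorem halts_copy {T : ℕ → ℕ} (hf : MergeFrame D P w s) (hT : s.natArr 2 = T)
    (h0 : s.nat 14 = 0) :
    Halts (.loop (.natLt (.reg 14) (.reg 6)) copyStep) s ((D.size + 1) * (4 + copyStep.cost))
      fun s' => s'.Stores D D.size ∧ s'.nat 6 = D.size ∧ s'.nat 15 = w ∧
        ∀ a < D.size, s'.natArr 1 a = T a := by
  have key := Halts.loop (b := .natLt (.reg 14) (.reg 6)) (c := copyStep) (T := copyStep.cost)
    (Inv := fun k s => (s.Stores D D.size ∧ s.nat 6 = D.size ∧ s.nat 15 = w ∧ s.natArr 2 = T ∧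
      ∀ a < s.nat 14, s.natArr 1 a = T a) ∧ k = D.size - s.nat 14) (by
      rintro k s ⟨⟨h1, h2, h3, h4, h5⟩, rfl⟩ hb
      have hlt : s.nat 14 < D.size := by rw [← h2]; exact hb
      refine Prog.LoopFree.halts (by simp [copyStep, Prog.LoopFree])
        ⟨D.size - (s.nat 14 + 1), by omega, ⟨h1.congr rfl ?_, ?_, ?_, ?_, ?_⟩, ?_⟩
      all_goals simp only [copyStep, Prog.run, NatExpr.eval]
      · simp
      · simpa using h2
      · simpa using h3
      · simpa using h4
      · intro a ha
        simp only [State.setN_nat, State.putN_nat, if_true] at ha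
        simp only [State.setN_natArr, State.putN_natArr, if_true]
        rcases eq_or_ne a (s.nat 14) with rfl | hne
        · rw [Function.update_self, h4]
        · rw [Function.update_of_ne hne]
          exact h5 a (by omega)
      · simp) _ s ⟨⟨hf.stores, hf.size, hf.width, hT, by simp [h0]⟩, rfl⟩
  refine key.mono (Nat.mul_le_mul (by omega) ?_) ?_
  · simp only [Test.time, NatExpr.time]
    omega
  · rintro s' ⟨hb, k, ⟨h1, h2, h3, h4, h5⟩, rfl⟩
    have hge : ¬ s'.nat 14 < D.size := by rw [← h2]; exact hb
    exact ⟨h1, h2, h3, fun a ha => h5 a (by omega)⟩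

/-- The invariant of the sorting loop. -/
structure SortInv (D : ScalingData) (w : ℕ) (s : State) : Prop where
  stores : s.Stores D D.size
  size : s.nat 6 = D.size
  width : s.nat 15 = w
  perm : PermutesBelow (s.natArr 1) D.size
  sorted : BlockSorted D.keyAt (s.natArr 1) D.size w

/-- The time of a round, up to the factor `D.size + 1`. -/
def roundCost : ℕ := mergeStep.cost + copyStep.cost + 20

theorem SortInv.round (h : SortInv D w s) (hw : 0 < w) :
    Halts roundProg s ((D.size + 1) * roundCost) (SortInv D (2 * w)) := by
  have h1 : MergeInv D (s.natArr 1) w ((s.setN 13 0).setN 14 0) := by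
    refine ⟨⟨h.stores.congr rfl rfl, by simpa using h.size, rfl, by simpa using h.width⟩,
      by simp, Or.inl ⟨by simp, ⟨Or.inl ⟨0, by simp⟩, ?_, ?_, ?_⟩⟩⟩
    · intro a ha; simp at ha
    · intro a ha; simp at ha
    · intro a b _ hb; simp at hb
  have e1 : Halts (.setNat 13 (.const 0)) s 2 fun s' => s' = s.setN 13 0 :=
    ⟨_, _, .setNat _ _ _, le_rfl, rfl⟩
  have e2 : ∀ s₁, s₁ = s.setN 13 0 → Halts (.setNat 14 (.const 0)) s₁ 2
      (MergeInv D (s.natArr 1) w) := by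
    rintro _ rfl
    exact ⟨_, _, .setNat _ _ _, le_rfl, h1⟩
  have e4 : ∀ s₃ : State, (MergeFrame D (s.natArr 1) w s₃ ∧ PermutesBelow (s₃.natArr 2) D.size ∧
        BlockSorted D.keyAt (s₃.natArr 2) D.size (2 * w)) →
      Halts (.setNat 14 (.const 0)) s₃ 2 fun s' => (MergeFrame D (s.natArr 1) w s' ∧
        PermutesBelow (s'.natArr 2) D.size ∧
        BlockSorted D.keyAt (s'.natArr 2) D.size (2 * w)) ∧ s'.nat 14 = 0 := by
    rintro s₃ ⟨⟨f1, f2, f3, f4⟩, hp, hb⟩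
    refine ⟨s₃.setN 14 0, _, .setNat _ _ _, le_rfl, ⟨⟨f1.congr rfl rfl, ?_, f3, ?_⟩, hp, hb⟩, ?_⟩
    · simpa using f2
    · simpa using f4
    · simp
  have e5 : ∀ s₄ : State, ((MergeFrame D (s.natArr 1) w s₄ ∧ PermutesBelow (s₄.natArr 2) D.size ∧
        BlockSorted D.keyAt (s₄.natArr 2) D.size (2 * w)) ∧ s₄.nat 14 = 0) →
      Halts (.loop (.natLt (.reg 14) (.reg 6)) copyStep) s₄
        ((D.size + 1) * (4 + copyStep.cost)) fun s' => s'.Stores D D.size ∧ s'.nat 6 = D.size ∧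
        s'.nat 15 = w ∧ PermutesBelow (s'.natArr 1) D.size ∧
        BlockSorted D.keyAt (s'.natArr 1) D.size (2 * w) := by
    rintro s₄ ⟨⟨f, hp, hb⟩, h0⟩
    refine (halts_copy f rfl h0).mono le_rfl ?_
    rintro s' ⟨g1, g2, g3, g4⟩
    refine ⟨g1, g2, g3, ⟨fun a ha => ?_, fun v hv => ?_⟩, fun a b hab hbN hdiv => ?_⟩
    · rw [g4 a ha]; exact hp.lt a ha
    · obtain ⟨a, ha, e⟩ := hp.surj v hv
      exact ⟨a, ha, by rw [g4 a ha, e]⟩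
    · rw [g4 a (by omega), g4 b hbN]
      exact hb a b hab hbN hdiv
  have e6 : ∀ s₅ : State, (s₅.Stores D D.size ∧ s₅.nat 6 = D.size ∧
        s₅.nat 15 = w ∧ PermutesBelow (s₅.natArr 1) D.size ∧
        BlockSorted D.keyAt (s₅.natArr 1) D.size (2 * w)) →
      Halts (.seq (.setNat 15 (.add (.reg 15) (.reg 15))) .skip) s₅ 5 (SortInv D (2 * w)) := by
    rintro s₅ ⟨g1, g2, g3, g4, g5⟩
    refine ⟨s₅.setN 15 (s₅.nat 15 + s₅.nat 15), _, .seq (.setNat _ _ _) (.skip _), le_rfl,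
      ⟨g1.congr rfl rfl, ?_, ?_, g4, g5⟩⟩
    · simpa using g2
    · simp [g3, two_mul]
  refine (e1.seq fun s₁ h₁ => (e2 s₁ h₁).seq fun s₂ h₂ => (h₂.halts h.perm h.sorted hw).seq
    fun s₃ h₃ => (e4 s₃ h₃).seq fun s₄ h₄ => (e5 s₄ h₄).seq e6).mono ?_ fun _ h => h
  -- Apart from the two loop bodies a round takes at most `8 (N + 1) + 11` units of time, where `N`
  -- is the number of steps.
  rw [roundCost]
  nlinarith

/-- There are `6 m ≤ 8 * 2 ^ r` runs of length `n + 1`, so `r + 3` doublings of the width suffice.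
-/
theorem size_le_of_le {D : ScalingData} {r : ℕ} (h : D.m ≤ 2 ^ r) :
    D.size ≤ (D.n + 1) * 2 ^ (r + 3) := by
  rw [ScalingData.size, Nat.mul_comm, pow_add]
  refine Nat.mul_le_mul_left _ ?_
  omega

/-- The exponent is the loop variant: doubling the width lowers it by one, and at exponent zero the
loop condition fails. -/
theorem halts_sortLoop (hw : 0 < w) (r : ℕ) (hr : D.size ≤ w * 2 ^ r) (h : SortInv D w s) :
    Halts (.loop (.natLt (.reg 15) (.reg 6)) roundProg) s
      ((r + 1) * (4 + (D.size + 1) * roundCost)) fun s' =>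
        ∃ w', D.size ≤ w' ∧ SortInv D w' s' := by
  have key := Halts.loop (b := .natLt (.reg 15) (.reg 6)) (c := roundProg)
    (T := (D.size + 1) * roundCost)
    (Inv := fun k s => ∃ w, 0 < w ∧ D.size ≤ w * 2 ^ k ∧ SortInv D w s) (by
      rintro k s ⟨w, hw, hk, hs⟩ hb
      have hlt : w < D.size := by rw [← hs.size, ← hs.width]; exact hb
      refine (hs.round hw).mono le_rfl fun s' hs' => ?_
      rcases k with _ | k
      · omega
      · exact ⟨k, by omega, 2 * w, by omega, by rw [pow_succ] at hk; linarith, hs'⟩) r s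
      ⟨w, hw, hr, h⟩
  refine key.mono (Nat.mul_le_mul le_rfl ?_) ?_
  · simp only [Test.time, NatExpr.time]
    omega
  · rintro s' ⟨hb, k, w, -, -, hs⟩
    refine ⟨w, ?_, hs⟩
    rw [← hs.size, ← hs.width]
    exact not_lt.1 hb

/-- The steps in the order of their keys. -/
structure Sorted (D : ScalingData) (s : State) : Prop where
  stores : s.Stores D D.size
  size : s.nat 6 = D.size
  perm : PermutesBelow (s.natArr 1) D.size
  mono : ∀ a b, a ≤ b → b < D.size → D.keyAt (s.natArr 1 a) ≤ D.keyAt (s.natArr 1 b)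

/-- Positions in the same block of width `n + 1` differ only in the reference index, so
`stepKey_mono` gives the invariant for the initial width. -/
theorem GenerateInv.halts_sort (hD : D.Valid) (h : GenerateInv D s) (hN : s.nat 6 = D.size)
    {r : ℕ} (hr : D.m ≤ 2 ^ r) :
    Halts sortProg s (4 + (r + 4) * (4 + (D.size + 1) * roundCost)) (Sorted D) := by
  have h1 : SortInv D (D.n + 1) (s.setN 15 (s.nat 0 + 1)) := by
    refine ⟨State.Stores.congr (s := s) (by rw [← hN]; exact h.stores) rfl rfl, by simpa using hN, ?_,
      ⟨fun a ha => ?_, fun v hv => ⟨v, hv, h.perm v (by omega)⟩⟩, fun a b hab hb hdiv => ?_⟩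
    · simp [← h.data, State.data]
    · simp only [State.setN_natArr]
      rw [h.perm a (by omega)]
      exact ha
    · simp only [State.setN_natArr]
      rw [h.perm a (by omega), h.perm b (by omega), ScalingData.keyAt, ScalingData.keyAt, hdiv]
      have h2 : a % (D.n + 1) ≤ b % (D.n + 1) := by
        have ha := Nat.div_add_mod a (D.n + 1)
        have hb := Nat.div_add_mod b (D.n + 1)
        rw [hdiv] at ha
        omega
      exact hD.stepKey_mono _ _ _ h2 (Nat.lt_succ_iff.1 (Nat.mod_lt _ (by omega)))
  have e1 : Halts (.setNat 15 (.add (.reg 0) (.const 1))) s 4 (SortInv D (D.n + 1)) :=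
    ⟨_, _, .setNat _ _ _, le_rfl, h1⟩
  refine (e1.seq fun s' hs' => halts_sortLoop (by omega) (r + 3) (size_le_of_le hr) hs').mono
    le_rfl ?_
  rintro s' ⟨w, hw, hs⟩
  refine ⟨hs.stores, hs.size, hs.perm, fun a b hab hb => hs.sorted a b hab hb ?_⟩
  rw [Nat.div_eq_of_lt (by omega), Nat.div_eq_of_lt (by omega)]

end RealRAM

/-! ## Sweeping over the steps -/

/-- The best value so far, where it is taken, and whether there (`0`), from the left (`1`) or from
the right (`2`); there is none as long as the side is `3`. -/
structure Best where
  value : ℝ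
  place : ℝ
  side : ℕ

namespace Best

open Classical in
/-- Replace a value by a better one, or by an equal one that is attained. -/
noncomputable def improve (b c : Best) : Best :=
  if b.side = 3 ∨ c.value < b.value ∨ (c.value = b.value ∧ c.side = 0) then c else b

/-- `b` is at least as good as `c`. -/
def Dominates (b c : Best) : Prop :=
  b.side ≠ 3 ∧ b.value ≤ c.value ∧ (c.side = 0 → c.value = b.value → b.side = 0)

/-- The value is a value of the function `φ` or a one-sided limit. -/
def Realised (b : Best) (φ : ℝ → ℝ) (L : ℝ) : Prop :=
  (b.side = 0 ∧ b.place ∈ Set.Icc 0 L ∧ φ b.place = b.value) ∨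
  (b.side = 1 ∧ b.place ∈ Set.Ioc 0 L ∧
    Filter.Tendsto φ (nhdsWithin b.place (Set.Iio b.place)) (nhds b.value)) ∨
  (b.side = 2 ∧ b.place ∈ Set.Ico 0 L ∧
    Filter.Tendsto φ (nhdsWithin b.place (Set.Ioi b.place)) (nhds b.value))

theorem Realised.side_ne {b : Best} {φ : ℝ → ℝ} {L : ℝ} (h : b.Realised φ L) : b.side ≠ 3 := by
  rcases h with ⟨h, -⟩ | ⟨h, -⟩ | ⟨h, -⟩ <;> omega

theorem improve_dominates {b c : Best} (hc : c.side ≠ 3) : (b.improve c).Dominates c := by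
  unfold improve
  split_ifs with h
  · exact ⟨hc, le_rfl, fun h _ => h⟩
  · push Not at h
    exact ⟨h.1, h.2.1, fun h0 he => absurd h0 (h.2.2 he)⟩

theorem Dominates.improve {b c d : Best} (h : b.Dominates d) (hc : c.side ≠ 3) :
    (b.improve c).Dominates d := by
  unfold Best.improve
  split_ifs with h'
  · rcases h' with h' | h' | ⟨h', h0⟩
    · exact absurd h' h.1
    · exact ⟨hc, h'.le.trans h.2.1, fun _ he => absurd h.2.1 (not_le.2 (he ▸ h'))⟩
    · exact ⟨hc, h' ▸ h.2.1, fun _ _ => h0⟩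
  · exact h

theorem Realised.improve {b c : Best} {φ : ℝ → ℝ} {L : ℝ} (hb : b.side = 3 ∨ b.Realised φ L)
    (hc : c.Realised φ L) : (b.improve c).Realised φ L := by
  unfold Best.improve
  split_ifs with h
  · exact hc
  · exact hb.resolve_left fun h3 => h (Or.inl h3)

/-- The three candidates on the interval between two keys, on which the cost is
`α * ε + β`. -/
noncomputable def improveOn (b : Best) (α β e e' : ℝ) (s s' : ℕ) : Best :=
  ((b.improve ⟨α * ((e + e') / 2) + β, (e + e') / 2, 0⟩).improve
    ⟨α * e + β, e, s + s⟩).improve ⟨α * e' + β, e', 1 - s'⟩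

end Best

theorem lt_germ_or_eq {e x : ℝ} {s : ℕ} (h : (toLex (e, s) : StepKey) ≤ germ x) :
    e < x ∨ (e = x ∧ s = 0) := by
  rw [germ, Prod.Lex.toLex_le_toLex] at h
  exact h.imp id fun h => ⟨h.1, by simpa using h.2⟩

theorem germ_lt_or_eq {e x : ℝ} {s : ℕ} (h : germ x < (toLex (e, s) : StepKey)) :
    x < e ∨ (x = e ∧ 0 < s) := by
  rwa [germ, Prod.Lex.toLex_lt_toLex] at h

theorem tendsto_nhdsLT_of_eq_affine {φ : ℝ → ℝ} {α β e e' : ℝ} (h : e < e')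
    (hφ : ∀ x, e < x → x < e' → φ x = α * x + β) :
    Filter.Tendsto φ (nhdsWithin e' (Set.Iio e')) (nhds (α * e' + β)) := by
  have h1 : Filter.Tendsto (fun x => α * x + β) (nhdsWithin e' (Set.Iio e'))
      (nhds (α * e' + β)) := (Continuous.tendsto (by fun_prop) e').mono_left nhdsWithin_le_nhds
  refine h1.congr' ?_
  filter_upwards [Ioo_mem_nhdsLT h] with x hx
  exact (hφ x hx.1 hx.2).symm

theorem tendsto_nhdsGT_of_eq_affine {φ : ℝ → ℝ} {α β e e' : ℝ} (h : e < e')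
    (hφ : ∀ x, e < x → x < e' → φ x = α * x + β) :
    Filter.Tendsto φ (nhdsWithin e (Set.Ioi e)) (nhds (α * e + β)) := by
  have h1 : Filter.Tendsto (fun x => α * x + β) (nhdsWithin e (Set.Ioi e))
      (nhds (α * e + β)) := (Continuous.tendsto (by fun_prop) e).mono_left nhdsWithin_le_nhds
  refine h1.congr' ?_
  filter_upwards [Ioo_mem_nhdsGT h] with x hx
  exact (hφ x hx.1 hx.2).symm

section Sweep

variable {φ : ℝ → ℝ} {L α β e e' : ℝ} {s s' : ℕ} {b : Best}

/-- The interval from the key `(e, s)` to the key `(e', s')` is treated correctly by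
`Best.improveOn`. -/
theorem Best.improveOn_spec (he : 0 ≤ e) (he' : e' ≤ L) (hs : s ≤ 1) (hs' : s' ≤ 1)
    (hlt : (toLex (e, s) : StepKey) < toLex (e', s'))
    (hφ : ∀ x, toLex (e, s) ≤ germ x → germ x < toLex (e', s') → φ x = α * x + β)
    (hb : b.side = 3 ∨ b.Realised φ L) :
    (b.improveOn α β e e' s s').Realised φ L ∧
    (∀ d, b.Dominates d → (b.improveOn α β e e' s s').Dominates d) ∧
    ∀ x, toLex (e, s) ≤ germ x → germ x < toLex (e', s') →
      (b.improveOn α β e e' s s').Dominates ⟨φ x, x, 0⟩ := by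
  have hlt' := hlt
  rw [Prod.Lex.toLex_lt_toLex] at hlt'
  simp only at hlt'
  have hee' : e ≤ e' := by rcases hlt' with h | ⟨h, -⟩ <;> linarith
  have hopen : ∀ x, e < x → x < e' → φ x = α * x + β := fun x h1 h2 => by
    refine hφ x ?_ ?_
    · rw [germ, Prod.Lex.toLex_le_toLex]; exact Or.inl h1
    · rw [germ, Prod.Lex.toLex_lt_toLex]; exact Or.inl h2
  have hleft : s = 0 → φ e = α * e + β := by
    rintro rfl
    exact hφ e le_rfl hlt
  have hright : s' = 1 → φ e' = α * e' + β := by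
    rintro rfl
    refine hφ e' ?_ ?_
    · rw [germ, Prod.Lex.toLex_le_toLex]
      rcases hlt' with h | ⟨h, h'⟩
      · exact Or.inl h
      · exact Or.inr ⟨h, by simp only; omega⟩
    · rw [germ, Prod.Lex.toLex_lt_toLex]
      exact Or.inr ⟨rfl, zero_lt_one⟩
  -- The midpoint is always attained: it is interior, or the interval is the single point from `(e,
  -- 0)` to `(e, 1)`.
  have c1 : Best.Realised ⟨α * ((e + e') / 2) + β, (e + e') / 2, 0⟩ φ L := by
    refine Or.inl ⟨rfl, ⟨?_, ?_⟩, ?_⟩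
    · simp only; linarith
    · simp only; linarith
    · rcases hlt' with h | ⟨h, h'⟩
      · exact hopen _ (by linarith) (by linarith)
      · subst h
        have : (e + e) / 2 = e := by ring
        simp only [this]
        exact hleft (by omega)
  -- With `s = 0` the left end belongs to the interval; with `s = 1` it is only a limit from the
  -- right, coded `2 = s + s`. At the right end the roles are reversed, and `1 - s'` codes value or
  -- limit from the left.
  have c2 : Best.Realised ⟨α * e + β, e, s + s⟩ φ L := by
    rcases Nat.le_one_iff_eq_zero_or_eq_one.1 hs with h | h
    · exact Or.inl ⟨by simp [h], ⟨he, hee'.trans he'⟩, hleft h⟩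
    · have h1 : e < e' := by rcases hlt' with h1 | ⟨-, h1⟩ <;> [exact h1; omega]
      exact Or.inr (Or.inr ⟨by simp [h], ⟨he, h1.trans_le he'⟩,
        tendsto_nhdsGT_of_eq_affine h1 hopen⟩)
  have c3 : Best.Realised ⟨α * e' + β, e', 1 - s'⟩ φ L := by
    rcases Nat.le_one_iff_eq_zero_or_eq_one.1 hs' with h | h
    · have h1 : e < e' := by rcases hlt' with h1 | ⟨-, h1⟩ <;> [exact h1; omega]
      exact Or.inr (Or.inl ⟨by simp [h], ⟨he.trans_lt h1, he'⟩,
        tendsto_nhdsLT_of_eq_affine h1 hopen⟩)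
    · exact Or.inl ⟨by simp [h], ⟨he.trans hee', he'⟩, hright h⟩
  have d1 : (b.improveOn α β e e' s s').Dominates
      ⟨α * ((e + e') / 2) + β, (e + e') / 2, 0⟩ :=
    ((Best.improve_dominates c1.side_ne).improve c2.side_ne).improve c3.side_ne
  have d2 : (b.improveOn α β e e' s s').Dominates ⟨α * e + β, e, s + s⟩ :=
    (Best.improve_dominates c2.side_ne).improve c3.side_ne
  have d3 : (b.improveOn α β e e' s s').Dominates ⟨α * e' + β, e', 1 - s'⟩ :=
    Best.improve_dominates c3.side_ne
  refine ⟨?_, fun d hd => ((hd.improve c1.side_ne).improve c2.side_ne).improve c3.side_ne, ?_⟩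
  · exact Best.Realised.improve (Or.inr (Best.Realised.improve
      (Or.inr (Best.Realised.improve hb c1)) c2)) c3
  · intro x hx hx'
    have hval := hφ x hx hx'
    rcases lt_germ_or_eq hx with h1 | ⟨rfl, rfl⟩
    · rcases germ_lt_or_eq hx' with h2 | ⟨rfl, h2⟩
      · have hpos : 0 < e' - e := by linarith
        -- An affine function at an interior point is at least the smaller of its values at the
        -- ends.
        have hv : (b.improveOn α β e e' s s').value ≤ α * x + β := by
          have h3 := d2.2.1
          have h4 := d3.2.1
          simp only at h3 h4
          nlinarith
        refine ⟨d1.1, by rw [hval]; exact hv, fun _ heq => d1.2.2 rfl ?_⟩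
        have h3 := d2.2.1
        have h4 := d3.2.1
        simp only at h3 h4 heq ⊢
        rw [hval] at heq
        -- An interior point can reach the optimum only if the function is constant. The midpoint
        -- then has the same value, so the tie rule makes the result an attained one.
        have hα : α = 0 := by
          rcases lt_trichotomy α 0 with h | h | h
          · nlinarith
          · exact h
          · nlinarith
        rw [hα] at heq ⊢
        linarith
      · obtain rfl : s' = 1 := by omega
        rw [hval]
        exact d3
    · rw [hval]
      exact d2

end Sweep

/-! The keys of the steps -/

namespace ScalingData

variable {D : ScalingData}

theorem side_clampKey_le {L e : ℝ} {s : ℕ} (hs : s ≤ 1) : (ofLex (clampKey L e s)).2 ≤ 1 := by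
  unfold clampKey
  split_ifs <;> simp [hs]

theorem side_passKey_le (c j : ℕ) : (ofLex (D.passKey c j)).2 ≤ 1 := by
  unfold passKey
  split_ifs <;> first | exact side_clampKey_le (by simp) | simp

theorem side_max_le {k l : StepKey} (hk : (ofLex k).2 ≤ 1) (hl : (ofLex l).2 ≤ 1) :
    (ofLex (max k l)).2 ≤ 1 := by
  rcases max_choice k l with h | h <;> rwa [h]

theorem side_min_le {k l : StepKey} (hk : (ofLex k).2 ≤ 1) (hl : (ofLex l).2 ≤ 1) :
    (ofLex (min k l)).2 ≤ 1 := by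
  rcases min_choice k l with h | h <;> rwa [h]

theorem side_stepKey_le (j u k c : ℕ) : (ofLex (D.stepKey j u k c)).2 ≤ 1 := by
  have h1 : (ofLex (D.winStart j u c)).2 ≤ 1 := by
    unfold winStart; split_ifs <;> exact side_passKey_le _ _
  have h2 : (ofLex (D.winEnd j u c)).2 ≤ 1 :=
    side_max_le h1 (by split_ifs <;> exact side_passKey_le _ _)
  unfold stepKey
  split_ifs
  · exact h1
  · refine side_max_le h1 (side_min_le ?_ h2)
    split_ifs
    · exact side_clampKey_le zero_le_one
    · unfold crossKey
      split_ifs <;> first | exact side_clampKey_le (by simp) | simp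
  · exact h2

theorem Valid.keyAt_bounds (hD : D.Valid) {k : ℕ} {e : ℝ} {s : ℕ} (h : toLex (e, s) = D.keyAt k) :
    0 ≤ e ∧ e ≤ D.L ∧ s ≤ 1 := by
  have h1 := hD.first_le_stepKey (k / (D.n + 1) / 3 / 2) (k / (D.n + 1) / 3 % 2)
    (k / (D.n + 1) % 3) (k % (D.n + 1))
  have h2 := hD.stepKey_le_last (k / (D.n + 1) / 3 / 2) (k / (D.n + 1) / 3 % 2)
    (k / (D.n + 1) % 3) (k % (D.n + 1))
  have h3 := D.side_stepKey_le (k / (D.n + 1) / 3 / 2) (k / (D.n + 1) / 3 % 2)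
    (k / (D.n + 1) % 3) (k % (D.n + 1))
  change _ ≤ D.keyAt k at h1
  change D.keyAt k ≤ _ at h2
  change (ofLex (D.keyAt k)).2 ≤ 1 at h3
  rw [← h] at h1 h2 h3
  rw [Prod.Lex.toLex_le_toLex'] at h1 h2
  exact ⟨h1.1, h2.1, h3⟩

/-- No admissible scaling comes before the first sorted key. The witness is the start of the window
with `j = 0`, `u = 1`, `c = 0`. -/
theorem Valid.exists_keyAt_first (hD : D.Valid) : ∃ k < D.size, D.keyAt k = toLex (0, 0) := by
  have hm := hD.m_pos
  obtain ⟨h1, h2, h3, h4⟩ := decode_number (n := D.n) (j := 0) (u := 1) (k := 0) (c := 0)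
    (by omega) (by omega) (by omega)
  refine ⟨((0 * 2 + 1) * 3 + 0) * (D.n + 1) + 0, ?_, ?_⟩
  rotate_left
  · rw [keyAt, h1, h2, h3, h4]
    simp [stepKey, winStart, passKey]
  · rw [size]
    have : ((0 * 2 + 1) * 3 + 0 + 1) * (D.n + 1) ≤ D.m * 2 * 3 * (D.n + 1) :=
      Nat.mul_le_mul_right _ (by omega)
    omega

/-- No admissible scaling comes at or after the last sorted key. The witness is the end of the
window with `j = 0`, `u = 1`, `c = n`. -/
theorem Valid.exists_keyAt_last (hD : D.Valid) : ∃ k < D.size, D.keyAt k = toLex (D.L, 1) := by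
  have hm := hD.m_pos
  obtain ⟨h1, h2, h3, h4⟩ := decode_number (n := D.n) (j := 0) (u := 1) (k := 2) (c := D.n)
    (by omega) (by omega) (by omega)
  refine ⟨((0 * 2 + 1) * 3 + 2) * (D.n + 1) + D.n, ?_, ?_⟩
  rotate_left
  · rw [keyAt, h1, h2, h3, h4]
    simp only [stepKey, winEnd, winStart, OfNat.ofNat_ne_zero, OfNat.ofNat_ne_one, one_ne_zero,
      if_false]
    rw [passKey_of_gt _ (Nat.lt_succ_self _)]
    exact max_eq_right (hD.passKey_le_last _ _)
  · rw [size]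
    have : ((0 * 2 + 1) * 3 + 2 + 1) * (D.n + 1) ≤ D.m * 2 * 3 * (D.n + 1) :=
      Nat.mul_le_mul_right _ (by omega)
    omega

/-- Between two consecutive keys the cost is the sum of the steps so far. -/
theorem scalingCost_eq_of_between {n m : ℕ} {R : PointMelody n} {Q : PointMelody m}
    (hV : (scalingData R Q).Valid) {P : ℕ → ℕ} (hP : PermutesBelow P (scalingData R Q).size)
    (hmono : ∀ a b, a ≤ b → b < (scalingData R Q).size →
      (scalingData R Q).keyAt (P a) ≤ (scalingData R Q).keyAt (P b))
    {k : ℕ} (hk : k + 1 < (scalingData R Q).size) {ε : ℝ} (h0 : 0 ≤ ε)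
    (hL : ε ≤ (scalingData R Q).L) (h1 : (scalingData R Q).keyAt (P k) ≤ germ ε)
    (h2 : germ ε < (scalingData R Q).keyAt (P (k + 1))) :
    scalingCost R Q ε = (∑ a ∈ Finset.range (k + 1), ((scalingData R Q).jumpAt (P a)).1) * ε +
      ∑ a ∈ Finset.range (k + 1), ((scalingData R Q).jumpAt (P a)).2 := by
  rw [scalingCost_eq_sum_steps hV h0 hL]
  set D := scalingData R Q
  have hreindex : ∀ f : ℕ → ℝ, ∑ v ∈ Finset.range D.size, f v =
      ∑ a ∈ Finset.range D.size, f (P a) := by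
    intro f
    symm
    refine Finset.sum_nbij P (fun a ha => ?_) hP.injOn (fun v hv => ?_) fun _ _ => rfl
    · exact Finset.mem_range.2 (hP.lt a (Finset.mem_range.1 ha))
    · obtain ⟨a, ha, rfl⟩ := hP.surj v (by simpa using hv)
      exact ⟨a, by simpa using ha, rfl⟩
  rw [hreindex, Finset.sum_mul, ← Finset.sum_add_distrib]
  symm
  -- In sorted order, the steps up to position `k` have taken effect and the later ones have not.
  refine Finset.sum_subset_zero_on_sdiff (fun a ha => ?_) (fun a ha => ?_) fun a ha => ?_
  · rw [Finset.mem_range] at ha ⊢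
    omega
  · rw [Finset.mem_sdiff, Finset.mem_range, Finset.mem_range] at ha
    rw [if_neg]
    exact not_le.2 (h2.trans_le (hmono _ _ (by omega) ha.1))
  · rw [Finset.mem_range] at ha
    rw [if_pos ((hmono a k (by omega) (by omega)).trans h1)]

end ScalingData

namespace RealRAM

/-! Natural registers: `0` the side of the best value; `14` the position in the sorted sequence;
`2`, `3` the current and the next step; `7`, `8` the sides of their keys. Real registers: `0`, `1`
the place and the best value; `4`, `5` slope and offset of the cost; `6`, `7` the times of the two
keys; `8`, `9` a candidate. -/

/-- The best value in the registers. -/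
def State.best (s : State) : Best := ⟨s.real 1, s.real 0, s.nat 0⟩

/-- The candidate in the registers `8` and `9`, with side `b`, is an improvement. -/
def improveTest (b : NatExpr) : Test :=
  .neg (.conj (.neg (.natEq (.reg 0) (.const 3)))
    (.conj (.neg (.realLt (.reg 8) (.reg 1)))
      (.neg (.conj (.realEq (.reg 8) (.reg 1)) (.natEq b (.const 0))))))

/-- Try the value at the place `a`. -/
def candidateProg (a : RealExpr) (b : NatExpr) : Prog :=
  block [
    .setReal 8 (.add (.mul (.reg 4) a) (.reg 5)),
    .setReal 9 a,
    .cond (improveTest b) (block [.setReal 1 (.reg 8), .setReal 0 (.reg 9), .setNat 0 b]) .skip]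

variable {s : State}

theorem holds_improveTest {b : NatExpr} : (improveTest b).Holds s ↔
    s.best.side = 3 ∨ s.real 8 < s.best.value ∨ (s.real 8 = s.best.value ∧ b.eval s = 0) := by
  simp only [improveTest, Test.Holds, RealExpr.eval, NatExpr.eval, State.best]
  tauto

/-- The place is evaluated a second time after register `8` has been overwritten, hence the
hypothesis on `a`. -/
theorem run_candidateProg {a : RealExpr} {b : NatExpr}
    (ha : ∀ y, a.eval (s.setR 8 y) = a.eval s) :
    ∃ s', (candidateProg a b).run s = s' ∧
      s'.best = s.best.improve ⟨s.real 4 * a.eval s + s.real 5, a.eval s, b.eval s⟩ ∧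
      (∀ r, r ≠ 0 → s'.nat r = s.nat r) ∧ (∀ r, 1 < r → r < 8 → s'.real r = s.real r) ∧
      s'.natArr = s.natArr ∧ s'.realArr = s.realArr := by
  obtain ⟨s₁, hs₁⟩ : ∃ s₁, s₁ = (s.setR 8 (s.real 4 * a.eval s + s.real 5)).setR 9 (a.eval s) :=
    ⟨_, rfl⟩
  have hrun : (candidateProg a b).run s = (Prog.cond (improveTest b)
      (block [.setReal 1 (.reg 8), .setReal 0 (.reg 9), .setNat 0 b]) .skip).run s₁ := by
    rw [hs₁]
    nth_rewrite 2 [← ha (s.real 4 * a.eval s + s.real 5)]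
    rfl
  have h8 : s₁.real 8 = s.real 4 * a.eval s + s.real 5 := by simp [hs₁]
  have h9 : s₁.real 9 = a.eval s := by simp [hs₁]
  have hb : b.eval s₁ = b.eval s := by simp [hs₁]
  have hbest : s₁.best = s.best := by simp [hs₁, State.best]
  have hr : ∀ r < 8, s₁.real r = s.real r := fun r hr => by
    simp [hs₁, show r ≠ 8 by omega, show r ≠ 9 by omega]
  have hn : s₁.nat = s.nat := by rw [hs₁]; rfl
  have hna : s₁.natArr = s.natArr := by rw [hs₁]; rfl
  have hra : s₁.realArr = s.realArr := by rw [hs₁]; rfl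
  have hiff := holds_improveTest (s := s₁) (b := b)
  rw [hbest, h8, hb] at hiff
  refine ⟨_, hrun, ?_⟩
  by_cases h : (improveTest b).Holds s₁
  · rw [Prog.run_cond_pos h, Best.improve, if_pos (hiff.1 h)]
    simp only [block, Prog.run, RealExpr.eval]
    refine ⟨by simp [State.best, h8, h9, hb], fun r h0 => by simp [h0, hn], fun r h1 h2 => ?_,
      hna, hra⟩
    simp [show r ≠ 0 by omega, show r ≠ 1 by omega, hr r h2]
  · rw [Prog.run_cond_neg h, Best.improve, if_neg (mt hiff.2 h)]
    exact ⟨hbest, fun r _ => by rw [← hn]; rfl, fun r _ h2 => hr r h2, hna, hra⟩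

/-- Load the next step, and add the current one to the cost. -/
def loadStep : Prog :=
  block [
    .setNat 2 (.get 1 (.reg 14)),
    .setNat 14 (.add (.reg 14) (.const 1)),
    .setNat 3 (.get 1 (.reg 14)),
    .setReal 4 (.add (.reg 4) (.get 5 (.reg 2))),
    .setReal 5 (.add (.reg 5) (.get 6 (.reg 2))),
    .setReal 6 (.get 4 (.reg 2)),
    .setReal 7 (.get 4 (.reg 3)),
    .setNat 7 (.get 0 (.reg 2)),
    .setNat 8 (.get 0 (.reg 3))]

def candidates : Prog :=
  block [
    candidateProg (.div (.add (.reg 6) (.reg 7)) (.const 2)) (.const 0),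
    candidateProg (.reg 6) (.add (.reg 7) (.reg 7)),
    candidateProg (.reg 7) (.sub (.const 1) (.reg 8))]

/-- Between equal keys there is no scaling. The partial sums there need not describe the cost
anywhere, so no candidate may be taken from them. -/
def sweepStep : Prog :=
  .seq loadStep (.cond (keyLt (.reg 6) (.reg 7) (.reg 7) (.reg 8)) candidates .skip)

/-- The natural register `0` loses the number of notes, which is no longer needed, and receives the
side `3` of "no value yet". -/
def sweepProg : Prog :=
  .seq (block [.setNat 14 (.const 0), .setNat 0 (.const 3), .setReal 4 (.const 0),
      .setReal 5 (.const 0)])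
    (.loop (.natLt (.add (.reg 14) (.const 1)) (.reg 6)) sweepStep)

theorem run_candidates :
    ∃ s', candidates.run s = s' ∧
      s'.best = s.best.improveOn (s.real 4) (s.real 5) (s.real 6) (s.real 7) (s.nat 7) (s.nat 8) ∧
      (∀ r, r ≠ 0 → s'.nat r = s.nat r) ∧ (∀ r, 1 < r → r < 8 → s'.real r = s.real r) ∧
      s'.natArr = s.natArr ∧ s'.realArr = s.realArr := by
  obtain ⟨s1, e1, b1, n1, r1, a1, A1⟩ := run_candidateProg (s := s)
    (a := .div (.add (.reg 6) (.reg 7)) (.const 2)) (b := .const 0)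
    (fun y => by simp [RealExpr.eval])
  obtain ⟨s2, e2, b2, n2, r2, a2, A2⟩ := run_candidateProg (s := s1)
    (a := .reg 6) (b := .add (.reg 7) (.reg 7)) (fun y => by simp [RealExpr.eval])
  obtain ⟨s3, e3, b3, n3, r3, a3, A3⟩ := run_candidateProg (s := s2)
    (a := .reg 7) (b := .sub (.const 1) (.reg 8)) (fun y => by simp [RealExpr.eval])
  refine ⟨s3, ?_, ?_, fun r hr => by rw [n3 r hr, n2 r hr, n1 r hr],
    fun r h1 h2 => by rw [r3 r h1 h2, r2 r h1 h2, r1 r h1 h2], by rw [a3, a2, a1],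
    by rw [A3, A2, A1]⟩
  · rw [← e3, ← e2, ← e1]; rfl
  · rw [b3, b2, b1]
    simp [RealExpr.eval, NatExpr.eval, r1, r2, n1, n2, Best.improveOn]

/-! ### Correctness of the sweep. -/

section Sweep

variable {n m : ℕ} {R : PointMelody n} {Q : PointMelody m}

/-- The invariant of the sweep. -/
structure SweepInv (R : PointMelody n) (Q : PointMelody m) (s : State) : Prop where
  sorted : Sorted (scalingData R Q) s
  lt : s.nat 14 < (scalingData R Q).size
  slope : s.real 4 =
    ∑ a ∈ Finset.range (s.nat 14), ((scalingData R Q).jumpAt (s.natArr 1 a)).1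
  offset : s.real 5 =
    ∑ a ∈ Finset.range (s.nat 14), ((scalingData R Q).jumpAt (s.natArr 1 a)).2
  best : s.best.side = 3 ∨ s.best.Realised (scalingCost R Q) (scalingData R Q).L
  dominates : ∀ x ∈ Set.Icc 0 (scalingData R Q).L,
    germ x < (scalingData R Q).keyAt (s.natArr 1 (s.nat 14)) →
      s.best.Dominates ⟨scalingCost R Q x, x, 0⟩

theorem Sorted.congr {D : ScalingData} {s s' : State} (h : Sorted D s)
    (h1 : s'.natArr = s.natArr) (h2 : s'.realArr = s.realArr) (h3 : s'.nat 6 = s.nat 6) :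
    Sorted D s' :=
  ⟨h.stores.congr h2 (by rw [h1]), h3.trans h.size, by rw [h1]; exact h.perm,
    by rw [h1]; exact h.mono⟩

theorem SweepInv.step (hV : (scalingData R Q).Valid) (h : SweepInv R Q s)
    (hlt : s.nat 14 + 1 < (scalingData R Q).size) :
    SweepInv R Q (sweepStep.run s) ∧ (sweepStep.run s).nat 14 = s.nat 14 + 1 := by
  set D := scalingData R Q with hD
  obtain ⟨s1, hs1⟩ : ∃ s1, s1 = loadStep.run s := ⟨_, rfl⟩
  have hS := h.sorted
  have hk := hS.perm.lt _ h.lt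
  have hk' := hS.perm.lt _ hlt
  have key1 := hS.stores.key _ hk
  have key2 := hS.stores.key _ hk'
  have q4 : s1.real 4 = ∑ a ∈ Finset.range (s.nat 14 + 1), (D.jumpAt (s.natArr 1 a)).1 := by
    rw [Finset.sum_range_succ, ← h.slope, ← hS.stores.slope _ hk]
    simp [hs1, loadStep, block, Prog.run, NatExpr.eval, RealExpr.eval]
  have q5 : s1.real 5 = ∑ a ∈ Finset.range (s.nat 14 + 1), (D.jumpAt (s.natArr 1 a)).2 := by
    rw [Finset.sum_range_succ, ← h.offset, ← hS.stores.offset _ hk]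
    simp [hs1, loadStep, block, Prog.run, NatExpr.eval, RealExpr.eval]
  have q6 : (toLex (s1.real 6, s1.nat 7) : StepKey) = D.keyAt (s.natArr 1 (s.nat 14)) := by
    rw [← key1]
    simp [hs1, loadStep, block, Prog.run, NatExpr.eval, RealExpr.eval]
  have q7 : (toLex (s1.real 7, s1.nat 8) : StepKey) = D.keyAt (s.natArr 1 (s.nat 14 + 1)) := by
    rw [← key2]
    simp [hs1, loadStep, block, Prog.run, NatExpr.eval, RealExpr.eval]
  have q14 : s1.nat 14 = s.nat 14 + 1 := by
    simp [hs1, loadStep, block, Prog.run, NatExpr.eval, RealExpr.eval]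
  have qN : s1.nat 6 = s.nat 6 := by
    simp [hs1, loadStep, block, Prog.run, NatExpr.eval, RealExpr.eval]
  have qb : s1.best = s.best := by
    simp [hs1, loadStep, block, Prog.run, NatExpr.eval, RealExpr.eval, State.best]
  have qn : s1.natArr = s.natArr := by rw [hs1]; rfl
  have qr : s1.realArr = s.realArr := by rw [hs1]; rfl
  have hrun : sweepStep.run s =
      (Prog.cond (keyLt (.reg 6) (.reg 7) (.reg 7) (.reg 8)) candidates .skip).run s1 := by
    rw [hs1]; rfl
  have hle := hS.mono (s.nat 14) (s.nat 14 + 1) (by omega) hlt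
  rw [hrun]
  by_cases hc : D.keyAt (s.natArr 1 (s.nat 14)) < D.keyAt (s.natArr 1 (s.nat 14 + 1))
  · rw [Prog.run_cond_pos (by rw [holds_keyLt]; simpa only [RealExpr.eval, NatExpr.eval, q6, q7])]
    obtain ⟨s2, e2, b2, n2, r2, a2, A2⟩ := run_candidates (s := s1)
    rw [e2]
    obtain ⟨u1, u2, u3⟩ := hV.keyAt_bounds q6
    obtain ⟨v1, v2, v3⟩ := hV.keyAt_bounds q7
    rw [← q6, ← q7] at hc
    have hspec := Best.improveOn_spec (φ := scalingCost R Q) (L := D.L) (α := s1.real 4)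
      (β := s1.real 5) (b := s1.best) u1 v2 u3 v3 hc (fun x hx hx' => by
        have hx0 : 0 ≤ x := by
          rcases lt_germ_or_eq hx with h | ⟨h, -⟩ <;> linarith
        have hxL : x ≤ D.L := by
          rcases germ_lt_or_eq hx' with h | ⟨h, -⟩ <;> linarith
        rw [q6] at hx
        rw [q7] at hx'
        rw [q4, q5]
        exact ScalingData.scalingCost_eq_of_between hV hS.perm hS.mono hlt hx0 hxL hx hx')
      (by rw [qb]; exact h.best)
    rw [← b2] at hspec
    obtain ⟨p1, p2, p3⟩ := hspec
    have e14 : s2.nat 14 = s.nat 14 + 1 := by rw [n2 14 (by norm_num), q14]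
    refine ⟨⟨hS.congr (a2.trans qn) (A2.trans qr) (by rw [n2 6 (by norm_num), qN]),
      by rw [e14]; exact hlt, ?_, ?_,
      Or.inr p1, fun x hx hlt => ?_⟩, e14⟩
    · rw [r2 4 (by norm_num) (by norm_num), q4, e14, a2, qn]
    · rw [r2 5 (by norm_num) (by norm_num), q5, e14, a2, qn]
    · rw [a2, qn, e14] at hlt
      -- Earlier scalings stay dominated because the best value only improves; those of the current
      -- interval are handled by its three candidates.
      rcases lt_or_ge (germ x) (D.keyAt (s.natArr 1 (s.nat 14))) with h1 | h1
      · exact p2 _ (qb ▸ h.dominates x hx h1)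
      · refine p3 x ?_ ?_
        · rw [q6]; exact h1
        · rw [q7]; exact hlt
  · rw [Prog.run_cond_neg (by rw [holds_keyLt]; simpa only [RealExpr.eval, NatExpr.eval, q6, q7])]
    refine ⟨⟨hS.congr qn qr qN, ?_, ?_, ?_, ?_, fun x hx hlt => ?_⟩, q14⟩
    · rw [Prog.run, q14]; exact hlt
    · rw [Prog.run, q4, q14, qn]
    · rw [Prog.run, q5, q14, qn]
    · rw [Prog.run, qb]; exact h.best
    · rw [Prog.run] at hlt ⊢
      rw [qn, q14] at hlt
      rw [qb]
      exact h.dominates x hx (hlt.trans_le (not_lt.1 hc))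

theorem loopFree_sweepStep : sweepStep.LoopFree := by
  simp [sweepStep, loadStep, candidates, candidateProg, block, Prog.LoopFree]

/-- Domination makes the value a lower bound, and realisation as a value or a limit makes it the
greatest one. A minimiser would tie with it, and the tie rule would then force side `0`. -/
theorem Best.isOptimalScaling {b : Best} (hb : b.Realised (scalingCost R Q) (scalingData R Q).L)
    (hdom : ∀ x ∈ Set.Icc 0 (scalingData R Q).L, b.Dominates ⟨scalingCost R Q x, x, 0⟩) :
    IsOptimalScaling R Q b.place b.value b.side := by
  have hI : scalingRange R Q = Set.Icc 0 (scalingData R Q).L := rfl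
  unfold IsOptimalScaling
  rw [hI]
  have hlow : b.value ∈ lowerBounds (scalingCost R Q '' Set.Icc 0 (scalingData R Q).L) := by
    rintro _ ⟨x, hx, rfl⟩
    exact (hdom x hx).2.1
  have hnomin : b.side ≠ 0 → IsGLB (scalingCost R Q '' Set.Icc 0 (scalingData R Q).L) b.value →
      ¬ ∃ ε' ∈ Set.Icc 0 (scalingData R Q).L,
        IsMinOn (scalingCost R Q) (Set.Icc 0 (scalingData R Q).L) ε' := by
    rintro h0 hglb ⟨x, hx, hmin⟩
    refine h0 ((hdom x hx).2.2 rfl (le_antisymm (hglb.2 ?_) (hdom x hx).2.1))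
    rintro _ ⟨y, hy, rfl⟩
    exact hmin hy
  rcases hb with ⟨h0, hmem, hval⟩ | ⟨h1, hmem, hlim⟩ | ⟨h2, hmem, hlim⟩
  · refine ⟨hmem, ⟨hlow, fun w hw => ?_⟩, Or.inl ⟨h0, fun x hx => ?_, hval⟩⟩
    · rw [← hval]
      exact hw ⟨_, hmem, rfl⟩
    · show scalingCost R Q b.place ≤ scalingCost R Q x
      rw [hval]
      exact (hdom x hx).2.1
  · have hglb : IsGLB (scalingCost R Q '' Set.Icc 0 (scalingData R Q).L) b.value := by
      refine ⟨hlow, fun w hw => ge_of_tendsto hlim ?_⟩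
      filter_upwards [Ioo_mem_nhdsLT hmem.1] with x hx
      exact hw ⟨x, ⟨hx.1.le, hx.2.le.trans hmem.2⟩, rfl⟩
    exact ⟨⟨hmem.1.le, hmem.2⟩, hglb, Or.inr ⟨hnomin (by omega) hglb, Or.inl ⟨h1, hmem.1, hlim⟩⟩⟩
  · have hglb : IsGLB (scalingCost R Q '' Set.Icc 0 (scalingData R Q).L) b.value := by
      refine ⟨hlow, fun w hw => ge_of_tendsto hlim ?_⟩
      filter_upwards [Ioo_mem_nhdsGT hmem.2] with x hx
      exact hw ⟨x, ⟨hmem.1.trans hx.1.le, hx.2.le⟩, rfl⟩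
    exact ⟨⟨hmem.1, hmem.2.le⟩, hglb, Or.inr ⟨hnomin (by omega) hglb, Or.inr ⟨h2, hmem.2, hlim⟩⟩⟩

theorem Sorted.halts_sweep (hV : (scalingData R Q).Valid) (h : Sorted (scalingData R Q) s) :
    Halts sweepProg s (9 + ((scalingData R Q).size + 1) * (6 + sweepStep.cost)) fun s' =>
      IsOptimalScaling R Q (s'.real 0) (s'.real 1) (s'.nat 0) := by
  set D := scalingData R Q with hD
  obtain ⟨k₀, hk₀, hfirst⟩ := hV.exists_keyAt_first
  obtain ⟨k₁, hk₁, hlast⟩ := hV.exists_keyAt_last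
  have e1 : Halts (block [.setNat 14 (.const 0), .setNat 0 (.const 3), .setReal 4 (.const 0),
      .setReal 5 (.const 0)]) s 9 (SweepInv R Q) := by
    refine Prog.LoopFree.halts (by simp [block, Prog.LoopFree]) ?_
    simp only [block, Prog.run, NatExpr.eval, RealExpr.eval]
    refine ⟨h.congr rfl rfl (by simp), ?_, by simp, by simp, Or.inl (by simp [State.best]),
      fun x hx hlt => ?_⟩
    · simp only [State.setR_nat, State.setN_nat]
      norm_num
      exact k₀.zero_le.trans_lt hk₀
    -- Initially nothing has to be dominated, since the least key is `(0, 0)`.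
    · exfalso
      simp only [State.setR_nat, State.setN_nat, State.setR_natArr, State.setN_natArr] at hlt
      norm_num at hlt
      obtain ⟨a, ha, rfl⟩ := h.perm.surj k₀ hk₀
      have h1 := h.mono 0 a (Nat.zero_le a) ha
      rw [hfirst] at h1
      exact absurd (first_le_germ hx.1) (not_le.2 (hlt.trans_le h1))
  have key : ∀ s, SweepInv R Q s → Halts (.loop (.natLt (.add (.reg 14) (.const 1)) (.reg 6))
      sweepStep) s ((D.size + 1) * (6 + sweepStep.cost)) fun s' =>
        IsOptimalScaling R Q (s'.real 0) (s'.real 1) (s'.nat 0) := by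
    intro s hs
    have key := Halts.loop (b := .natLt (.add (.reg 14) (.const 1)) (.reg 6)) (c := sweepStep)
      (T := sweepStep.cost) (Inv := fun k s => SweepInv R Q s ∧ k = D.size - s.nat 14) (by
        rintro k s ⟨hi, rfl⟩ hb
        have hlt : s.nat 14 + 1 < D.size := by rw [← hi.sorted.size]; exact hb
        obtain ⟨h1, h2⟩ := hi.step hV hlt
        exact loopFree_sweepStep.halts ⟨_, by omega, h1, rfl⟩) _ s ⟨hs, rfl⟩
    refine key.mono (Nat.mul_le_mul (by omega) ?_) ?_
    · simp only [Test.time, NatExpr.time]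
      omega
    · rintro s' ⟨hb, k, hi, rfl⟩
      have hge : ¬ s'.nat 14 + 1 < D.size := by rw [← hi.sorted.size]; exact hb
      have hdom : ∀ x ∈ Set.Icc 0 D.L, s'.best.Dominates ⟨scalingCost R Q x, x, 0⟩ := by
        intro x hx
        -- At the end the current step is the last one; its key is at least `(L, 1)` and exceeds
        -- every admissible scaling.
        refine hi.dominates x hx ?_
        obtain ⟨a, ha, rfl⟩ := hi.sorted.perm.surj k₁ hk₁
        have h1 := hi.sorted.mono a (s'.nat 14)
          (by have ha' : a < D.size := ha; omega) hi.lt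
        rw [hlast] at h1
        exact lt_of_lt_of_le (not_le.1 (not_last_le_germ hx.2)) h1
      have h0 := (hdom 0 ⟨le_rfl, hV.L_nonneg⟩).1
      exact Best.isOptimalScaling (hi.best.resolve_left h0) hdom
  exact e1.seq key

end Sweep

/-! ## The algorithm -/

/-- Generate the steps of the cost function, sort them, and sweep over them. -/
def optimalScalingProg : Prog :=
  .seq rangeProg (.seq generateProg (.seq sortProg sweepProg))

/-- The time of the algorithm, up to the factor `n * m * log m`. -/
def timeFactor : ℕ :=
  200 + 13 * stepProg.cost + 13 * roundCost + 13 * sweepStep.cost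

theorem halts_optimalScalingProg {n m : ℕ} (hn : 0 < n) (hm : 0 < m) (R : PointMelody n)
    (Q : PointMelody m) (h : Q.duration ≤ R.duration) :
    Halts optimalScalingProg (input R Q) (timeFactor * (n * m * (Nat.log 2 m + 5))) fun s =>
      IsOptimalScaling R Q (s.real 0) (s.real 1) (s.nat 0) := by
  have hV : (scalingData R Q).Valid := ScalingData.valid_scalingData hn hm h
  have hr : (scalingData R Q).m ≤ 2 ^ (Nat.log 2 m + 1) :=
    (Nat.lt_pow_succ_log_self (by norm_num) m).le
  refine ((halts_rangeProg R Q).seq fun s₁ h₁ => h₁.halts.seq fun s₂ h₂ =>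
    (h₂.1.halts_sort hV h₂.2 hr).seq fun s₃ h₃ => h₃.halts_sweep hV).mono ?_ fun _ h => h
  -- `6 m (n + 1) + 1 = 6 n m + 6 m + 1`, where `m` and `1` are at most `n m`.
  have hsize : (scalingData R Q).size + 1 ≤ 13 * (n * m) := by
    have e : (scalingData R Q).size = m * 2 * 3 * (n + 1) := rfl
    have h1 : m ≤ n * m := Nat.le_mul_of_pos_left m hn
    have h2 : 1 ≤ n * m := Nat.mul_pos hn hm
    rw [e]
    linarith
  have hm' : m + 1 ≤ 2 * (n * m) := by
    have h1 : m ≤ n * m := Nat.le_mul_of_pos_left m hn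
    have h2 : 1 ≤ n * m := Nat.mul_pos hn hm
    omega
  have hnm : 1 ≤ n * m := Nat.mul_pos hn hm
  generalize (scalingData R Q).size + 1 = N at hsize ⊢
  generalize n * m = z at *
  generalize Nat.log 2 m = l
  have b1 : (m + 1) * 20 + 10 ≤ 50 * z := by omega
  have b2 : N * (4 + stepProg.cost) ≤ (13 * z) * (4 + stepProg.cost) := Nat.mul_le_mul_right _ hsize
  have b3 : (l + 1 + 4) * (4 + N * roundCost) ≤ (l + 5) * (4 * z + 13 * z * roundCost) :=
    Nat.mul_le_mul (by omega)
      (Nat.add_le_add (by omega) (Nat.mul_le_mul_right _ hsize))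
  have b4 : N * (6 + sweepStep.cost) ≤ (13 * z) * (6 + sweepStep.cost) :=
    Nat.mul_le_mul_right _ hsize
  calc _ ≤ 50 * z + ((13 * z) * (4 + stepProg.cost) +
          (4 * z + (l + 5) * (4 * z + 13 * z * roundCost) +
            (9 * z + (13 * z) * (6 + sweepStep.cost)))) := by omega
    _ = z * ((193 + 13 * stepProg.cost + 13 * sweepStep.cost) * 1 +
          (4 + 13 * roundCost) * (l + 5)) := by ring
    _ ≤ z * ((193 + 13 * stepProg.cost + 13 * sweepStep.cost) * (l + 5) +
          (4 + 13 * roundCost) * (l + 5)) :=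
        Nat.mul_le_mul_left _ (Nat.add_le_add_right (Nat.mul_le_mul_left _ (by omega)) _)
    _ = (197 + 13 * stepProg.cost + 13 * roundCost + 13 * sweepStep.cost) * (z * (l + 5)) := by ring
    _ ≤ timeFactor * (z * (l + 5)) := Nat.mul_le_mul_right _ (by rw [timeFactor]; omega)

end RealRAM

/-- The constant `5` is absorbed by `log (m + 1) ≥ log 2`; with `log m` in its place this would fail
for `m = 1`. -/
theorem natLog_add_le {m : ℕ} (hm : 0 < m) :
    ((Nat.log 2 m + 5 : ℕ) : ℝ) ≤ 6 / Real.log 2 * Real.log (m + 1) := by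
  have h2 : 0 < Real.log 2 := Real.log_pos (by norm_num)
  have hm1 : (1 : ℝ) ≤ m := by exact_mod_cast hm
  have h3 : Real.log 2 ≤ Real.log (m + 1) := Real.log_le_log (by norm_num) (by linarith)
  have h4 : (Nat.log 2 m : ℝ) ≤ Real.log (m + 1) / Real.log 2 := by
    refine (Real.natLog_le_logb m 2).trans ?_
    rw [Real.logb, Nat.cast_ofNat]
    exact div_le_div_of_nonneg_right (Real.log_le_log (by linarith) (by linarith)) h2.le
  have h5 : 1 ≤ Real.log (m + 1) / Real.log 2 := by rwa [le_div_iff₀ h2, one_mul]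
  push_cast
  calc (Nat.log 2 m : ℝ) + 5 ≤ 6 * (Real.log (m + 1) / Real.log 2) := by linarith
    _ = 6 / Real.log 2 * Real.log (m + 1) := by ring

theorem mainTheorem2 :
    -- the cost is linear between events, of which there are `O(nm)`
    (∃ K : ℕ, ∀ (n m : ℕ), 0 < n → 0 < m → ∀ (R : PointMelody n) (Q : PointMelody m),
      (events R Q).Finite ∧ (events R Q).ncard ≤ K * (n * m) ∧
      ∀ a b : ℝ, 0 ≤ a → a < b → Disjoint (Set.Ioo a b) (events R Q) →
        ∃ α β : ℝ, ∀ ε ∈ Set.Ioo a b, scalingCost R Q ε = α * ε + β) ∧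
    -- the cost may be discontinuous at an event
    (∃ (n m : ℕ) (R : PointMelody n) (Q : PointMelody m) (ε : ℝ),
      ε ∈ interior (scalingRange R Q) ∧ ε ∈ events R Q ∧
      ¬ ContinuousAt (scalingCost R Q) ε) ∧
    -- an optimal scaling is computed in `O(nm log m)` time
    (∃ (prog : RealRAM.Prog) (C : ℝ), ∀ (n m : ℕ), 0 < n → 0 < m →
      ∀ (R : PointMelody n) (Q : PointMelody m), Q.duration ≤ R.duration →
        ∃ (s : RealRAM.State) (t : ℕ),
          RealRAM.Exec prog (RealRAM.input R Q) s t ∧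
          (t : ℝ) ≤ C * (n * m * Real.log (m + 1)) ∧
          IsOptimalScaling R Q (s.real 0) (s.real 1) (s.nat 0)) := by
  refine ⟨⟨3, fun n m _ _ R Q => ?_⟩, exists_discontinuous_event,
    RealRAM.optimalScalingProg, RealRAM.timeFactor * (6 / Real.log 2), fun n m hn hm R Q h => ?_⟩
  · obtain ⟨h1, h2⟩ := events_finite_and_ncard_le R Q
    exact ⟨h1, h2, fun a b ha _ hdis => scalingCost_affine R Q ha hdis⟩
  · obtain ⟨s, t, h1, h2, h3⟩ := RealRAM.halts_optimalScalingProg hn hm R Q h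
    refine ⟨s, t, h1, ?_, h3⟩
    calc (t : ℝ) ≤ ((RealRAM.timeFactor * (n * m * (Nat.log 2 m + 5)) : ℕ) : ℝ) := by
          exact_mod_cast h2
      _ = RealRAM.timeFactor * (n * m) * ((Nat.log 2 m + 5 : ℕ) : ℝ) := by push_cast; ring
      _ ≤ RealRAM.timeFactor * (n * m) * (6 / Real.log 2 * Real.log (m + 1)) :=
          mul_le_mul_of_nonneg_left (natLog_add_le hm) (by positivity)
      _ = RealRAM.timeFactor * (6 / Real.log 2) * (n * m * Real.log (m + 1)) := by ring
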